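/- All homology and cohomology is singular with integer coefficients. Let $U$ be a path-connected space, $u\in U$, $G=\pi_1(U,u)$; write $H_i=H_i(U)$, $H^i=H^i(U)$, and $C^i$, $Z^i$ for singular cochains and cocycles. Let $\gamma_1G=G$, $\gamma_{k+1}G=(G,\gamma_kG)$. Consider the conditions, for some $n$: 1. $G/G'$ is free abelian of rank $n$; 2. $G$ is generated by $n$ elements; 3. the homomorphism $\bar\Delta:H_2\to H_1\otimes H_1$ induced by the (Alexander–Whitney) comultiplication is injective. Notation. Let $\mu:C^1\otimes C^1\to C^2$ be the cup product of cochains, $\bar\mu:H^1\otimes H^1\to H^2$ and $\bar{\bar\mu}:\Lambda^2H^1\to H^2$ the cup products in cohomology, $\eta_2:H^1\otimes H^1\to\Lambda^2H^1$ the projection, $R^2=\operatorname{Ker}\bar\mu$, $\bar R^2=\operatorname{Ker}\bar{\bar\mu}$, $Q^3=R^2\otimes H^1\cap H^1\otimes R^2\subset (H^1)^{\otimes 3}$, and $\bar Q^3=\operatorname{Ker}(H^1\otimes\bar R^2\to\Lambda^3H^1)$, $x\otimes r\mapsto x\wedge r$. Let $P_2$ be the image of $[H_1,H_1]$ in $H_1^{\otimes2}/\bar\Delta(H_2)$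 and $P_3$ the image of $[H_1,[H_1,H_1]]$ in $H_1^{\otimes 3}/(\bar\Delta(H_2)\otimes H_1+H_1\otimes\bar\Delta(H_2))$, where $[x,y]=x\otimes y-y\otimes x$. The class $[\lambda]$. Fix a basis $\xi_1,\dots,\xi_n$ of $H^1$. Choose a homomorphism $\varkappa:H^1\to Z^1$ right inverse to the projection and a homomorphism $\nu:R^2\to C^1$ with $\mu\circ(\varkappa\otimes\varkappa)=d\circ\nu$ on $R^2$, $\nu(\xi_i\otimes\xi_i)=\zeta(\varkappa\xi_i)$, and $\nu(\xi_i\otimes\xi_j+\xi_j\otimes\xi_i)=\zeta(\varkappa(\xi_i+\xi_j))-\zeta(\varkappa\xi_i)-\zeta(\varkappa\xi_j)$ for $i\neq j$, where $\zeta(\omega)(a)=(\omega(a)-\omega(a)^2)/2$ for every singular $1$-simplex $a$. Let $\bar\lambda:Q^3\to H^2$ send $q$ to the class of $\mu\bigl((\nu\otimes\varkappa+\varkappa\otimes\nu)(q)\bigr)$. For $t=\sum_i\xi_i\otimes\sum_{j<k}\alpha_{ijk}\,\xi_j\wedge\xi_k\in\bar Q^3$ put $$pt=\sum_{i<j<k}\bigl(\alpha_{jik}(\xi_i\otimes\xi_j\otimes\xi_k+\xi_j\otimes\xi_i\otimes\xi_k)+\alpha_{kij}(\xi_i\otimes\xi_k\otimes\xi_j+\xi_k\otimes\xi_i\otimes\xi_j)\bigr)+\sum_{i<j}\bigl(\alpha_{iij}\,\xi_i\otimes\xi_i\otimes\xi_j-\alpha_{jij}\,\xi_j\otimes\xi_j\otimes\xi_i\bigr)\in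 Q^3,$$ and $\bar{\bar\lambda}=\bar\lambda\circ p:\bar Q^3\to H^2$. Then $[\lambda]$ is the class of $\bar{\bar\lambda}$ in $\operatorname{Hom}(\bar Q^3,H^2)$ modulo all maps $\bar\mu\circ(\mathrm{id}\otimes g\eta_2+g\eta_2\otimes\mathrm{id})\circ p$ with $g\in\operatorname{Hom}(\bar R^2,H^1)$. Theorem. Let $(U_a,u_a)$ and $(U_b,u_b)$ satisfy (1)–(3), with $G_a,G_b$ their fundamental groups, and identify $H_1(U_a)=G_a/\gamma_2G_a$, $H_1(U_b)=G_b/\gamma_2G_b$. Let $f:H_1(U_a)\to H_1(U_b)$ be an isomorphism and $\varphi:H^1(U_b)\to H^1(U_a)$ its dual. (i) If $f$ extends to an isomorphism $G_a/\gamma_3G_a\to G_b/\gamma_3G_b$, then $\Lambda^2\varphi(\bar R^2_b)=\bar R^2_a$. If $P_2^{(a)}$ and $P_2^{(b)}$ are free abelian, then conversely $\Lambda^2\varphi(\bar R^2_b)=\bar R^2_a$ implies that $f$ extends to an isomorphism $G_a/\gamma_3G_a\to G_b/\gamma_3G_b$. (ii) Suppose that $\Lambda^2\varphi(\bar R^2_b)=\bar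 R^2_a$ and that $P_3^{(a)}$ and $P_3^{(b)}$ are free abelian. Form $[\lambda_b]$ with any basis of $H^1(U_b)$ and $[\lambda_a]$ with its image under $\varphi$. Then $f$ extends to an isomorphism $G_a/\gamma_4G_a\to G_b/\gamma_4G_b$ if and only if $[\lambda_a]$ corresponds to $[\lambda_b]$, that is, there are an isomorphism $\psi:H^2(U_b)\to H^2(U_a)$ with $\psi(x\smile y)=\varphi(x)\smile\varphi(y)$ for all $x,y\in H^1(U_b)$ and representatives $\bar{\bar\lambda}_a,\bar{\bar\lambda}_b$ of the two classes such that $\bar{\bar\lambda}_a\circ(\varphi\otimes\Lambda^2\varphi)=\psi\circ\bar{\bar\lambda}_b$ on $\bar Q^3_b$. -/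

import Mathlib

open scoped TensorProduct

universe u v

/- Every `ℤ`-module structure below is the one coming from the construction of the group; the generic
instance on abelian groups (equal to it) is only a fallback. -/
attribute [local instance 10] AddCommGroup.toIntModule

noncomputable section

namespace TripleMassey

/-! ### Multilinear algebra over `ℤ` -/

section Algebra

variable (M : Type*) [AddCommGroup M] [Module ℤ M]

/-- The canonical projection `η₂ : M ⊗ M → Λ² M`, `x ⊗ y ↦ x ∧ y`. -/
def eta₂ : M ⊗[ℤ] M →ₗ[ℤ] ⋀[ℤ]^2 M :=
  have e0 : ∀ a b c : M, Function.update ![a, b] 0 c = ![c, b] := by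
    intro a b c; ext i; fin_cases i <;> rfl
  have e1 : ∀ a b c : M, Function.update ![a, b] 1 c = ![a, c] := by
    intro a b c; ext i; fin_cases i <;> rfl
  TensorProduct.lift <| LinearMap.mk₂ ℤ (fun x y => exteriorPower.ιMulti ℤ 2 ![x, y])
    (fun x x' y => by
      have := (exteriorPower.ιMulti ℤ 2 (M := M)).map_update_add ![x, y] 0 x x'
      rwa [e0, e0, e0] at this)
    (fun c x y => by
      have := (exteriorPower.ιMulti ℤ 2 (M := M)).map_update_smul ![x, y] 0 c x
      rwa [e0, e0] at this)
    (fun x y y' => by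
      have := (exteriorPower.ιMulti ℤ 2 (M := M)).map_update_add ![x, y] 1 y y'
      rwa [e1, e1, e1] at this)
    (fun c x y => by
      have := (exteriorPower.ιMulti ℤ 2 (M := M)).map_update_smul ![x, y] 1 c y
      rwa [e1, e1] at this)

/-- The wedge product `l : M ⊗ Λ² M → Λ³ M`, `x ⊗ r ↦ x ∧ r`
(the values are written as elements of the whole exterior algebra). -/
def wedge₁₂ : M ⊗[ℤ] (⋀[ℤ]^2 M) →ₗ[ℤ] ExteriorAlgebra ℤ M :=
  TensorProduct.lift <|
    (LinearMap.mul ℤ (ExteriorAlgebra ℤ M)).compl₁₂ (ExteriorAlgebra.ι ℤ) (⋀[ℤ]^2 M).subtype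

variable {M}

/-- The map `N ⊗ M → M ⊗ M ⊗ M` induced by the inclusion of a subgroup `N ⊆ M ⊗ M`. -/
def inclLeft (N : Submodule ℤ (M ⊗[ℤ] M)) : N ⊗[ℤ] M →ₗ[ℤ] M ⊗[ℤ] (M ⊗[ℤ] M) :=
  (TensorProduct.assoc ℤ M M M).toLinearMap ∘ₗ TensorProduct.map N.subtype LinearMap.id

/-- The map `M ⊗ N → M ⊗ M ⊗ M` induced by the inclusion of a subgroup `N ⊆ M ⊗ M`. -/
def inclRight (N : Submodule ℤ (M ⊗[ℤ] M)) : M ⊗[ℤ] N →ₗ[ℤ] M ⊗[ℤ] (M ⊗[ℤ] M) :=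
  TensorProduct.map LinearMap.id N.subtype

/-- `x ⊗ y ⊗ z`. -/
def tri (x y z : M) : M ⊗[ℤ] (M ⊗[ℤ] M) := x ⊗ₜ (y ⊗ₜ z)

/-- For a basis `ξ₁, …, ξₙ` of `M` and `j < k`: the coordinate of an element of `Λ² M` at
`ξⱼ ∧ ξₖ`. -/
def wedgeCoord {n : ℕ} (ξ : Module.Basis (Fin n) ℤ M) (j k : Fin n) : ⋀[ℤ]^2 M →ₗ[ℤ] ℤ :=
  exteriorPower.pairingDual ℤ M 2 (exteriorPower.ιMulti ℤ 2 ![ξ.coord j, ξ.coord k])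

/-- The coordinate `αᵢⱼₖ` of `t = ∑ᵢ ξᵢ ⊗ ∑_{j<k} αᵢⱼₖ ξⱼ ∧ ξₖ`. -/
def alphaCoord {n : ℕ} (ξ : Module.Basis (Fin n) ℤ M) (i j k : Fin n) :
    M ⊗[ℤ] (⋀[ℤ]^2 M) →ₗ[ℤ] ℤ :=
  (TensorProduct.lid ℤ ℤ).toLinearMap ∘ₗ TensorProduct.map (ξ.coord i) (wedgeCoord ξ j k)

/-- The map `t ↦ α(t) x`. -/
def scaled {N T : Type*} [AddCommGroup N] [Module ℤ N] [AddCommGroup T] [Module ℤ T]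
    (α : N →ₗ[ℤ] ℤ) (x : T) : N →ₗ[ℤ] T :=
  LinearMap.toSpanSingleton ℤ T x ∘ₗ α

/-- The map `p` attached to a basis `ξ₁, …, ξₙ`:
`p t = ∑_{i<j<k} (αⱼᵢₖ (ξᵢξⱼξₖ + ξⱼξᵢξₖ) + αₖᵢⱼ (ξᵢξₖξⱼ + ξₖξᵢξⱼ))
  + ∑_{i<j} (αᵢᵢⱼ ξᵢξᵢξⱼ - αⱼᵢⱼ ξⱼξⱼξᵢ)`. -/
def pMap {n : ℕ} (ξ : Module.Basis (Fin n) ℤ M) :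
    M ⊗[ℤ] (⋀[ℤ]^2 M) →ₗ[ℤ] M ⊗[ℤ] (M ⊗[ℤ] M) :=
  (∑ i, ∑ j, ∑ k, if i < j ∧ j < k then
      scaled (alphaCoord ξ j i k) (tri (ξ i) (ξ j) (ξ k) + tri (ξ j) (ξ i) (ξ k)) +
      scaled (alphaCoord ξ k i j) (tri (ξ i) (ξ k) (ξ j) + tri (ξ k) (ξ i) (ξ j))
    else 0) +
  ∑ i, ∑ j, if i < j then
      scaled (alphaCoord ξ i i j) (tri (ξ i) (ξ i) (ξ j)) -
      scaled (alphaCoord ξ j i j) (tri (ξ j) (ξ j) (ξ i))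
    else 0

/-- `[M, M] ⊆ M ⊗ M`, spanned by the `[x, y] = x ⊗ y - y ⊗ x`. -/
def brackets₂ (M : Type*) [AddCommGroup M] [Module ℤ M] : Submodule ℤ (M ⊗[ℤ] M) :=
  Submodule.span ℤ {t | ∃ x y : M, t = x ⊗ₜ y - y ⊗ₜ x}

/-- `[M, [M, M]] ⊆ M ⊗ M ⊗ M`, spanned by the
`[x, [y, z]] = x ⊗ [y, z] - [y, z] ⊗ x`. -/
def brackets₃ (M : Type*) [AddCommGroup M] [Module ℤ M] : Submodule ℤ (M ⊗[ℤ] (M ⊗[ℤ] M)) :=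
  Submodule.span ℤ
    {t | ∃ x y z : M, t = (tri x y z - tri x z y) - (tri y z x - tri z y x)}

end Algebra

/-! ### Singular chains and cochains -/

section Singular

variable (U : Type u) [TopologicalSpace U]

/-- Singular `n`-simplices of `U`. -/
abbrev Simplex (n : ℕ) : Type u := C(stdSimplex ℝ (Fin (n + 1)), U)

variable {U} in
/-- The `i`-th face of a singular simplex (opposite to the `i`-th vertex). -/
def face {n : ℕ} (i : Fin (n + 2)) (σ : Simplex U (n + 1)) : Simplex U n :=
  σ.comp ⟨stdSimplex.map i.succAbove, stdSimplex.continuous_map _⟩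

/-- Singular `n`-chains with integer coefficients. -/
abbrev Chain (n : ℕ) : Type u := Simplex U n →₀ ℤ

variable {U} in
/-- A singular simplex as a chain. -/
abbrev chainOf {n : ℕ} (σ : Simplex U n) : Chain U n := Finsupp.single σ 1

/-- The boundary `∂ : C_{n+1} → C_n`. -/
def bdry (n : ℕ) : Chain U (n + 1) →ₗ[ℤ] Chain U n :=
  ∑ i : Fin (n + 2), (-1 : ℤ) ^ (i : ℕ) • Finsupp.lmapDomain ℤ ℤ (face i)

/-- Cycles `Z_{n+1}`. -/
abbrev Cycles (n : ℕ) : Submodule ℤ (Chain U (n + 1)) := LinearMap.ker (bdry U n)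

/-- Singular homology `H_{n+1}(U)`. -/
abbrev HomologySucc (n : ℕ) : Type u :=
  Cycles U n ⧸ (LinearMap.range (bdry U (n + 1))).submoduleOf (Cycles U n)

/-- Cochains `C^n = Hom(C_n, ℤ)`. -/
abbrev Cochain (n : ℕ) : Type u := Module.Dual ℤ (Chain U n)

/-- The coboundary `d : C^n → C^{n+1}`, adjoint to `∂`. -/
abbrev cobdry (n : ℕ) : Cochain U n →ₗ[ℤ] Cochain U (n + 1) := (bdry U n).dualMap

/-- Cocycles `Z^{n+1}`. -/
abbrev Cocycles (n : ℕ) : Submodule ℤ (Cochain U (n + 1)) := LinearMap.ker (cobdry U (n + 1))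

/-- Singular cohomology `H^{n+1}(U)`. -/
abbrev CohomologySucc (n : ℕ) : Type u :=
  Cocycles U n ⧸ (LinearMap.range (cobdry U n)).submoduleOf (Cocycles U n)

/-- `H_1(U)`. -/
abbrev HomologyOne : Type u := HomologySucc U 0
/-- `H_2(U)`. -/
abbrev HomologyTwo : Type u := HomologySucc U 1
/-- `H^1(U)`. -/
abbrev CohomologyOne : Type u := CohomologySucc U 0
/-- `H^2(U)`. -/
abbrev CohomologyTwo : Type u := CohomologySucc U 1

/-- The Kronecker pairing `H^{n+1}(U) × H_{n+1}(U) → ℤ`. -/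
def kronecker (n : ℕ) : CohomologySucc U n →ₗ[ℤ] HomologySucc U n →ₗ[ℤ] ℤ :=
  Submodule.liftQ _
    { toFun := fun ω => Submodule.liftQ _ (ω.1 ∘ₗ (Cycles U n).subtype) (by
        rintro ⟨c, hc⟩ ⟨e, rfl⟩
        exact LinearMap.congr_fun ω.2 e)
      map_add' := fun ω η => by
        refine LinearMap.ext fun w => ?_
        obtain ⟨c, rfl⟩ := Submodule.Quotient.mk_surjective _ w
        rfl
      map_smul' := fun a ω => by
        refine LinearMap.ext fun w => ?_
        obtain ⟨c, rfl⟩ := Submodule.Quotient.mk_surjective _ w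
        rfl }
    (by
      rintro ⟨ω, hω⟩ ⟨θ, rfl⟩
      refine LinearMap.ext fun w => ?_
      obtain ⟨⟨c, hc⟩, rfl⟩ := Submodule.Quotient.mk_surjective _ w
      change θ (bdry U n c) = 0
      rw [LinearMap.mem_ker.mp hc, map_zero])

/-- The component `C_2 → C_1 ⊗ C_1` of the (Alexander–Whitney) comultiplication `Δ`:
`[012] ↦ [01] ⊗ [12]`. -/
def comult : Chain U 2 →ₗ[ℤ] Chain U 1 ⊗[ℤ] Chain U 1 :=
  Finsupp.lift _ ℤ _ fun σ => chainOf (face 2 σ) ⊗ₜ[ℤ] chainOf (face 0 σ)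

/-- The cup product `μ : C^1 ⊗ C^1 → C^2`, adjoint to the comultiplication. -/
def cupCochain : Cochain U 1 ⊗[ℤ] Cochain U 1 →ₗ[ℤ] Cochain U 2 :=
  (comult U).dualMap ∘ₗ TensorProduct.dualDistrib ℤ (Chain U 1) (Chain U 1)

variable {U}

theorem face_face {n : ℕ} {i j : Fin (n + 2)} (h : i ≤ j) (σ : Simplex U (n + 2)) :
    face i (face j.succ σ) = face j (face i.castSucc σ) := by
  ext x
  simp only [face, ContinuousMap.comp_apply, ContinuousMap.coe_mk]
  rw [stdSimplex.map_comp_apply, stdSimplex.map_comp_apply]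
  congr 2
  ext k
  simp only [Function.comp_apply, Fin.succAbove]
  rcases i with ⟨i, _⟩
  rcases j with ⟨j, _⟩
  rcases k with ⟨k, _⟩
  split_ifs <;> · simp at * <;> lia

theorem bdry_zero_chainOf (σ : Simplex U 1) :
    bdry U 0 (chainOf σ) = chainOf (face 0 σ) - chainOf (face 1 σ) := by
  simp [bdry, Fin.sum_univ_two, sub_eq_add_neg, Finsupp.mapDomain_single]

theorem bdry_one_chainOf (σ : Simplex U 2) :
    bdry U 1 (chainOf σ) = chainOf (face 0 σ) - chainOf (face 1 σ) + chainOf (face 2 σ) := by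
  simp [bdry, Fin.sum_univ_three, sub_eq_add_neg, Finsupp.mapDomain_single]

theorem bdry_two_chainOf (σ : Simplex U 3) :
    bdry U 2 (chainOf σ) = chainOf (face 0 σ) - chainOf (face 1 σ) + chainOf (face 2 σ)
      - chainOf (face 3 σ) := by
  simp [bdry, Fin.sum_univ_four, sub_eq_add_neg, Finsupp.mapDomain_single, pow_succ]

theorem comult_chainOf (σ : Simplex U 2) :
    comult U (chainOf σ) = chainOf (face 2 σ) ⊗ₜ chainOf (face 0 σ) := by
  simp [comult]

/-- Maps vanishing on boundaries kill the comultiplication of a boundary. -/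
theorem map_comult_bdry {N N' : Type*} [AddCommGroup N] [AddCommGroup N'] [Module ℤ N] [Module ℤ N']
    (g : Chain U 1 →ₗ[ℤ] N) (h : Chain U 1 →ₗ[ℤ] N')
    (hg : g ∘ₗ bdry U 1 = 0) (hh : h ∘ₗ bdry U 1 = 0) (c : Chain U 3) :
    TensorProduct.map g h (comult U (bdry U 2 c)) = 0 := by
  suffices H : TensorProduct.map g h ∘ₗ comult U ∘ₗ bdry U 2 = 0 from LinearMap.congr_fun H c
  refine Finsupp.lhom_ext' fun τ => LinearMap.ext_ring ?_
  change TensorProduct.map g h (comult U (bdry U 2 (chainOf τ))) = 0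
  have e1 := LinearMap.congr_fun hg (chainOf (face 3 τ))
  have e2 := LinearMap.congr_fun hh (chainOf (face 0 τ))
  simp only [LinearMap.comp_apply, bdry_one_chainOf, map_add, map_sub, LinearMap.zero_apply]
    at e1 e2
  have i1 : face 2 (face 0 τ) = face 0 (face 3 τ) := (face_face (i := 0) (j := 2) (by decide) τ).symm
  have i2 : face 0 (face 1 τ) = face 0 (face 0 τ) := face_face (i := 0) (j := 0) (by decide) τ
  have i3 : face 2 (face 1 τ) = face 1 (face 3 τ) := (face_face (i := 1) (j := 2) (by decide) τ).symm
  have i4 : face 2 (face 3 τ) = face 2 (face 2 τ) := face_face (i := 2) (j := 2) (by decide) τ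
  have i5 : face 1 (face 0 τ) = face 0 (face 2 τ) := (face_face (i := 0) (j := 1) (by decide) τ).symm
  simp only [bdry_two_chainOf, map_add, map_sub, comult_chainOf, TensorProduct.map_tmul]
  rw [i1, i5] at e2
  rw [i4] at e1
  rw [i1, i2, i3, i4]
  generalize g (chainOf (face 0 (face 3 τ))) = a at *
  generalize g (chainOf (face 1 (face 3 τ))) = b at *
  generalize g (chainOf (face 2 (face 2 τ))) = c at *
  generalize h (chainOf (face 0 (face 0 τ))) = a' at *
  generalize h (chainOf (face 0 (face 2 τ))) = b' at *
  generalize h (chainOf (face 0 (face 3 τ))) = c' at *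
  obtain rfl : b = a + c := by rw [← sub_eq_zero, ← neg_eq_zero, ← e1]; abel
  obtain rfl : b' = a' + c' := by rw [← sub_eq_zero, ← neg_eq_zero, ← e2]; abel
  rw [TensorProduct.add_tmul, TensorProduct.tmul_add]
  abel

theorem cupCochain_chainOf (ω η : Cochain U 1) (σ : Simplex U 2) :
    cupCochain U (ω ⊗ₜ η) (chainOf σ) = ω (chainOf (face 2 σ)) * η (chainOf (face 0 σ)) := by
  simp only [cupCochain, LinearMap.comp_apply, LinearMap.dualMap_apply, comult_chainOf,
    TensorProduct.dualDistrib_apply]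

theorem cocycle_chainOf (ω : Cocycles U 0) (σ : Simplex U 2) :
    ω.1 (chainOf (face 1 σ)) = ω.1 (chainOf (face 0 σ)) + ω.1 (chainOf (face 2 σ)) := by
  have h : ω.1 (bdry U 1 (chainOf σ)) = 0 := LinearMap.congr_fun ω.2 (chainOf σ)
  rw [bdry_one_chainOf, map_add, map_sub] at h
  linarith

theorem cochain_ext {n : ℕ} {ω η : Cochain U n}
    (h : ∀ σ : Simplex U n, ω (chainOf σ) = η (chainOf σ)) : ω = η :=
  Finsupp.lhom_ext' fun σ => LinearMap.ext_ring (h σ)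

/-- The cochain with prescribed values on singular simplices. -/
def cochainOf {n : ℕ} (F : Simplex U n → ℤ) : Cochain U n := Finsupp.lift _ ℤ _ F

@[simp]
theorem cochainOf_chainOf {n : ℕ} (F : Simplex U n → ℤ) (σ : Simplex U n) :
    cochainOf F (chainOf σ) = F σ := by
  simp [cochainOf]

/-- The cup product of two 1-cocycles, as a 2-cocycle. -/
def cupCocycle : Cocycles U 0 →ₗ[ℤ] Cocycles U 0 →ₗ[ℤ] Cocycles U 1 :=
  LinearMap.mk₂ ℤ
    (fun ω η => ⟨cupCochain U (ω.1 ⊗ₜ η.1), by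
      rw [LinearMap.mem_ker]
      refine LinearMap.ext fun c => ?_
      have h := map_comult_bdry ω.1 η.1 ω.2 η.2 c
      change TensorProduct.lid ℤ ℤ (TensorProduct.map ω.1 η.1 (comult U (bdry U 2 c))) = 0
      rw [h, map_zero]⟩)
    (fun _ _ _ => Subtype.ext (by simp [TensorProduct.add_tmul]))
    (fun c ω η => Subtype.ext (by
      change cupCochain U ((c • ω.1) ⊗ₜ η.1) = c • cupCochain U (ω.1 ⊗ₜ η.1)
      rw [← TensorProduct.smul_tmul', map_smul]))
    (fun _ _ _ => Subtype.ext (by simp [TensorProduct.tmul_add]))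
    (fun _ _ _ => Subtype.ext (by simp))

theorem cupCocycle_val (ω η : Cocycles U 0) :
    (cupCocycle ω η).1 = cupCochain U (ω.1 ⊗ₜ η.1) := rfl

/-- The class of a 2-cocycle in `H^2(U)`. -/
abbrev classTwo : Cocycles U 1 →ₗ[ℤ] CohomologyTwo U := Submodule.mkQ _

theorem classTwo_cup_exact_left (ω η : Cocycles U 0)
    (hω : ω.1 ∈ LinearMap.range (cobdry U 0)) : classTwo (cupCocycle ω η) = 0 := by
  obtain ⟨θ, hθ⟩ := hω
  rw [Submodule.mkQ_apply, Submodule.Quotient.mk_eq_zero]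
  refine ⟨cochainOf fun e => θ (chainOf (face 1 e)) * η.1 (chainOf e), cochain_ext fun σ => ?_⟩
  have i1 : face 0 (face 2 σ) = face 1 (face 0 σ) := face_face (i := 0) (j := 1) (by decide) σ
  have i2 : face 1 (face 2 σ) = face 1 (face 1 σ) := face_face (i := 1) (j := 1) (by decide) σ
  change _ = cupCochain U (ω.1 ⊗ₜ η.1) (chainOf σ)
  rw [cupCochain_chainOf, ← hθ]
  simp only [LinearMap.dualMap_apply, bdry_one_chainOf, bdry_zero_chainOf, map_add, map_sub,
    cochainOf_chainOf, cocycle_chainOf η σ, i1, i2]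
  ring

theorem classTwo_cup_exact_right (ω η : Cocycles U 0)
    (hη : η.1 ∈ LinearMap.range (cobdry U 0)) : classTwo (cupCocycle ω η) = 0 := by
  obtain ⟨θ, hθ⟩ := hη
  rw [Submodule.mkQ_apply, Submodule.Quotient.mk_eq_zero]
  refine ⟨cochainOf fun e => - (ω.1 (chainOf e) * θ (chainOf (face 0 e))),
    cochain_ext fun σ => ?_⟩
  have i1 : face 0 (face 2 σ) = face 1 (face 0 σ) := face_face (i := 0) (j := 1) (by decide) σ
  have i2 : face 0 (face 1 σ) = face 0 (face 0 σ) := face_face (i := 0) (j := 0) (by decide) σ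
  change _ = cupCochain U (ω.1 ⊗ₜ η.1) (chainOf σ)
  rw [cupCochain_chainOf, ← hθ]
  simp only [LinearMap.dualMap_apply, bdry_one_chainOf, bdry_zero_chainOf, map_add, map_sub,
    cochainOf_chainOf, cocycle_chainOf ω σ, i1, i2]
  ring

/-- The cup product `H^1(U) × H^1(U) → H^2(U)`. -/
def cup : CohomologyOne U →ₗ[ℤ] CohomologyOne U →ₗ[ℤ] CohomologyTwo U :=
  (Submodule.liftQ _
    (Submodule.liftQ _ (cupCocycle.compr₂ classTwo) (by
      intro ω hω
      exact LinearMap.ext fun η => classTwo_cup_exact_left ω η hω)).flip (by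
    intro η hη
    refine LinearMap.ext fun x => ?_
    obtain ⟨ω, rfl⟩ := Submodule.Quotient.mk_surjective _ x
    exact classTwo_cup_exact_right ω η hη)).flip

theorem cup_mk (ω η : Cocycles U 0) :
    cup (Submodule.Quotient.mk ω) (Submodule.Quotient.mk η) = classTwo (cupCocycle ω η) := rfl

/-- The map `ζ` (from 1-cochains to 1-cochains) with `ζ(ω)(a) = (ω(a) - ω(a)²) / 2` on each singular
1-simplex `a`; the division is exact. -/
def zeta (ω : Cochain U 1) : Cochain U 1 :=
  cochainOf fun a => (ω (chainOf a) - ω (chainOf a) ^ 2) / 2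

theorem cup_self (x : CohomologyOne U) : cup x x = 0 := by
  obtain ⟨ω, rfl⟩ := Submodule.Quotient.mk_surjective _ x
  rw [cup_mk, Submodule.mkQ_apply, Submodule.Quotient.mk_eq_zero]
  refine ⟨zeta ω.1, cochain_ext fun σ => ?_⟩
  change _ = cupCochain U (ω.1 ⊗ₜ ω.1) (chainOf σ)
  rw [cupCochain_chainOf]
  simp only [LinearMap.dualMap_apply, bdry_one_chainOf, map_add, map_sub, zeta,
    cochainOf_chainOf, cocycle_chainOf ω σ]
  generalize ω.1 (chainOf (face 0 σ)) = a
  generalize ω.1 (chainOf (face 2 σ)) = b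
  have key : ∀ m : ℤ, 2 * ((m - m ^ 2) / 2) = m - m ^ 2 := fun m =>
    Int.mul_ediv_cancel' (by
      have : m - m ^ 2 = -(m * (m - 1)) := by ring
      rw [this, dvd_neg]
      exact (Int.even_mul_pred_self m).two_dvd)
  have h1 := key a
  have h2 := key b
  have h3 := key (a + b)
  refine mul_left_cancel₀ (two_ne_zero (α := ℤ)) ?_
  rw [mul_add, mul_sub, h1, h2, h3]
  ring

variable (U)

/-- The cup product `μ̄ : H^1 ⊗ H^1 → H^2`. -/
def muBar : CohomologyOne U ⊗[ℤ] CohomologyOne U →ₗ[ℤ] CohomologyTwo U :=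
  TensorProduct.lift cup

/-- The cup product as a map `Λ² H^1 → H^2`. -/
def muBarBar : ⋀[ℤ]^2 (CohomologyOne U) →ₗ[ℤ] CohomologyTwo U :=
  exteriorPower.alternatingMapLinearEquiv
    { toFun := fun v => cup (v 0) (v 1)
      map_update_add' := by
        intro _ v i x y
        fin_cases i <;> simp
      map_update_smul' := by
        intro _ v i c x
        fin_cases i <;> simp
      map_eq_zero_of_eq' := by
        intro v i j h hij
        have h01 : v 0 = v 1 := by
          fin_cases i <;> fin_cases j <;> simp_all
        rw [h01]
        exact cup_self _ }

theorem muBarBar_eta₂ (r : CohomologyOne U ⊗[ℤ] CohomologyOne U) :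
    muBarBar U (eta₂ _ r) = muBar U r := by
  induction r with
  | zero => simp
  | add x y hx hy => simp only [map_add, hx, hy]
  | tmul x y => simp [eta₂, muBarBar, muBar]

/-- `R² = Ker (H^1 ⊗ H^1 → H^2)`. -/
def R2 : Submodule ℤ (CohomologyOne U ⊗[ℤ] CohomologyOne U) := LinearMap.ker (muBar U)

/-- `R̄² = Ker (Λ² H^1 → H^2)`. -/
def RBar2 : Submodule ℤ (⋀[ℤ]^2 (CohomologyOne U)) := LinearMap.ker (muBarBar U)

/-- The restriction `R² → R̄²` of `η₂`. -/
def etaR : R2 U →ₗ[ℤ] RBar2 U :=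
  ((eta₂ (CohomologyOne U)).comp (R2 U).subtype).codRestrict (RBar2 U) fun r => by
    change muBarBar U (eta₂ _ r.1) = 0
    rw [muBarBar_eta₂]
    exact r.2

/-- `Q³ = R² ⊗ H^1 ∩ H^1 ⊗ R²` inside `H^1 ⊗ H^1 ⊗ H^1`. -/
def Q3 : Submodule ℤ (CohomologyOne U ⊗[ℤ] (CohomologyOne U ⊗[ℤ] CohomologyOne U)) :=
  LinearMap.range (inclLeft (R2 U)) ⊓ LinearMap.range (inclRight (R2 U))

/-- `Q̄³ = Ker (l : H^1 ⊗ R̄² → Λ³ H^1)`, as a subgroup of `H^1 ⊗ Λ² H^1`. -/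
def QBar3 : Submodule ℤ (CohomologyOne U ⊗[ℤ] (⋀[ℤ]^2 (CohomologyOne U))) :=
  LinearMap.range (TensorProduct.map (LinearMap.id : CohomologyOne U →ₗ[ℤ] CohomologyOne U)
    (RBar2 U).subtype) ⊓ LinearMap.ker (wedge₁₂ (CohomologyOne U))

variable {U}

/-- Admissible choices, relative to a basis `ξ₁, …, ξₙ` of `H^1`, of
* a homomorphism `κ : H^1 → Z^1` right inverse to the projection `Z^1 → H^1`,
* a homomorphism `ν : R² → C^1` with `μ ∘ (κ ⊗ κ) = d ∘ ν` on `R²`, normalized by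
  `ν(ξᵢ ⊗ ξᵢ) = ζ(κ ξᵢ)` and
  `ν(ξᵢ ⊗ ξⱼ + ξⱼ ⊗ ξᵢ) = ζ(κ(ξᵢ + ξⱼ)) - ζ(κ ξᵢ) - ζ(κ ξⱼ)` for `i ≠ j`. -/
structure IsAdmissible {n : ℕ} (ξ : Module.Basis (Fin n) ℤ (CohomologyOne U))
    (κ : CohomologyOne U →ₗ[ℤ] Cocycles U 0) (ν : R2 U →ₗ[ℤ] Cochain U 1) : Prop where
  section_κ : ∀ x, (Submodule.Quotient.mk (κ x) : CohomologyOne U) = x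
  cobdry_ν : ∀ r : R2 U,
    cupCochain U (TensorProduct.map ((Cocycles U 0).subtype ∘ₗ κ) ((Cocycles U 0).subtype ∘ₗ κ)
      (r : CohomologyOne U ⊗[ℤ] CohomologyOne U)) = cobdry U 1 (ν r)
  ν_diag : ∀ (i : Fin n) (r : R2 U), (r : CohomologyOne U ⊗[ℤ] CohomologyOne U) = ξ i ⊗ₜ ξ i →
    ν r = zeta (κ (ξ i)).1
  ν_symm : ∀ (i j : Fin n) (r : R2 U), i ≠ j →
    (r : CohomologyOne U ⊗[ℤ] CohomologyOne U) = ξ i ⊗ₜ ξ j + ξ j ⊗ₜ ξ i →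
    ν r = zeta (κ (ξ i + ξ j)).1 - zeta (κ (ξ i)).1 - zeta (κ (ξ j)).1

/-- `lam : Q³ → H^2` is the map `λ̄` determined by `κ` and `ν`: it sends `q` to the class of
`μ ((ν ⊗ κ + κ ⊗ ν)(q))`, where `ν ⊗ κ` is evaluated on `q` as an element `a` of `R² ⊗ H^1` and
`κ ⊗ ν` is evaluated on `q` as an element `b` of `H^1 ⊗ R²`. -/
def IsLambdaBar (κ : CohomologyOne U →ₗ[ℤ] Cocycles U 0) (ν : R2 U →ₗ[ℤ] Cochain U 1)
    (lam : Q3 U →ₗ[ℤ] CohomologyTwo U) : Prop :=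
  ∀ (q : Q3 U) (a : R2 U ⊗[ℤ] CohomologyOne U) (b : CohomologyOne U ⊗[ℤ] R2 U),
    inclLeft (R2 U) a = q → inclRight (R2 U) b = q →
    ∃ z : Cocycles U 1, lam q = classTwo z ∧
      z.1 = cupCochain U (TensorProduct.map ν ((Cocycles U 0).subtype ∘ₗ κ) a) +
        cupCochain U (TensorProduct.map ((Cocycles U 0).subtype ∘ₗ κ) ν b)

/-- `L : Q̄³ → H^2` is of the form `λ̄ ∘ p` for some admissible choices of `κ` and `ν`. -/
def IsLambdaBarBar {n : ℕ} (ξ : Module.Basis (Fin n) ℤ (CohomologyOne U))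
    (L : QBar3 U →ₗ[ℤ] CohomologyTwo U) : Prop :=
  ∃ (κ : CohomologyOne U →ₗ[ℤ] Cocycles U 0) (ν : R2 U →ₗ[ℤ] Cochain U 1)
    (lam : Q3 U →ₗ[ℤ] CohomologyTwo U),
    IsAdmissible ξ κ ν ∧ IsLambdaBar κ ν lam ∧
      ∀ t : QBar3 U, ∃ ht : pMap ξ t.1 ∈ Q3 U, L t = lam ⟨pMap ξ t.1, ht⟩

/-- `D : Q̄³ → H^2` is the image of `g : R̄² → H^1` under the map sending `g` to
`μ̄ ∘ (id ⊗ (g ∘ η₂) + (g ∘ η₂) ⊗ id) ∘ p`. -/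
def IsDelta {n : ℕ} (ξ : Module.Basis (Fin n) ℤ (CohomologyOne U))
    (g : RBar2 U →ₗ[ℤ] CohomologyOne U) (D : QBar3 U →ₗ[ℤ] CohomologyTwo U) : Prop :=
  ∀ t : QBar3 U, ∃ (a : R2 U ⊗[ℤ] CohomologyOne U) (b : CohomologyOne U ⊗[ℤ] R2 U),
    inclLeft (R2 U) a = pMap ξ t.1 ∧ inclRight (R2 U) b = pMap ξ t.1 ∧
    D t = muBar U (TensorProduct.map LinearMap.id (g ∘ₗ etaR U) b) +
      muBar U (TensorProduct.map (g ∘ₗ etaR U) LinearMap.id a)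

/-- The Massey class `[λ]`, as a coset in `Hom(Q̄³, H^2)` of the subgroup of all maps
`μ̄ ∘ (id ⊗ (g ∘ η₂) + (g ∘ η₂) ⊗ id) ∘ p`, `g ∈ Hom(R̄², H^1)`. -/
def masseyClass {n : ℕ} (ξ : Module.Basis (Fin n) ℤ (CohomologyOne U)) :
    Set (QBar3 U →ₗ[ℤ] CohomologyTwo U) :=
  {L | ∃ (L₀ : QBar3 U →ₗ[ℤ] CohomologyTwo U) (g : RBar2 U →ₗ[ℤ] CohomologyOne U),
    IsLambdaBarBar ξ L₀ ∧ IsDelta ξ g (L - L₀)}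

/-! ### Loops, the comultiplication in homology, and the groups `P₂`, `P₃` -/

/-- A path as a singular 1-simplex. -/
def pathSimplex {x y : U} (γ : Path x y) : Simplex U 1 :=
  γ.toContinuousMap.comp ⟨stdSimplexHomeomorphUnitInterval, stdSimplexHomeomorphUnitInterval.continuous⟩

/-- A point as a singular 0-simplex. -/
abbrev pointSimplex (x : U) : Simplex U 0 := ContinuousMap.const _ x

theorem bdry_pathSimplex {x y : U} (γ : Path x y) :
    bdry U 0 (chainOf (pathSimplex γ)) = chainOf (pointSimplex y) - chainOf (pointSimplex x) := by
  have hv : ∀ s : stdSimplex ℝ (Fin 1), s = stdSimplex.vertex 0 := fun s => Subsingleton.elim _ _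
  have h0 : face 0 (pathSimplex γ) = pointSimplex y := by
    ext s
    rw [hv s]
    simp [face, pathSimplex, stdSimplex.map_vertex]
  have h1 : face 1 (pathSimplex γ) = pointSimplex x := by
    ext s
    rw [hv s]
    simp [face, pathSimplex, stdSimplex.map_vertex]
  rw [bdry_zero_chainOf, h0, h1]

/-- The class in `H_1(U)` of a loop. -/
def loopClass {x : U} (γ : Path x x) : HomologyOne U :=
  Submodule.Quotient.mk ⟨chainOf (pathSimplex γ), by
    rw [LinearMap.mem_ker, bdry_pathSimplex, sub_self]⟩

theorem bdry_bdry (c : Chain U 2) : bdry U 0 (bdry U 1 c) = 0 := by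
  suffices H : bdry U 0 ∘ₗ bdry U 1 = 0 from LinearMap.congr_fun H c
  refine Finsupp.lhom_ext' fun σ => LinearMap.ext_ring ?_
  change bdry U 0 (bdry U 1 (chainOf σ)) = 0
  have i1 : face 0 (face 2 σ) = face 1 (face 0 σ) := face_face (i := 0) (j := 1) (by decide) σ
  have i2 : face 0 (face 1 σ) = face 0 (face 0 σ) := face_face (i := 0) (j := 0) (by decide) σ
  have i3 : face 1 (face 2 σ) = face 1 (face 1 σ) := face_face (i := 1) (j := 1) (by decide) σ
  rw [bdry_one_chainOf, map_add, map_sub, bdry_zero_chainOf, bdry_zero_chainOf,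
    bdry_zero_chainOf, i1, i2, i3]
  abel

section Based

variable [PathConnectedSpace U] (u : U)

/-- The homomorphism `C_0 → C_1` sending each point `x` to a chosen path from `u` to `x`. -/
def tails : Chain U 0 →ₗ[ℤ] Chain U 1 :=
  Finsupp.lift _ ℤ _ fun σ => chainOf (pathSimplex (PathConnectedSpace.somePath u (σ default)))

theorem bdry_tails_bdry (c : Chain U 1) : bdry U 0 (tails u (bdry U 0 c)) = bdry U 0 c := by
  suffices H : bdry U 0 ∘ₗ tails u ∘ₗ bdry U 0 = bdry U 0 from LinearMap.congr_fun H c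
  refine Finsupp.lhom_ext' fun e => LinearMap.ext_ring ?_
  have ht : ∀ σ : Simplex U 0, bdry U 0 (tails u (chainOf σ)) =
      chainOf σ - chainOf (pointSimplex u) := fun σ => by
    have : pointSimplex (σ default) = σ := by
      ext s
      rw [Subsingleton.elim s default]
      rfl
    simp only [tails, Finsupp.lift_apply, Finsupp.sum_single_index, zero_smul, one_smul,
      bdry_pathSimplex, this]
  change bdry U 0 (tails u (bdry U 0 (chainOf e))) = bdry U 0 (chainOf e)
  rw [bdry_zero_chainOf, map_sub, map_sub, ht, ht]
  abel

/-- An extension `C_1 → H_1` of the projection `Z_1 → H_1`: every 1-simplex is closed up to a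
loop by the chosen paths from `u` to its end points. -/
def closeUp : Chain U 1 →ₗ[ℤ] HomologyOne U :=
  Submodule.mkQ _ ∘ₗ (LinearMap.id - tails u ∘ₗ bdry U 0).codRestrict (Cycles U 0) fun c => by
    rw [LinearMap.mem_ker]
    simp [bdry_tails_bdry]

theorem closeUp_bdry : closeUp u ∘ₗ bdry U 1 = 0 := by
  refine LinearMap.ext fun c => ?_
  change Submodule.mkQ _ _ = 0
  rw [Submodule.mkQ_apply, Submodule.Quotient.mk_eq_zero]
  refine ⟨c, ?_⟩
  change bdry U 1 c = bdry U 1 c - tails u (bdry U 0 (bdry U 1 c))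
  rw [bdry_bdry, map_zero, sub_zero]

/-- The homomorphism `Δ̄ : H_2(U) → H_1(U) ⊗ H_1(U)` induced by the comultiplication: the class of
a cycle `c` is sent to the image of `Δ c ∈ C_1 ⊗ C_1` in `H_1 ⊗ H_1`. It does not depend on the
chosen extension `C_1 → H_1` of the projection `Z_1 → H_1`. -/
def comultBar : HomologyTwo U →ₗ[ℤ] HomologyOne U ⊗[ℤ] HomologyOne U :=
  Submodule.liftQ _
    (TensorProduct.map (closeUp u) (closeUp u) ∘ₗ comult U ∘ₗ (Cycles U 1).subtype) (by
      rintro ⟨c, hc⟩ ⟨e, rfl⟩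
      exact map_comult_bdry _ _ (closeUp_bdry u) (closeUp_bdry u) e)

/-- `Δ̄` is adjoint to the cup product (so it is independent of the choices made above whenever
`H_1` is free of finite rank). -/
theorem kronecker_cup (x y : CohomologyOne U) (w : HomologyTwo U) :
    kronecker U 1 (cup x y) w =
      TensorProduct.lid ℤ ℤ
        (TensorProduct.map (kronecker U 0 x) (kronecker U 0 y) (comultBar u w)) := by
  have key : ∀ x : CohomologyOne U, ∃ ω : Cocycles U 0, Submodule.Quotient.mk ω = x ∧
      kronecker U 0 x ∘ₗ closeUp u = ω.1 := by
    intro x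
    obtain ⟨ω, rfl⟩ := Submodule.Quotient.mk_surjective _ x
    refine ⟨⟨kronecker U 0 (Submodule.Quotient.mk ω) ∘ₗ closeUp u, ?_⟩, ?_, rfl⟩
    · change (kronecker U 0 (Submodule.Quotient.mk ω) ∘ₗ closeUp u) ∘ₗ bdry U 1 = 0
      rw [LinearMap.comp_assoc, closeUp_bdry, LinearMap.comp_zero]
    · rw [Submodule.Quotient.eq]
      refine ⟨-(ω.1 ∘ₗ tails u), LinearMap.ext fun c => ?_⟩
      change -(ω.1 (tails u (bdry U 0 c))) = ω.1 (c - tails u (bdry U 0 c)) - ω.1 c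
      rw [map_sub]
      ring
  obtain ⟨ω, hω, eω⟩ := key x
  obtain ⟨η, hη, eη⟩ := key y
  obtain ⟨c, rfl⟩ := Submodule.Quotient.mk_surjective _ w
  have h : comultBar u (Submodule.Quotient.mk c) =
      TensorProduct.map (closeUp u) (closeUp u) (comult U c.1) := rfl
  rw [h, ← LinearMap.comp_apply (TensorProduct.map _ _), ← TensorProduct.map_comp, eω, eη,
    ← hω, ← hη]
  rfl

/-- `P₂`, the image of `[H_1, H_1]` in `(H_1 ⊗ H_1) / Δ̄(H_2)`. -/
def P2 : Submodule ℤ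
    ((HomologyOne U ⊗[ℤ] HomologyOne U) ⧸ LinearMap.range (comultBar u)) :=
  (brackets₂ (HomologyOne U)).map (Submodule.mkQ _)

/-- `Δ̄(H_2) ⊗ H_1 + H_1 ⊗ Δ̄(H_2)`. -/
def relations₃ : Submodule ℤ (HomologyOne U ⊗[ℤ] (HomologyOne U ⊗[ℤ] HomologyOne U)) :=
  LinearMap.range (inclLeft (LinearMap.range (comultBar u))) ⊔
    LinearMap.range (inclRight (LinearMap.range (comultBar u)))

/-- `P₃`, the image of `[H_1, [H_1, H_1]]` in
`(H_1 ⊗ H_1 ⊗ H_1) / (Δ̄(H_2) ⊗ H_1 + H_1 ⊗ Δ̄(H_2))`. -/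
def P3 : Submodule ℤ
    ((HomologyOne U ⊗[ℤ] (HomologyOne U ⊗[ℤ] HomologyOne U)) ⧸ relations₃ u) :=
  (brackets₃ (HomologyOne U)).map (Submodule.mkQ _)

/-- The standing conditions on `(U, u)` with `G = π₁(U, u)`: for some `n`,
(1) `G / G'` is free abelian of rank `n`;
(2) `G` is generated by `n` elements;
(3) `Δ̄ : H_2(U) → H_1(U) ⊗ H_1(U)` is injective. -/
def StandingConditions : Prop :=
  ∃ n : ℕ,
    Nonempty (Additive (Abelianization (FundamentalGroup U u)) ≃+ (Fin n → ℤ)) ∧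
    (∃ g : Fin n → FundamentalGroup U u, Subgroup.closure (Set.range g) = ⊤) ∧
    Function.Injective (comultBar u)

end Based

end Singular

/-! ### The relations between two spaces -/

section Two

variable {U : Type u} {V : Type v} [TopologicalSpace U] [TopologicalSpace V]

/-- `γ_k G` for `k ≥ 1` (so `γ_1 G = G`); Mathlib starts the numbering of the series at `0`. -/
abbrev gammaSub (G : Type*) [Group G] (k : ℕ) : Subgroup G :=
  (⊤ : Subgroup G).lowerCentralSeries (k - 1)

/-- The isomorphism `f : H_1(U) → H_1(V)` extends to an isomorphism
`π₁(U, u) / γ_k → π₁(V, v) / γ_k`, where `H_1` is identified with `π₁ / γ_2` by sending the class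
of a loop to its homology class. -/
def ExtendsTo (x : U) (y : V) (f : HomologyOne U ≃ₗ[ℤ] HomologyOne V) (k : ℕ) : Prop :=
  ∃ F : (FundamentalGroup U x ⧸ gammaSub (FundamentalGroup U x) k) ≃*
      (FundamentalGroup V y ⧸ gammaSub (FundamentalGroup V y) k),
    ∀ (α : Path x x) (β : Path y y),
      F (QuotientGroup.mk (FundamentalGroup.fromPath (Path.Homotopic.Quotient.mk α))) =
        QuotientGroup.mk (FundamentalGroup.fromPath (Path.Homotopic.Quotient.mk β)) →
      f (loopClass α) = loopClass β

/-- `[λ_U]` (formed with the basis `ξ` of `H^1(U)`) corresponds to `[λ_V]` (formed with the basis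
`ξ'` of `H^1(V)`): there are representatives `L`, `L'` of the two classes and an isomorphism
`ψ : H^2(V) → H^2(U)`, compatible with `φ : H^1(V) → H^1(U)` and cup products, with
`L ∘ (φ ⊗ Λ² φ) = ψ ∘ L'` on `Q̄³(V)`. -/
def ClassesCorrespond (φ : CohomologyOne V →ₗ[ℤ] CohomologyOne U) {n : ℕ}
    (ξ : Module.Basis (Fin n) ℤ (CohomologyOne U))
    (ξ' : Module.Basis (Fin n) ℤ (CohomologyOne V)) : Prop :=
  ∃ ψ : CohomologyTwo V ≃ₗ[ℤ] CohomologyTwo U,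
    (∀ a b, ψ (cup a b) = cup (φ a) (φ b)) ∧
    ∃ L ∈ masseyClass ξ, ∃ L' ∈ masseyClass ξ', ∀ t : QBar3 V, ∃ s : QBar3 U,
      s.1 = TensorProduct.map φ (exteriorPower.map 2 φ) t.1 ∧ L s = ψ (L' t)

end Two

end TripleMassey

end

open TripleMassey

noncomputable section

namespace TripleMassey

open scoped commutatorElement

/-! ### Truncated noncommutative power series -/

/-- Noncommutative power series in `n` variables with constant term `1`, truncated in
degree `4`: the coefficients in degrees `1`, `2`, `3`. -/
@[ext]
structure MagnusGroup (n : ℕ) where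
  deg₁ : Fin n → ℤ
  deg₂ : Fin n → Fin n → ℤ
  deg₃ : Fin n → Fin n → Fin n → ℤ

namespace MagnusGroup

variable {n : ℕ}

instance : Mul (MagnusGroup n) :=
  ⟨fun x y => ⟨fun i => x.deg₁ i + y.deg₁ i,
    fun i j => x.deg₂ i j + y.deg₂ i j + x.deg₁ i * y.deg₁ j,
    fun i j k => x.deg₃ i j k + y.deg₃ i j k + x.deg₁ i * y.deg₂ j k + x.deg₂ i j * y.deg₁ k⟩⟩

instance : One (MagnusGroup n) := ⟨⟨fun _ => 0, fun _ _ => 0, fun _ _ _ => 0⟩⟩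

instance : Inv (MagnusGroup n) :=
  ⟨fun x => ⟨fun i => -x.deg₁ i, fun i j => -x.deg₂ i j + x.deg₁ i * x.deg₁ j,
    fun i j k => -x.deg₃ i j k + x.deg₁ i * x.deg₂ j k + x.deg₂ i j * x.deg₁ k
      - x.deg₁ i * x.deg₁ j * x.deg₁ k⟩⟩

@[simp] theorem mul_deg₁ (x y : MagnusGroup n) (i) : (x * y).deg₁ i = x.deg₁ i + y.deg₁ i := rfl
@[simp] theorem mul_deg₂ (x y : MagnusGroup n) (i j) :
    (x * y).deg₂ i j = x.deg₂ i j + y.deg₂ i j + x.deg₁ i * y.deg₁ j := rfl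
@[simp] theorem mul_deg₃ (x y : MagnusGroup n) (i j k) :
    (x * y).deg₃ i j k =
      x.deg₃ i j k + y.deg₃ i j k + x.deg₁ i * y.deg₂ j k + x.deg₂ i j * y.deg₁ k := rfl
@[simp] theorem one_deg₁ (i) : (1 : MagnusGroup n).deg₁ i = 0 := rfl
@[simp] theorem one_deg₂ (i j) : (1 : MagnusGroup n).deg₂ i j = 0 := rfl
@[simp] theorem one_deg₃ (i j k) : (1 : MagnusGroup n).deg₃ i j k = 0 := rfl
@[simp] theorem inv_deg₁ (x : MagnusGroup n) (i) : (x⁻¹).deg₁ i = -x.deg₁ i := rfl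
@[simp] theorem inv_deg₂ (x : MagnusGroup n) (i j) :
    (x⁻¹).deg₂ i j = -x.deg₂ i j + x.deg₁ i * x.deg₁ j := rfl
@[simp] theorem inv_deg₃ (x : MagnusGroup n) (i j k) :
    (x⁻¹).deg₃ i j k = -x.deg₃ i j k + x.deg₁ i * x.deg₂ j k + x.deg₂ i j * x.deg₁ k
      - x.deg₁ i * x.deg₁ j * x.deg₁ k := rfl

instance : Group (MagnusGroup n) :=
  Group.ofLeftAxioms
    (fun x y z => by
      ext <;> simp <;> ring)
    (fun x => by ext <;> simp)
    (fun x => by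
      ext <;> simp
      ring)

theorem commutator_deg₁ (x y : MagnusGroup n) (i) : ⁅x, y⁆.deg₁ i = 0 := by
  simp [commutatorElement_def]

theorem commutator_deg₂ (x y : MagnusGroup n) (i j) :
    ⁅x, y⁆.deg₂ i j = x.deg₁ i * y.deg₁ j - y.deg₁ i * x.deg₁ j := by
  simp [commutatorElement_def]
  ring

theorem commutator_deg₃ (x y : MagnusGroup n) (hy : ∀ i, y.deg₁ i = 0) (i j k) :
    ⁅x, y⁆.deg₃ i j k = x.deg₁ i * y.deg₂ j k - y.deg₂ i j * x.deg₁ k := by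
  simp [commutatorElement_def, hy]
  ring

/-- `(C ⊗ 1 + 1 ⊗ C)(b)` for a linear map `C` from degree `1` to degree `2`. -/
def derive (C : Fin n → Fin n → Fin n → ℤ) (b : Fin n → Fin n → ℤ) (i j k : Fin n) : ℤ :=
  ∑ l, (C l i j * b l k + C l j k * b i l)

/-- The endomorphism `Xᵢ ↦ Xᵢ + Cᵢ + Dᵢ` of the group of truncated power series, where `Cᵢ` and
`Dᵢ` are homogeneous of degrees `2` and `3`. -/
def subst (C : Fin n → Fin n → Fin n → ℤ) (D : Fin n → Fin n → Fin n → Fin n → ℤ) :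
    MagnusGroup n →* MagnusGroup n where
  toFun x := ⟨x.deg₁, fun i j => x.deg₂ i j + ∑ l, C l i j * x.deg₁ l,
    fun i j k => x.deg₃ i j k + derive C x.deg₂ i j k + ∑ l, D l i j k * x.deg₁ l⟩
  map_one' := by ext <;> simp [derive]
  map_mul' x y := by
    ext i
    · rfl
    · simp only [mul_deg₂, mul_deg₁, mul_add, Finset.sum_add_distrib]
      ring
    · simp only [mul_deg₂, mul_deg₁, mul_deg₃, mul_add, add_mul, derive, Finset.sum_add_distrib,
        Finset.mul_sum, Finset.sum_mul]
      ring_nf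

end MagnusGroup

section Magnus

variable {n : ℕ}

/-- The Magnus expansion `xᵢ ↦ 1 + Xᵢ`. -/
def magnus : FreeGroup (Fin n) →* MagnusGroup n :=
  FreeGroup.lift fun i => ⟨Pi.single i 1, fun _ _ => 0, fun _ _ _ => 0⟩

@[simp] theorem magnus_of_deg₁ (i : Fin n) : (magnus (FreeGroup.of i)).deg₁ = Pi.single i 1 := by
  simp [magnus]
@[simp] theorem magnus_of_deg₂ (i : Fin n) (j k) : (magnus (FreeGroup.of i)).deg₂ j k = 0 := by
  simp [magnus]
@[simp] theorem magnus_of_deg₃ (i : Fin n) (j k l) : (magnus (FreeGroup.of i)).deg₃ j k l = 0 := by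
  simp [magnus]

/-- The shuffle relation between the coefficients of degrees `1` and `2`. -/
theorem magnus_shuffle (w : FreeGroup (Fin n)) (i j : Fin n) :
    (magnus w).deg₂ i j + (magnus w).deg₂ j i + (if i = j then (magnus w).deg₁ i else 0) =
      (magnus w).deg₁ i * (magnus w).deg₁ j := by
  induction w using FreeGroup.induction_on with
  | C1 => simp
  | of k =>
    by_cases h : i = j
    · subst h
      by_cases hk : i = k
      · subst hk; simp
      · simp [hk]
    · simp only [magnus_of_deg₂, h, if_false, magnus_of_deg₁]
      by_cases hk : i = k
      · subst hk; simp [Ne.symm h]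
      · simp [hk]
  | inv_of k h =>
    simp only [map_inv, MagnusGroup.inv_deg₁, MagnusGroup.inv_deg₂]
    split_ifs at h ⊢ <;> linarith
  | mul x y hx hy =>
    simp only [map_mul, MagnusGroup.mul_deg₁, MagnusGroup.mul_deg₂]
    split_ifs at hx hy ⊢ with hij
    · subst hij; linarith
    · linarith

/-- A homomorphism from a free group to an abelian group is determined by the exponent sums. -/
theorem hom_eq_sum_deg₁ {A : Type*} [AddCommGroup A] (χ : FreeGroup (Fin n) → A)
    (hχ : ∀ x y, χ (x * y) = χ x + χ y) (w : FreeGroup (Fin n)) :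
    χ w = ∑ i, (magnus w).deg₁ i • χ (FreeGroup.of i) := by
  have h1 : χ 1 = 0 := by simpa using hχ 1 1
  induction w using FreeGroup.induction_on with
  | C1 => simp [h1]
  | of k =>
    rw [Finset.sum_eq_single k]
    · simp
    · intro i _ hi; simp [hi]
    · simp
  | inv_of k h =>
    have : χ (FreeGroup.of k)⁻¹ = -χ (FreeGroup.of k) := by
      rw [eq_neg_iff_add_eq_zero, ← hχ, inv_mul_cancel, h1]
    rw [this, h]
    simp
  | mul x y hx hy => simp [hχ, hx, hy, add_smul, Finset.sum_add_distrib]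

theorem mem_commutator_of_deg₁ {w : FreeGroup (Fin n)} (h : ∀ i, (magnus w).deg₁ i = 0) :
    w ∈ commutator (FreeGroup (Fin n)) := by
  have := hom_eq_sum_deg₁ (fun x => Additive.ofMul (Abelianization.of x)) (fun x y => by simp) w
  simp only [h, zero_smul, Finset.sum_const_zero] at this
  rw [← Abelianization.ker_of]
  exact this

theorem deg₁_of_mem_commutator {w : FreeGroup (Fin n)} (h : w ∈ commutator (FreeGroup (Fin n)))
    (i : Fin n) : (magnus w).deg₁ i = 0 := by
  induction h using Subgroup.closure_induction with
  | mem x hx =>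
    obtain ⟨a, -, b, -, rfl⟩ := hx
    rw [map_commutatorElement, MagnusGroup.commutator_deg₁]
  | one => simp
  | mul x y _ _ hx hy => simp [hx, hy]
  | inv x _ hx => simp [hx]

/-! ### Degree `2` -/

/-- In a group whose commutators are central, the commutator is additive in the first variable. -/
theorem commutator_mul_left_of_mem_center {Q : Type*} [Group Q] {g g' m : Q}
    (h' : ⁅g', m⁆ ∈ Subgroup.center Q) :
    ⁅g * g', m⁆ = ⁅g, m⁆ * ⁅g', m⁆ := by
  rw [commutatorElement_mul_left_eq_conj_mul, Subgroup.mem_center_iff.mp h' g,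
    mul_inv_cancel_right]
  exact (Subgroup.mem_center_iff.mp h' _).symm

theorem commutator_mul_right_of_mem_center {Q : Type*} [Group Q] {g m m' : Q}
    (h' : ⁅g, m'⁆ ∈ Subgroup.center Q) :
    ⁅g, m * m'⁆ = ⁅g, m⁆ * ⁅g, m'⁆ := by
  rw [commutatorElement_mul_right_eq_mul_conj, mul_assoc ⁅g, m⁆, Subgroup.mem_center_iff.mp h' m]
  group

theorem commutator_inv_right_of_mem_center {Q : Type*} [Group Q] {g m : Q}
    (h' : ⁅g, m⁆ ∈ Subgroup.center Q) : ⁅g, m⁻¹⁆ = ⁅g, m⁆⁻¹ := by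
  rw [eq_inv_iff_mul_eq_one, ← commutator_mul_right_of_mem_center h', inv_mul_cancel,
    commutatorElement_one_right]

theorem commutator_inv_left_of_mem_center {Q : Type*} [Group Q] {g m : Q}
    (h' : ⁅g, m⁆ ∈ Subgroup.center Q) : ⁅g⁻¹, m⁆ = ⁅g, m⁆⁻¹ := by
  rw [eq_inv_iff_mul_eq_one, ← commutator_mul_left_of_mem_center h', inv_mul_cancel,
    commutatorElement_one_left]

/-- Elements of the `k`-th term of the lower central series are central modulo the next term. -/
theorem mk_mem_center {G : Type*} [Group G] {k : ℕ} {w : G}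
    (h : w ∈ (⊤ : Subgroup G).lowerCentralSeries k) :
    (w : G ⧸ (⊤ : Subgroup G).lowerCentralSeries (k + 1)) ∈ Subgroup.center _ := by
  rw [Subgroup.mem_center_iff]
  intro g
  obtain ⟨g, rfl⟩ := QuotientGroup.mk_surjective g
  rw [← QuotientGroup.mk_mul, ← QuotientGroup.mk_mul, QuotientGroup.eq]
  have : (g * w)⁻¹ * (w * g) = ⁅w⁻¹, g⁻¹⁆ := by
    simp [commutatorElement_def, mul_assoc]
  rw [this]
  exact Subgroup.commutator_mem_commutator (inv_mem h) (Subgroup.mem_top _)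

/-- An antisymmetric matrix is the sum of its entries above the diagonal times the standard
antisymmetric matrices. -/
theorem sum_alternating {A : Type*} [AddCommGroup A] (a a' : Fin n → ℤ) (k : Fin n → Fin n → A)
    (hk : ∀ i, k i i = 0) (hk' : ∀ i j, k j i = -k i j) :
    ∑ i, ∑ j, (if i < j then (a i * a' j - a' i * a j) • k i j else 0) =
      ∑ i, ∑ j, (a i * a' j) • k i j := by
  have e1 : ∑ i, ∑ j, (if i < j then (a i * a' j - a' i * a j) • k i j else 0) =
      ∑ i, ∑ j, (if i < j then (a i * a' j) • k i j else 0) +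
      ∑ i, ∑ j, (if j < i then (a i * a' j) • k i j else 0) := by
    rw [Finset.sum_comm (f := fun i j => if j < i then (a i * a' j) • k i j else 0),
      ← Finset.sum_add_distrib]
    refine Finset.sum_congr rfl fun i _ => ?_
    rw [← Finset.sum_add_distrib]
    refine Finset.sum_congr rfl fun j _ => ?_
    split_ifs
    · rw [hk' i j, smul_neg, sub_smul, mul_comm (a j), ← sub_eq_add_neg]
    · simp
  rw [e1, ← Finset.sum_add_distrib]
  refine Finset.sum_congr rfl fun i _ => ?_
  rw [← Finset.sum_add_distrib]
  refine Finset.sum_congr rfl fun j _ => ?_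
  rcases lt_trichotomy i j with h | rfl | h
  · simp [h, h.not_gt]
  · simp [hk]
  · simp [h, h.not_gt]

/-- The centre of a group, written additively. -/
def AddCenter (Q : Type*) [Group Q] : Type _ := Additive (Subgroup.center Q)

instance {Q : Type*} [Group Q] : AddCommGroup (AddCenter Q) :=
  { (inferInstance : AddGroup (Additive (Subgroup.center Q))) with
    add_comm := fun _ y => Additive.toMul.injective
      (Subtype.ext (Subgroup.mem_center_iff.mp (Additive.toMul y).2 _)) }

/-- A central element as an element of the additive centre. -/
def addCenter {Q : Type*} [Group Q] (q : Q) (hq : q ∈ Subgroup.center Q) : AddCenter Q :=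
  Additive.ofMul ⟨q, hq⟩

theorem addCenter_mul {Q : Type*} [Group Q] {q q' : Q} (hq : q ∈ Subgroup.center Q)
    (hq' : q' ∈ Subgroup.center Q) :
    addCenter (q * q') (mul_mem hq hq') = addCenter q hq + addCenter q' hq' := rfl

theorem addCenter_inv {Q : Type*} [Group Q] {q : Q} (hq : q ∈ Subgroup.center Q) :
    addCenter q⁻¹ (inv_mem hq) = -addCenter q hq := rfl

theorem addCenter_one {Q : Type*} [Group Q] : addCenter (1 : Q) (one_mem _) = 0 := rfl

theorem addCenter_eq_iff {Q : Type*} [Group Q] {q q' : Q} (hq : q ∈ Subgroup.center Q)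
    (hq' : q' ∈ Subgroup.center Q) : addCenter q hq = addCenter q' hq' ↔ q = q' :=
  ⟨fun h => congrArg (fun z : AddCenter Q => (Additive.toMul z).1) h, fun h => by subst h; rfl⟩

/-- In a group of class two, the image of a product of commutators of words is determined by the
coefficients of degree `2`. -/
theorem map_commutator_eq_sum {Q : Type*} [Group Q] (hQ : ∀ g h : Q, ⁅g, h⁆ ∈ Subgroup.center Q)
    (p : FreeGroup (Fin n) →* Q) (w : FreeGroup (Fin n))
    (hw : w ∈ commutator (FreeGroup (Fin n))) :
    ∃ h : p w ∈ Subgroup.center Q, addCenter (p w) h =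
      ∑ i, ∑ j, if i < j then (magnus w).deg₂ i j •
        addCenter ⁅p (FreeGroup.of i), p (FreeGroup.of j)⁆ (hQ _ _) else 0 := by
  induction hw using Subgroup.closure_induction with
  | mem x hx =>
    obtain ⟨a, -, b, -, rfl⟩ := hx
    refine ⟨by rw [map_commutatorElement]; exact hQ _ _, ?_⟩
    simp only [map_commutatorElement, MagnusGroup.commutator_deg₂]
    rw [sum_alternating _ _ (fun i j => addCenter ⁅p (FreeGroup.of i), p (FreeGroup.of j)⁆ (hQ _ _))
      (fun i => by simp [addCenter_one]) (fun i j => by simp [← addCenter_inv (hQ _ _)])]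
    rw [hom_eq_sum_deg₁ (fun g => addCenter ⁅p g, p b⁆ (hQ _ _)) (fun x y => by
      simp [← addCenter_mul, commutator_mul_left_of_mem_center (hQ _ _)])]
    refine Finset.sum_congr rfl fun i _ => ?_
    rw [hom_eq_sum_deg₁ (fun g => addCenter ⁅p (FreeGroup.of i), p g⁆ (hQ _ _)) (fun x y => by
      simp [← addCenter_mul, commutator_mul_right_of_mem_center (hQ _ _)]), Finset.smul_sum]
    simp only [mul_smul]
  | one => exact ⟨by simp [one_mem], by simp [addCenter_one]⟩
  | mul x y hx hy ihx ihy =>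
    obtain ⟨cx, ex⟩ := ihx
    obtain ⟨cy, ey⟩ := ihy
    refine ⟨by rw [map_mul]; exact mul_mem cx cy, ?_⟩
    simp only [map_mul, addCenter_mul cx cy, ex, ey, ← Finset.sum_add_distrib]
    refine Finset.sum_congr rfl fun i _ => Finset.sum_congr rfl fun j _ => ?_
    split_ifs <;> simp [deg₁_of_mem_commutator hx, add_smul]
  | inv x hx ihx =>
    obtain ⟨cx, ex⟩ := ihx
    refine ⟨by rw [map_inv]; exact inv_mem cx, ?_⟩
    simp only [map_inv, addCenter_inv cx, ex, ← Finset.sum_neg_distrib]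
    refine Finset.sum_congr rfl fun i _ => Finset.sum_congr rfl fun j _ => ?_
    split_ifs <;> simp [deg₁_of_mem_commutator hx]

theorem mem_gamma_three_of_deg₂ {w : FreeGroup (Fin n)} (h₁ : ∀ i, (magnus w).deg₁ i = 0)
    (h₂ : ∀ i j, (magnus w).deg₂ i j = 0) :
    w ∈ (⊤ : Subgroup (FreeGroup (Fin n))).lowerCentralSeries 2 := by
  have hQ : ∀ g h : FreeGroup (Fin n) ⧸ (⊤ : Subgroup (FreeGroup (Fin n))).lowerCentralSeries 2,
      ⁅g, h⁆ ∈ Subgroup.center _ := by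
    intro g h
    obtain ⟨g, rfl⟩ := QuotientGroup.mk_surjective g
    obtain ⟨h, rfl⟩ := QuotientGroup.mk_surjective h
    exact mk_mem_center (k := 1) (Subgroup.commutator_mem_commutator (Subgroup.mem_top g)
        (Subgroup.mem_top h))
  obtain ⟨hc, e⟩ := map_commutator_eq_sum hQ (QuotientGroup.mk' _) w (mem_commutator_of_deg₁ h₁)
  simp only [h₂, zero_smul, ite_self, Finset.sum_const_zero] at e
  rw [← addCenter_one, addCenter_eq_iff] at e
  exact (QuotientGroup.eq_one_iff _).mp e

/-! ### Degree `3` -/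

/-- A preimage of the trilinear form `T` (alternating in the last two variables and subject to the
Jacobi identity) under antisymmetrization in the last two variables, symmetric in the first two
variables. -/
def symLift {A : Type*} [AddCommGroup A] (T : Fin n → Fin n → Fin n → A) (p q r : Fin n) : A :=
  if p = q then T p p r
  else if p < q then (if p < r ∧ q ≠ r then T q p r else 0)
  else (if q < r ∧ p ≠ r then T p q r else 0)

theorem symLift_symm {A : Type*} [AddCommGroup A] (T : Fin n → Fin n → Fin n → A) (p q r : Fin n) :
    symLift T p q r = symLift T q p r := by
  rcases lt_trichotomy p q with h | rfl | h
  · simp [symLift, h, h.ne, h.ne', h.not_gt]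
  · rfl
  · simp [symLift, h, h.ne, h.ne', h.not_gt]

/-- The relations between the brackets `[xᵢ, [xⱼ, xₖ]]`. -/
structure IsBracketLike {A : Type*} [AddCommGroup A] (T : Fin n → Fin n → Fin n → A) : Prop where
  self : ∀ i j, T i j j = 0
  anti : ∀ i j k, T i k j = -T i j k
  jacobi : ∀ i j k, T i j k + T j k i + T k i j = 0

theorem IsBracketLike.symLift_sub {A : Type*} [AddCommGroup A] {T : Fin n → Fin n → Fin n → A}
    (hT : IsBracketLike T) (a b c : Fin n) :
    symLift T a b c - symLift T a c b = T a b c := by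
  have main : ∀ b c : Fin n, b < c → symLift T a b c - symLift T a c b = T a b c := by
    intro b c hbc
    rcases lt_trichotomy a b with hab | rfl | hab
    · have hac := hab.trans hbc
      have J := hT.jacobi a b c
      rw [hT.anti b a c] at J
      simp only [symLift, hab.ne, hac.ne, hab, hac, if_true, if_false, hbc.ne, hbc.ne', ne_eq,
        not_false_eq_true, and_self]
      rw [← sub_eq_zero, ← neg_eq_zero, ← J]
      abel
    · simp [symLift, hbc, hbc.ne]
    · rcases lt_trichotomy a c with hac | rfl | hac
      · simp [symLift, hab.ne', hac.ne, hab.not_gt, hac, hbc]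
      · rw [hT.anti a a b]
        simp [symLift, hab.ne', hab.not_gt]
      · simp [symLift, hab.ne', hac.ne', hab.not_gt, hac.not_gt, hbc, hbc.not_gt]
  rcases lt_trichotomy b c with h | rfl | h
  · exact main b c h
  · simp [hT.self]
  · rw [← neg_sub, main c b h, hT.anti, neg_neg]

/-- The pairing of a trilinear form with the bracket `[a, [a', a'']]`. -/
theorem IsBracketLike.sum_symLift {A : Type*} [AddCommGroup A] {T : Fin n → Fin n → Fin n → A}
    (hT : IsBracketLike T) (a a' a'' : Fin n → ℤ) :
    ∑ p, ∑ q, ∑ r, (a p * (a' q * a'' r - a'' q * a' r) - (a' p * a'' q - a'' p * a' q) * a r) •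
      symLift T p q r = ∑ p, ∑ q, ∑ r, (a p * a' q * a'' r) • T p q r := by
  have e1 : ∑ p, ∑ q, ∑ r, (a p * (a'' q * a' r)) • symLift T p q r =
      ∑ p, ∑ q, ∑ r, (a p * a' q * a'' r) • symLift T p r q := by
    refine Finset.sum_congr rfl fun p _ => ?_
    rw [Finset.sum_comm]
    exact Finset.sum_congr rfl fun q _ => Finset.sum_congr rfl fun r _ => by
      congr 1; ring
  have e2 : ∑ p, ∑ q, ∑ r, (a'' p * a' q * a r) • symLift T p q r =
      ∑ p, ∑ q, ∑ r, (a' p * a'' q * a r) • symLift T p q r := by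
    rw [Finset.sum_comm]
    exact Finset.sum_congr rfl fun q _ => Finset.sum_congr rfl fun r _ => Finset.sum_congr rfl
      fun s _ => by rw [symLift_symm, mul_comm (a'' r)]
  simp only [mul_sub, sub_mul, sub_smul, Finset.sum_sub_distrib, e1, e2]
  simp only [← hT.symLift_sub, smul_sub, Finset.sum_sub_distrib, mul_assoc]
  abel

/-- In a group of class three, the image of an element of `γ₃` of the free group is determined by
the coefficients of degree `3`. -/
theorem map_gamma_three_eq_sum {Q : Type*} [Group Q]
    (hQ : ∀ (g m : Q), m ∈ commutator Q → ⁅g, m⁆ ∈ Subgroup.center Q)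
    (p : FreeGroup (Fin n) →* Q) (w : FreeGroup (Fin n))
    (hw : w ∈ (⊤ : Subgroup (FreeGroup (Fin n))).lowerCentralSeries 2) :
    (∀ i, (magnus w).deg₁ i = 0) ∧ (∀ i j, (magnus w).deg₂ i j = 0) ∧
    ∃ h : p w ∈ Subgroup.center Q, addCenter (p w) h =
      ∑ i, ∑ j, ∑ k, (magnus w).deg₃ i j k •
        symLift (fun i j k => addCenter ⁅p (FreeGroup.of i), ⁅p (FreeGroup.of j), p (FreeGroup.of k)⁆⁆
          (hQ _ _ (Subgroup.commutator_mem_commutator (Subgroup.mem_top _) (Subgroup.mem_top _))))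
          i j k := by
  have hc : ∀ g h : Q, ⁅g, h⁆ ∈ commutator Q := fun g h =>
    Subgroup.commutator_mem_commutator (Subgroup.mem_top _) (Subgroup.mem_top _)
  have hpc : ∀ m, m ∈ commutator (FreeGroup (Fin n)) → p m ∈ commutator Q := fun m hm => by
    have := Subgroup.mem_map_of_mem p hm
    rw [commutator, Subgroup.map_commutator] at this
    exact Subgroup.commutator_mono le_top le_top this
  set T : Fin n → Fin n → Fin n → AddCenter Q := fun i j k =>
    addCenter ⁅p (FreeGroup.of i), ⁅p (FreeGroup.of j), p (FreeGroup.of k)⁆⁆ (hQ _ _ (hc _ _)) with hTdef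
  have ml : ∀ g g' h k : Q, ⁅g * g', ⁅h, k⁆⁆ = ⁅g, ⁅h, k⁆⁆ * ⁅g', ⁅h, k⁆⁆ := fun g g' h k =>
    commutator_mul_left_of_mem_center (hQ _ _ (hc _ _))
  have mm : ∀ g h h' k : Q, ⁅g, ⁅h * h', k⁆⁆ = ⁅g, ⁅h, k⁆⁆ * ⁅g, ⁅h', k⁆⁆ := fun g h h' k => by
    have : ⁅h * h', k⁆ = ⁅h, ⁅h', k⁆⁆ * (⁅h', k⁆ * ⁅h, k⁆) := by
      rw [commutatorElement_mul_left_eq_conj_mul]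
      simp [commutatorElement_def, mul_assoc]
    rw [this, commutator_mul_right_of_mem_center (hQ _ _ (mul_mem (hc _ _) (hc _ _))),
      commutatorElement_eq_one_iff_mul_comm.mpr (Subgroup.mem_center_iff.mp (hQ _ _ (hc _ _)) g),
      one_mul, commutator_mul_right_of_mem_center (hQ _ _ (hc _ _))]
    exact Subgroup.mem_center_iff.mp (hQ _ _ (hc _ _)) _
  have ma : ∀ g h k : Q, ⁅g, ⁅k, h⁆⁆ = ⁅g, ⁅h, k⁆⁆⁻¹ := fun g h k => by
    rw [← commutator_inv_right_of_mem_center (hQ _ _ (hc _ _)), commutatorElement_inv]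
  have mr : ∀ g h k k' : Q, ⁅g, ⁅h, k * k'⁆⁆ = ⁅g, ⁅h, k⁆⁆ * ⁅g, ⁅h, k'⁆⁆ := fun g h k k' => by
    rw [ma, mm, mul_inv_rev, ← ma, ← ma]
    exact Subgroup.mem_center_iff.mp (hQ _ _ (hc _ _)) _
  have hT : IsBracketLike T := by
    refine ⟨fun i j => ?_, fun i j k => ?_, fun i j k => ?_⟩
    · simp [hTdef, addCenter_one]
    · simp only [hTdef, ← addCenter_inv (hQ _ _ (hc _ _)), addCenter_eq_iff]
      exact ma _ _ _
    · have conj : ∀ a b m : Q, m ∈ commutator Q → ⁅a * b * a⁻¹, m⁆ = ⁅b, m⁆ := by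
        intro a b m hm
        rw [commutator_mul_left_of_mem_center (hQ _ _ hm),
          commutator_mul_left_of_mem_center (hQ _ _ hm),
          commutator_inv_left_of_mem_center (hQ _ _ hm),
          Subgroup.mem_center_iff.mp (hQ _ _ hm) ⁅a, m⁆, mul_inv_cancel_right]
      have HW := commutatorElement_conj_commutatorElement_mul (p (FreeGroup.of k))
        (p (FreeGroup.of i)) (p (FreeGroup.of j))
      rw [conj _ _ _ (hc _ _), conj _ _ _ (hc _ _), conj _ _ _ (hc _ _)] at HW
      rw [add_right_comm]
      simp only [hTdef, ← addCenter_mul]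
      rw [← addCenter_one, addCenter_eq_iff, HW]
  have bracket : ∀ (g m : FreeGroup (Fin n)) (hm : m ∈ commutator (FreeGroup (Fin n))),
      addCenter ⁅p g, p m⁆ (hQ _ _ (hpc m hm)) = ∑ i, ∑ j, ∑ k,
        ((magnus g).deg₁ i * (magnus m).deg₂ j k - (magnus m).deg₂ i j * (magnus g).deg₁ k) •
          symLift T i j k := by
    intro g m hm
    induction hm using Subgroup.closure_induction with
    | mem x hx =>
      obtain ⟨a, -, b, -, rfl⟩ := hx
      simp only [map_commutatorElement, MagnusGroup.commutator_deg₂, hT.sum_symLift]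
      rw [hom_eq_sum_deg₁ (fun g => addCenter ⁅p g, ⁅p a, p b⁆⁆ (hQ _ _ (hc _ _))) (fun x y => by
        simp [← addCenter_mul, ml])]
      refine Finset.sum_congr rfl fun i _ => ?_
      rw [hom_eq_sum_deg₁ (fun g => addCenter ⁅p (FreeGroup.of i), ⁅p g, p b⁆⁆ (hQ _ _ (hc _ _)))
        (fun x y => by simp [← addCenter_mul, mm]), Finset.smul_sum]
      refine Finset.sum_congr rfl fun j _ => ?_
      rw [hom_eq_sum_deg₁ (fun g => addCenter ⁅p (FreeGroup.of i), ⁅p (FreeGroup.of j), p g⁆⁆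
        (hQ _ _ (hc _ _))) (fun x y => by simp [← addCenter_mul, mr]), Finset.smul_sum,
        Finset.smul_sum]
      simp only [mul_smul, hTdef]
    | one => simp [addCenter_one]
    | mul x y hx hy ihx ihy =>
      simp only [map_mul, commutator_mul_right_of_mem_center (hQ (p g) _ (hpc y hy)),
        addCenter_mul (hQ (p g) _ (hpc x hx)) (hQ (p g) _ (hpc y hy)), ihx, ihy,
        ← Finset.sum_add_distrib, ← add_smul, MagnusGroup.mul_deg₂, deg₁_of_mem_commutator hx]
      refine Finset.sum_congr rfl fun i _ => Finset.sum_congr rfl fun j _ =>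
        Finset.sum_congr rfl fun k _ => ?_
      congr 1
      ring
    | inv x hx ihx =>
      simp only [map_inv, commutator_inv_right_of_mem_center (hQ (p g) _ (hpc x hx)),
        addCenter_inv (hQ (p g) _ (hpc x hx)), ihx,
        ← Finset.sum_neg_distrib, ← neg_smul, MagnusGroup.inv_deg₂, deg₁_of_mem_commutator hx]
      refine Finset.sum_congr rfl fun i _ => Finset.sum_congr rfl fun j _ =>
        Finset.sum_congr rfl fun k _ => ?_
      congr 1
      ring
  induction hw using Subgroup.closure_induction with
  | mem x hx =>
    obtain ⟨m, hm, g, -, rfl⟩ := hx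
    have hm' := deg₁_of_mem_commutator hm
    refine ⟨fun i => ?_, fun i j => ?_, ?_⟩
    · rw [map_commutatorElement, MagnusGroup.commutator_deg₁]
    · rw [map_commutatorElement, MagnusGroup.commutator_deg₂, hm', hm']; ring
    · have hcen : ⁅p m, p g⁆ ∈ Subgroup.center Q := by
        rw [← commutatorElement_inv]
        exact inv_mem (hQ _ _ (hpc m hm))
      refine ⟨by rw [map_commutatorElement]; exact hcen, ?_⟩
      have : ∀ i j k, (magnus ⁅m, g⁆).deg₃ i j k = -((magnus g).deg₁ i * (magnus m).deg₂ j k -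
          (magnus m).deg₂ i j * (magnus g).deg₁ k) := fun i j k => by
        rw [← MagnusGroup.commutator_deg₃ _ _ hm', ← commutatorElement_inv, map_inv,
          MagnusGroup.inv_deg₃, map_commutatorElement]
        simp [MagnusGroup.commutator_deg₁]
      simp only [this, neg_smul, Finset.sum_neg_distrib, ← bracket g m hm, ← addCenter_inv]
      simp
  | one => exact ⟨by simp, by simp, by simp [one_mem], by simp [addCenter_one]⟩
  | mul x y hx hy ihx ihy =>
    obtain ⟨ax, bx, cx, ex⟩ := ihx
    obtain ⟨ay, by', cy, ey⟩ := ihy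
    refine ⟨by simp [ax, ay], by simp [ax, ay, bx, by'], by rw [map_mul]; exact mul_mem cx cy, ?_⟩
    simp [map_mul, addCenter_mul cx cy, ex, ey, ← Finset.sum_add_distrib, ← add_smul, ax, bx]
  | inv x hx ihx =>
    obtain ⟨ax, bx, cx, ex⟩ := ihx
    refine ⟨by simp [ax], by simp [ax, bx], by rw [map_inv]; exact inv_mem cx, ?_⟩
    simp [map_inv, addCenter_inv cx, ex, ← Finset.sum_neg_distrib, ax, bx]

theorem mem_gamma_four_of_deg₃ {w : FreeGroup (Fin n)} (h₁ : ∀ i, (magnus w).deg₁ i = 0)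
    (h₂ : ∀ i j, (magnus w).deg₂ i j = 0) (h₃ : ∀ i j k, (magnus w).deg₃ i j k = 0) :
    w ∈ (⊤ : Subgroup (FreeGroup (Fin n))).lowerCentralSeries 3 := by
  have hQ : ∀ g m : FreeGroup (Fin n) ⧸ (⊤ : Subgroup (FreeGroup (Fin n))).lowerCentralSeries 3,
      m ∈ commutator _ → ⁅g, m⁆ ∈ Subgroup.center _ := by
    intro g m hm
    obtain ⟨g, rfl⟩ := QuotientGroup.mk_surjective g
    have : (commutator (FreeGroup (Fin n))).map (QuotientGroup.mk' _) =
        commutator (FreeGroup (Fin n) ⧸ (⊤ : Subgroup (FreeGroup (Fin n))).lowerCentralSeries 3) := by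
      rw [commutator, Subgroup.map_commutator, ← MonoidHom.range_eq_map,
        MonoidHom.range_eq_top.mpr (QuotientGroup.mk'_surjective _)]
      rfl
    rw [← this] at hm
    obtain ⟨m, hm, rfl⟩ := hm
    rw [← commutatorElement_inv]
    exact inv_mem (mk_mem_center (k := 2) (Subgroup.commutator_mem_commutator hm (Subgroup.mem_top g)))
  obtain ⟨-, -, hc, e⟩ := map_gamma_three_eq_sum hQ (QuotientGroup.mk' _) w
    (mem_gamma_three_of_deg₂ h₁ h₂)
  simp only [h₃, zero_smul, Finset.sum_const_zero] at e
  rw [← addCenter_one, addCenter_eq_iff] at e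
  exact (QuotientGroup.eq_one_iff _).mp e

end Magnus

open scoped commutatorElement

/-! ### Marked groups and their relations -/

section Marked

variable {n : ℕ} {G : Type*} [Group G]

/-- `ε` identifies the abelianization of `G` with `ℤⁿ`, and the elements `xᵢ` lift the standard
basis. -/
structure IsMarked (ε : G → Fin n → ℤ) (x : Fin n → G) : Prop where
  mul : ∀ g h i, ε (g * h) i = ε g i + ε h i
  basis : ∀ i, ε (x i) = Pi.single i 1
  ker : ∀ g, (∀ i, ε g i = 0) → g ∈ commutator G

/-- The preimage in the free group of the `k`-th term of the lower central series of `G`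
(numbered from `0`). -/
def relSub (x : Fin n → G) (k : ℕ) : Subgroup (FreeGroup (Fin n)) :=
  ((⊤ : Subgroup G).lowerCentralSeries k).comap (FreeGroup.lift x)

theorem mem_relSub {x : Fin n → G} {k : ℕ} {w : FreeGroup (Fin n)} :
    w ∈ relSub x k ↔ FreeGroup.lift x w ∈ (⊤ : Subgroup G).lowerCentralSeries k := Iff.rfl

theorem map_mem_lowerCentralSeries {G' : Type*} [Group G'] (p : G →* G') {k : ℕ} {w : G}
    (hw : w ∈ (⊤ : Subgroup G).lowerCentralSeries k) :
    p w ∈ (⊤ : Subgroup G').lowerCentralSeries k := by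
  have := Subgroup.mem_map_of_mem p hw
  rw [Subgroup.map_lowerCentralSeries] at this
  exact Subgroup.lowerCentralSeries_mono k le_top this

theorem lowerCentralSeries_le_relSub (x : Fin n → G) (k : ℕ) :
    (⊤ : Subgroup (FreeGroup (Fin n))).lowerCentralSeries k ≤ relSub x k := fun _ hw =>
  map_mem_lowerCentralSeries _ hw

theorem relSub_antitone (x : Fin n → G) {k l : ℕ} (h : k ≤ l) : relSub x l ≤ relSub x k :=
  Subgroup.comap_mono ((⊤ : Subgroup G).lowerCentralSeries_antitone h)

instance (x : Fin n → G) (k : ℕ) : (relSub x k).Normal := by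
  unfold relSub; infer_instance

variable {ε : G → Fin n → ℤ} {x : Fin n → G}

theorem exists_deg₁ (a : Fin n → ℤ) : ∃ w : FreeGroup (Fin n), (magnus w).deg₁ = a := by
  let S : AddSubgroup (Fin n → ℤ) :=
    { carrier := {a | ∃ w : FreeGroup (Fin n), (magnus w).deg₁ = a}
      zero_mem' := ⟨1, rfl⟩
      add_mem' := by
        rintro _ _ ⟨w, rfl⟩ ⟨w', rfl⟩
        exact ⟨w * w', by ext; simp⟩
      neg_mem' := by
        rintro _ ⟨w, rfl⟩
        exact ⟨w⁻¹, by ext; simp⟩ }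
  have : a = ∑ i, a i • Pi.single (M := fun _ => ℤ) i 1 := by
    ext i; simp [Finset.sum_apply, Pi.single_apply]
  rw [this]
  exact S.sum_mem fun i _ => S.zsmul_mem ⟨FreeGroup.of i, by simp⟩ _

namespace IsMarked

theorem one (hx : IsMarked ε x) (i : Fin n) : ε 1 i = 0 := by
  simpa using hx.mul 1 1 i

theorem inv (hx : IsMarked ε x) (g : G) (i : Fin n) : ε g⁻¹ i = -ε g i := by
  have := hx.mul g⁻¹ g i
  rw [inv_mul_cancel, hx.one] at this
  linarith

theorem commutator_eq_zero (hx : IsMarked ε x) {g : G} (hg : g ∈ commutator G) (i : Fin n) :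
    ε g i = 0 := by
  induction hg using Subgroup.closure_induction with
  | mem y hy =>
    obtain ⟨a, -, b, -, rfl⟩ := hy
    simp only [commutatorElement_def, hx.mul, hx.inv]
    ring
  | one => exact hx.one i
  | mul y z _ _ hy hz => rw [hx.mul, hy, hz, add_zero]
  | inv y _ hy => rw [hx.inv, hy, neg_zero]

theorem lowerCentralSeries_eq_zero (hx : IsMarked ε x) {g : G} {k : ℕ} (hk : 1 ≤ k)
    (hg : g ∈ (⊤ : Subgroup G).lowerCentralSeries k) (i : Fin n) : ε g i = 0 :=
  hx.commutator_eq_zero ((⊤ : Subgroup G).lowerCentralSeries_antitone hk hg) i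

theorem lift_eq (hx : IsMarked ε x) (w : FreeGroup (Fin n)) :
    ε (FreeGroup.lift x w) = (magnus w).deg₁ := by
  rw [hom_eq_sum_deg₁ (fun w => ε (FreeGroup.lift x w)) (fun y z => by
    ext i; simp [hx.mul])]
  simp only [FreeGroup.lift_apply_of, hx.basis]
  ext i
  simp [Finset.sum_apply, Pi.single_apply]

theorem deg₁_of_mem_relSub (hx : IsMarked ε x) {k : ℕ} (hk : 1 ≤ k) {w : FreeGroup (Fin n)}
    (hw : w ∈ relSub x k) (i : Fin n) : (magnus w).deg₁ i = 0 := by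
  rw [← hx.lift_eq]
  exact hx.lowerCentralSeries_eq_zero hk hw i

theorem range_sup_eq_top (hx : IsMarked ε x) (k : ℕ) :
    (FreeGroup.lift x).range ⊔ (⊤ : Subgroup G).lowerCentralSeries k = ⊤ := by
  have h1 : (FreeGroup.lift x).range ⊔ (⊤ : Subgroup G).lowerCentralSeries 1 = ⊤ := by
    rw [eq_top_iff]
    intro g _
    obtain ⟨w, hw⟩ := exists_deg₁ (ε g)
    have : (FreeGroup.lift x w)⁻¹ * g ∈ commutator G := hx.ker _ fun i => by
      rw [hx.mul, hx.inv, hx.lift_eq, hw, neg_add_cancel]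
    rw [← mul_inv_cancel_left (FreeGroup.lift x w) g]
    exact Subgroup.mul_mem_sup ⟨w, rfl⟩ this
  induction k with
  | zero => simp
  | succ k ih =>
    rcases Nat.eq_zero_or_pos k with rfl | hk
    · exact h1
    rw [eq_top_iff]
    refine h1.ge.trans (sup_le_iff.mpr ⟨le_sup_left, ?_⟩)
    rw [Subgroup.top_lowerCentralSeries_one, commutator, Subgroup.commutator_le]
    have dec : ∀ g : G, ∃ w, ∃ z ∈ (⊤ : Subgroup G).lowerCentralSeries k, FreeGroup.lift x w * z = g := by
      intro g
      obtain ⟨_, ⟨w, rfl⟩, z, hz, e⟩ := Subgroup.mem_sup_of_normal_right.mp (ih.ge (Subgroup.mem_top g))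
      exact ⟨w, z, hz, e⟩
    intro g _ h _
    obtain ⟨w, z, hz, rfl⟩ := dec g
    obtain ⟨w', z', hz', rfl⟩ := dec h
    have e : (QuotientGroup.mk' ((⊤ : Subgroup G).lowerCentralSeries (k + 1))) ⁅FreeGroup.lift x w * z, FreeGroup.lift x w' * z'⁆ =
        QuotientGroup.mk' ((⊤ : Subgroup G).lowerCentralSeries (k + 1)) ⁅FreeGroup.lift x w, FreeGroup.lift x w'⁆ := by
      have cz := mk_mem_center hz
      have cz' := mk_mem_center hz'
      have c1 : ∀ {Q : Type _} [Group Q] {a b z : Q}, z ∈ Subgroup.center Q → ⁅a * z, b⁆ = ⁅a, b⁆ := by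
        intro Q _ a b z hz
        have : ⁅z, b⁆ = 1 := commutatorElement_eq_one_iff_mul_comm.mpr
          (Subgroup.mem_center_iff.mp hz b).symm
        rw [commutatorElement_mul_left_eq_conj_mul, this, mul_one, mul_inv_cancel, one_mul]
      rw [map_commutatorElement, map_commutatorElement, map_mul, map_mul]
      rw [c1 (by exact cz), ← commutatorElement_inv, c1 (by exact cz'), commutatorElement_inv]
    have e' := QuotientGroup.eq.mp e.symm
    rw [← mul_inv_cancel_left ⁅FreeGroup.lift x w, FreeGroup.lift x w'⁆
      ⁅FreeGroup.lift x w * z, FreeGroup.lift x w' * z'⁆]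
    exact Subgroup.mul_mem_sup ⟨⁅w, w'⁆, map_commutatorElement _ _ _⟩ e'

theorem exists_lift (hx : IsMarked ε x) (k : ℕ) (g : G) :
    ∃ w, (FreeGroup.lift x w)⁻¹ * g ∈ (⊤ : Subgroup G).lowerCentralSeries k := by
  obtain ⟨_, ⟨w, rfl⟩, z, hz, e⟩ := Subgroup.mem_sup_of_normal_right.mp
    ((hx.range_sup_eq_top k).ge (Subgroup.mem_top g))
  exact ⟨w, by rw [← e]; simpa using hz⟩

/-- The projection of the free group to `G / γ` is surjective. -/
theorem mk_lift_surjective (hx : IsMarked ε x) (k : ℕ) :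
    Function.Surjective
      ((QuotientGroup.mk' ((⊤ : Subgroup G).lowerCentralSeries k)).comp (FreeGroup.lift x)) := by
  intro g
  obtain ⟨g, rfl⟩ := QuotientGroup.mk_surjective g
  obtain ⟨w, hw⟩ := hx.exists_lift k g
  exact ⟨w, QuotientGroup.eq.mpr hw⟩

theorem exists_lift_gamma_three (hx : IsMarked ε x) {g : G}
    (hg : g ∈ (⊤ : Subgroup G).lowerCentralSeries 2) :
    ∃ w ∈ (⊤ : Subgroup (FreeGroup (Fin n))).lowerCentralSeries 2,
      (FreeGroup.lift x w)⁻¹ * g ∈ (⊤ : Subgroup G).lowerCentralSeries 3 := by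
  have h := Subgroup.map_lowerCentralSeries (⊤ : Subgroup (FreeGroup (Fin n)))
    ((QuotientGroup.mk' ((⊤ : Subgroup G).lowerCentralSeries 3)).comp (FreeGroup.lift x)) 2
  rw [← MonoidHom.range_eq_map, MonoidHom.range_eq_top.mpr (hx.mk_lift_surjective 3)] at h
  have h2 := map_mem_lowerCentralSeries (QuotientGroup.mk' ((⊤ : Subgroup G).lowerCentralSeries 3)) hg
  rw [← h] at h2
  obtain ⟨w, hw, e⟩ := h2
  exact ⟨w, hw, QuotientGroup.eq.mp e⟩

end IsMarked

/-! ### The relations of degree `2` -/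

/-- The coefficients of degree `2` of the relations of `G / γ₄ G`. -/
def IsMarked.rel₂ (hx : IsMarked ε x) : AddSubgroup (Fin n → Fin n → ℤ) where
  carrier := {b | ∃ r ∈ relSub x 3, (magnus r).deg₂ = b}
  zero_mem' := ⟨1, one_mem _, by ext; simp⟩
  add_mem' := by
    rintro _ _ ⟨r, hr, rfl⟩ ⟨r', hr', rfl⟩
    refine ⟨r * r', mul_mem hr hr', ?_⟩
    ext i j
    simp [hx.deg₁_of_mem_relSub (by norm_num) hr]
  neg_mem' := by
    rintro _ ⟨r, hr, rfl⟩
    refine ⟨r⁻¹, inv_mem hr, ?_⟩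
    ext i j
    simp [hx.deg₁_of_mem_relSub (by norm_num) hr]

theorem IsMarked.mem_rel₂ (hx : IsMarked ε x) {b : Fin n → Fin n → ℤ} :
    b ∈ hx.rel₂ ↔ ∃ r ∈ relSub x 3, (magnus r).deg₂ = b := Iff.rfl

theorem deg₁_of_mem_lowerCentralSeries {w : FreeGroup (Fin n)} {k : ℕ} (hk : 1 ≤ k)
    (hw : w ∈ (⊤ : Subgroup (FreeGroup (Fin n))).lowerCentralSeries k) (i : Fin n) :
    (magnus w).deg₁ i = 0 :=
  deg₁_of_mem_commutator ((⊤ : Subgroup (FreeGroup (Fin n))).lowerCentralSeries_antitone hk hw) i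

theorem deg₂_of_mem_gamma_three {w : FreeGroup (Fin n)}
    (hw : w ∈ (⊤ : Subgroup (FreeGroup (Fin n))).lowerCentralSeries 2) (i j : Fin n) :
    (magnus w).deg₂ i j = 0 := by
  induction hw using Subgroup.closure_induction with
  | mem y hy =>
    obtain ⟨a, ha, b, -, rfl⟩ := hy
    have := deg₁_of_mem_lowerCentralSeries le_rfl ha
    rw [map_commutatorElement, MagnusGroup.commutator_deg₂, this, this]
    ring
  | one => simp
  | mul y z hy _ ihy ihz =>
    simp [ihy, ihz, deg₁_of_mem_lowerCentralSeries (k := 2) (by norm_num) hy]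
  | inv y hy ihy => simp [ihy, deg₁_of_mem_lowerCentralSeries (k := 2) (by norm_num) hy]

theorem deg₂_antisymm {w : FreeGroup (Fin n)} (hw : ∀ i, (magnus w).deg₁ i = 0) (i j : Fin n) :
    (magnus w).deg₂ j i = -(magnus w).deg₂ i j := by
  have := magnus_shuffle w i j
  simp only [hw, ite_self, mul_zero, add_zero] at this
  linarith

theorem IsMarked.rel₂_antisymm (hx : IsMarked ε x) {b : Fin n → Fin n → ℤ} (hb : b ∈ hx.rel₂)
    (i j : Fin n) : b j i = -b i j := by
  obtain ⟨r, hr, rfl⟩ := hb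
  exact deg₂_antisymm (hx.deg₁_of_mem_relSub (by norm_num) hr) i j

/-- The relations of `G / γ₃ G` have the same coefficients of degree `2`. -/
theorem IsMarked.deg₂_mem_rel₂ (hx : IsMarked ε x) {r : FreeGroup (Fin n)} (hr : r ∈ relSub x 2) :
    (magnus r).deg₂ ∈ hx.rel₂ := by
  obtain ⟨w, hw, e⟩ := hx.exists_lift_gamma_three hr
  have hw' : ∀ i, (magnus w).deg₁ i = 0 := fun i =>
    hx.deg₁_of_mem_relSub (by norm_num) (lowerCentralSeries_le_relSub x 2 hw) i
  refine ⟨w⁻¹ * r, by rw [mem_relSub]; simpa using e, ?_⟩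
  have hw2 := deg₂_of_mem_gamma_three hw
  ext i j
  simp [hw', hw2]

end Marked

open scoped commutatorElement

/-! ### Brackets in degree `3` -/

section Brackets

variable {n : ℕ}

/-- `K ⊗ H + H ⊗ K` for a group `K` of tensors of degree `2`. -/
def tensorSpan (K : AddSubgroup (Fin n → Fin n → ℤ)) : AddSubgroup (Fin n → Fin n → Fin n → ℤ) :=
  AddSubgroup.closure {c | ∃ b ∈ K, ∃ a : Fin n → ℤ,
    c = (fun i j k => a i * b j k) ∨ c = (fun i j k => b i j * a k)}

/-- `[H, K]` for a group `K` of tensors of degree `2`. -/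
def bracketSpan (K : AddSubgroup (Fin n → Fin n → ℤ)) : AddSubgroup (Fin n → Fin n → Fin n → ℤ) :=
  AddSubgroup.closure {c | ∃ b ∈ K, ∃ a : Fin n → ℤ,
    c = (fun i j k => a i * b j k - b i j * a k)}

/-- The tensors on which bracketing is multiplication by `3`; Lie elements of degree `3` have this
property. -/
def dynkin (n : ℕ) : AddSubgroup (Fin n → Fin n → Fin n → ℤ) where
  carrier := {c | ∀ i j k, 3 * c i j k = c i j k - c i k j - c k i j + c k j i}
  zero_mem' := by simp
  add_mem' := by
    intro c c' h h' i j k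
    have := h i j k
    have := h' i j k
    simp only [Pi.add_apply]
    linarith
  neg_mem' := by
    intro c h i j k
    have := h i j k
    simp only [Pi.neg_apply]
    linarith

theorem bracketSpan_le_dynkin {K : AddSubgroup (Fin n → Fin n → ℤ)}
    (hK : ∀ b ∈ K, ∀ i j, b j i = -b i j) : bracketSpan K ≤ dynkin n := by
  rw [bracketSpan, AddSubgroup.closure_le]
  rintro _ ⟨b, hb, a, rfl⟩ i j k
  have e1 := hK b hb j k
  have e2 := hK b hb i j
  have e3 := hK b hb i k
  simp only [e1, e2, e3]
  ring

/-- Lie elements in `K ⊗ H + H ⊗ K` are in `[H, K]`. -/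
theorem mem_bracketSpan_of_mem_tensorSpan {K : AddSubgroup (Fin n → Fin n → ℤ)}
    (hK : ∀ b ∈ K, ∀ i j, b j i = -b i j) {c : Fin n → Fin n → Fin n → ℤ}
    (hc : c ∈ tensorSpan K) (hd : c ∈ dynkin n) : c ∈ bracketSpan K := by
  have key : ∃ d ∈ bracketSpan K, ∀ i j k, (c - d) i k j = -(c - d) i j k := by
    clear hd
    induction hc using AddSubgroup.closure_induction with
    | mem c hc =>
      obtain ⟨b, hb, a, rfl | rfl⟩ := hc
      · refine ⟨0, zero_mem _, fun i j k => ?_⟩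
        simp [hK b hb j k]
      · refine ⟨-(fun i j k => a i * b j k - b i j * a k),
          neg_mem (AddSubgroup.subset_closure ⟨b, hb, a, rfl⟩), fun i j k => ?_⟩
        simp [hK b hb j k]
    | zero => exact ⟨0, zero_mem _, by simp⟩
    | add c c' _ _ h h' =>
      obtain ⟨d, hd, e⟩ := h
      obtain ⟨d', hd', e'⟩ := h'
      refine ⟨d + d', add_mem hd hd', fun i j k => ?_⟩
      have := e i j k
      have := e' i j k
      simp only [Pi.sub_apply, Pi.add_apply] at *
      linarith
    | neg c _ h =>
      obtain ⟨d, hd, e⟩ := h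
      refine ⟨-d, neg_mem hd, fun i j k => ?_⟩
      have := e i j k
      simp only [Pi.sub_apply, Pi.neg_apply] at *
      linarith
  obtain ⟨d, hdK, e⟩ := key
  have hy : c - d ∈ dynkin n := sub_mem hd (bracketSpan_le_dynkin hK hdK)
  have h0 : ∀ i j k, (c - d) i j k = 0 := by
    have rot : ∀ i j k, (c - d) i j k = -2 * (c - d) k i j := fun i j k => by
      have h1 := hy i j k
      have h2 := e i j k
      have h3 := e k i j
      linarith
    intro i j k
    have h1 := rot i j k
    have h2 := rot k i j
    have h3 := rot j k i
    linarith
  have : c = d := by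
    ext i j k
    have := h0 i j k
    simp only [Pi.sub_apply] at this
    linarith
  rwa [this]

theorem deg₃_mem_dynkin {w : FreeGroup (Fin n)}
    (hw : w ∈ (⊤ : Subgroup (FreeGroup (Fin n))).lowerCentralSeries 2) :
    (magnus w).deg₃ ∈ dynkin n := by
  induction hw using Subgroup.closure_induction with
  | mem y hy =>
    obtain ⟨a, ha, b, -, rfl⟩ := hy
    have h1 := deg₁_of_mem_lowerCentralSeries le_rfl ha
    have : (magnus ⁅a, b⁆).deg₃ = -(fun i j k => (magnus b).deg₁ i * (magnus a).deg₂ j k -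
        (magnus a).deg₂ i j * (magnus b).deg₁ k) := by
      ext i j k
      rw [← commutatorElement_inv, map_inv, map_commutatorElement, MagnusGroup.inv_deg₃,
        MagnusGroup.commutator_deg₃ _ _ h1]
      simp [MagnusGroup.commutator_deg₁]
    rw [this]
    refine neg_mem fun i j k => ?_
    rw [deg₂_antisymm h1 i j, deg₂_antisymm h1 j k, deg₂_antisymm h1 i k]
    ring
  | one => exact zero_mem _
  | mul y z hy _ ihy ihz =>
    have h1 := deg₁_of_mem_lowerCentralSeries (k := 2) (by norm_num) hy
    have h2 := deg₂_of_mem_gamma_three hy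
    have : (magnus (y * z)).deg₃ = (magnus y).deg₃ + (magnus z).deg₃ := by
      ext i j k; simp [h1, h2]
    rw [this]
    exact add_mem ihy ihz
  | inv y hy ihy =>
    have h1 := deg₁_of_mem_lowerCentralSeries (k := 2) (by norm_num) hy
    have h2 := deg₂_of_mem_gamma_three hy
    have : (magnus y⁻¹).deg₃ = -(magnus y).deg₃ := by
      ext i j k; simp [h1]
    rw [this]
    exact neg_mem ihy

end Brackets

section Marked

variable {n : ℕ} {G : Type*} [Group G] {ε : G → Fin n → ℤ} {x : Fin n → G}

theorem IsMarked.exists_relSub_of_mem_bracketSpan (hx : IsMarked ε x)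
    {c : Fin n → Fin n → Fin n → ℤ} (hc : c ∈ bracketSpan hx.rel₂) :
    ∃ y ∈ relSub x 3, y ∈ (⊤ : Subgroup (FreeGroup (Fin n))).lowerCentralSeries 2 ∧
      (magnus y).deg₃ = c := by
  induction hc using AddSubgroup.closure_induction with
  | mem c hc =>
    obtain ⟨b, ⟨r, hr, rfl⟩, a, rfl⟩ := hc
    obtain ⟨w, rfl⟩ := exists_deg₁ a
    have hr1 := hx.deg₁_of_mem_relSub (by norm_num) hr
    refine ⟨⁅w, r⁆, ?_, ?_, ?_⟩
    · rw [commutatorElement_def]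
      exact mul_mem ((inferInstance : (relSub x 3).Normal).conj_mem r hr w) (inv_mem hr)
    · rw [← commutatorElement_inv]
      exact inv_mem (Subgroup.commutator_mem_commutator (mem_commutator_of_deg₁ hr1)
        (Subgroup.mem_top _))
    · ext i j k
      rw [map_commutatorElement, MagnusGroup.commutator_deg₃ _ _ hr1]
  | zero => exact ⟨1, one_mem _, one_mem _, rfl⟩
  | add c c' _ _ h h' =>
    obtain ⟨y, hy, hy', rfl⟩ := h
    obtain ⟨z, hz, hz', rfl⟩ := h'
    refine ⟨y * z, mul_mem hy hz, mul_mem hy' hz', ?_⟩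
    ext i j k
    simp [deg₁_of_mem_lowerCentralSeries (k := 2) (by norm_num) hy', deg₂_of_mem_gamma_three hy']
  | neg c _ h =>
    obtain ⟨y, hy, hy', rfl⟩ := h
    refine ⟨y⁻¹, inv_mem hy, inv_mem hy', ?_⟩
    ext i j k
    simp [deg₁_of_mem_lowerCentralSeries (k := 2) (by norm_num) hy']

/-- An element of `γ₃` of the free group is a relation of `G / γ₄ G` as soon as its coefficients of
degree `3` are in `K ⊗ H + H ⊗ K`. -/
theorem IsMarked.mem_relSub_of_mem_tensorSpan (hx : IsMarked ε x) {y : FreeGroup (Fin n)}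
    (hy : y ∈ (⊤ : Subgroup (FreeGroup (Fin n))).lowerCentralSeries 2)
    (h : (magnus y).deg₃ ∈ tensorSpan hx.rel₂) : y ∈ relSub x 3 := by
  obtain ⟨z, hz, hz', e⟩ := hx.exists_relSub_of_mem_bracketSpan
    (mem_bracketSpan_of_mem_tensorSpan (fun b hb => hx.rel₂_antisymm hb) h (deg₃_mem_dynkin hy))
  rw [← inv_mul_cancel_right y z]
  refine mul_mem (lowerCentralSeries_le_relSub x 3 (mem_gamma_four_of_deg₃ ?_ ?_ ?_)) hz
  all_goals
    have h1 := deg₁_of_mem_lowerCentralSeries (k := 2) (by norm_num) hy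
    have h2 := deg₁_of_mem_lowerCentralSeries (k := 2) (by norm_num) hz'
    simp [h1, h2, deg₂_of_mem_gamma_three hy, deg₂_of_mem_gamma_three hz', e]

/-! ### Bar cycles -/

/-- The boundary `(g, h) ↦ g + h - gh` of the bar complex. -/
def barBdry (G : Type*) [Group G] : (G × G →₀ ℤ) →ₗ[ℤ] (G →₀ ℤ) :=
  Finsupp.lift _ ℤ _ fun p => Finsupp.single p.1 1 + Finsupp.single p.2 1 - Finsupp.single (p.1 * p.2) 1

/-- The value of a 2-cochain of the group `G`. -/
def barEval {A : Type*} [AddCommGroup A] (F : G → G → A) : (G × G →₀ ℤ) →ₗ[ℤ] A :=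
  Finsupp.linearCombination ℤ fun p => F p.1 p.2

@[simp] theorem barBdry_single (g h : G) : barBdry G (Finsupp.single (g, h) 1) =
    Finsupp.single g 1 + Finsupp.single h 1 - Finsupp.single (g * h) 1 := by
  simp [barBdry]

@[simp] theorem barEval_single {A : Type*} [AddCommGroup A] (F : G → G → A) (g h : G) :
    barEval F (Finsupp.single (g, h) 1) = F g h := by
  rw [barEval, Finsupp.linearCombination_single]
  exact one_smul ℤ _

/-- The value of a 1-cochain of the group `G`. -/
def barEval₁ {A : Type*} [AddCommGroup A] (F : G → A) : (G →₀ ℤ) →ₗ[ℤ] A :=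
  Finsupp.linearCombination ℤ F

@[simp] theorem barEval₁_single {A : Type*} [AddCommGroup A] (F : G → A) (g : G) :
    barEval₁ F (Finsupp.single g 1) = F g := by
  rw [barEval₁, Finsupp.linearCombination_single]
  exact one_smul ℤ _

namespace IsMarked

/-- A set-theoretic section of the projection of the free group to `G / γ₄ G`. -/
def sec (hx : IsMarked ε x) (g : G) : FreeGroup (Fin n) := (hx.exists_lift 3 g).choose

theorem sec_spec (hx : IsMarked ε x) (g : G) :
    (FreeGroup.lift x (hx.sec g))⁻¹ * g ∈ (⊤ : Subgroup G).lowerCentralSeries 3 :=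
  (hx.exists_lift 3 g).choose_spec

theorem mk_sec (hx : IsMarked ε x) (g : G) :
    QuotientGroup.mk' ((⊤ : Subgroup G).lowerCentralSeries 3) (FreeGroup.lift x (hx.sec g)) =
      QuotientGroup.mk' ((⊤ : Subgroup G).lowerCentralSeries 3) g :=
  QuotientGroup.eq.mpr (hx.sec_spec g)

/-- The coefficients of degree `2` of an element of `G`, well defined modulo `K`. -/
def coef₂ (hx : IsMarked ε x) (g : G) : Fin n → Fin n → ℤ := (magnus (hx.sec g)).deg₂

theorem deg₁_sec (hx : IsMarked ε x) (g : G) : (magnus (hx.sec g)).deg₁ = ε g := by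
  ext i
  have := hx.lowerCentralSeries_eq_zero (by norm_num) (hx.sec_spec g) i
  rw [hx.mul, hx.inv, hx.lift_eq] at this
  linarith

theorem mul_inv_mem_relSub (_ : IsMarked ε x) {v w : FreeGroup (Fin n)}
    (h : QuotientGroup.mk' ((⊤ : Subgroup G).lowerCentralSeries 3) (FreeGroup.lift x v) =
      QuotientGroup.mk' ((⊤ : Subgroup G).lowerCentralSeries 3) (FreeGroup.lift x w)) :
    v * w⁻¹ ∈ relSub x 3 := by
  rw [mem_relSub, ← QuotientGroup.eq_one_iff, map_mul, map_inv]
  change QuotientGroup.mk' _ (_ * _) = 1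
  rw [map_mul, map_inv, h, mul_inv_cancel]

theorem coef₂_lift (hx : IsMarked ε x) (w : FreeGroup (Fin n)) :
    (magnus w).deg₂ - hx.coef₂ (FreeGroup.lift x w) ∈ hx.rel₂ := by
  have h := hx.mul_inv_mem_relSub (hx.mk_sec (FreeGroup.lift x w)).symm
  refine ⟨_, h, ?_⟩
  have h1 := hx.deg₁_of_mem_relSub (by norm_num) h
  have h2 : magnus w = magnus (w * (hx.sec (FreeGroup.lift x w))⁻¹) *
      magnus (hx.sec (FreeGroup.lift x w)) := by
    rw [← map_mul, inv_mul_cancel_right]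
  ext i j
  conv_rhs => rw [h2]
  simp only [Pi.sub_apply, MagnusGroup.mul_deg₂, h1, coef₂]
  ring

theorem coef₂_mul (hx : IsMarked ε x) (g h : G) :
    (fun i j => hx.coef₂ g i j + hx.coef₂ h i j + ε g i * ε h j - hx.coef₂ (g * h) i j) ∈ hx.rel₂ := by
  have e : QuotientGroup.mk' ((⊤ : Subgroup G).lowerCentralSeries 3)
      (FreeGroup.lift x (hx.sec g * hx.sec h)) =
      QuotientGroup.mk' ((⊤ : Subgroup G).lowerCentralSeries 3)
      (FreeGroup.lift x (hx.sec (g * h))) := by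
    rw [map_mul, map_mul, hx.mk_sec, hx.mk_sec, hx.mk_sec, map_mul]
  have hr := hx.mul_inv_mem_relSub e
  refine ⟨_, hr, ?_⟩
  have h1 := hx.deg₁_of_mem_relSub (by norm_num) hr
  have h2 : magnus (hx.sec g * hx.sec h) = magnus (hx.sec g * hx.sec h * (hx.sec (g * h))⁻¹) *
      magnus (hx.sec (g * h)) := by
    rw [← map_mul, inv_mul_cancel_right]
  ext i j
  have h3 := congrArg (fun m => MagnusGroup.deg₂ m i j) h2
  simp only [map_mul magnus (hx.sec g) (hx.sec h), MagnusGroup.mul_deg₂, h1, deg₁_sec] at h3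
  simp only [coef₂]
  linarith

/-- The coefficients of degree `2` vanish on `γ₃ G`, up to relations. -/
theorem coef₂_gamma_three (hx : IsMarked ε x) {g : G}
    (hg : g ∈ (⊤ : Subgroup G).lowerCentralSeries 2) : hx.coef₂ g ∈ hx.rel₂ := by
  refine hx.deg₂_mem_rel₂ ?_
  rw [mem_relSub]
  have h1 := (⊤ : Subgroup G).lowerCentralSeries_antitone (show 2 ≤ 3 by norm_num) (hx.sec_spec g)
  have := mul_mem hg (inv_mem h1)
  simpa using this

/-- `S` vanishes on `K ⊗ H + H ⊗ K`. -/
structure Kills (hx : IsMarked ε x) (S : Fin n → Fin n → Fin n → ℤ) : Prop where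
  left : ∀ b ∈ hx.rel₂, ∀ k, ∑ i, ∑ j, S i j k * b i j = 0
  right : ∀ b ∈ hx.rel₂, ∀ i, ∑ j, ∑ k, S i j k * b j k = 0

end IsMarked

/-- The pairing of tensors of degree `3`. -/
def pair₃ (S c : Fin n → Fin n → Fin n → ℤ) : ℤ := ∑ i, ∑ j, ∑ k, S i j k * c i j k

/-- `a ⊗ b' + b ⊗ a'`. -/
def cross (a : Fin n → ℤ) (b : Fin n → Fin n → ℤ) (a' : Fin n → ℤ) (b' : Fin n → Fin n → ℤ) :
    Fin n → Fin n → Fin n → ℤ := fun i j k => a i * b' j k + b i j * a' k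

theorem pair₃_add (S c c' : Fin n → Fin n → Fin n → ℤ) :
    pair₃ S (c + c') = pair₃ S c + pair₃ S c' := by
  simp [pair₃, mul_add, Finset.sum_add_distrib]

theorem pair₃_neg (S c : Fin n → Fin n → Fin n → ℤ) : pair₃ S (-c) = -pair₃ S c := by
  simp [pair₃]

theorem pair₃_sub (S c c' : Fin n → Fin n → Fin n → ℤ) :
    pair₃ S (c - c') = pair₃ S c - pair₃ S c' := by
  rw [sub_eq_add_neg, pair₃_add, pair₃_neg, ← sub_eq_add_neg]

theorem pair₃_zero (S : Fin n → Fin n → Fin n → ℤ) : pair₃ S 0 = 0 := by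
  simp [pair₃]

namespace IsMarked

theorem Kills.pair_left {hx : IsMarked ε x} {S : Fin n → Fin n → Fin n → ℤ} (hS : hx.Kills S)
    {b : Fin n → Fin n → ℤ} (hb : b ∈ hx.rel₂) (a : Fin n → ℤ) :
    pair₃ S (fun i j k => b i j * a k) = 0 := by
  have : pair₃ S (fun i j k => b i j * a k) = ∑ k, (∑ i, ∑ j, S i j k * b i j) * a k := by
    simp only [pair₃, Finset.sum_mul]
    rw [Finset.sum_comm' (t' := Finset.univ) (s' := fun _ => Finset.univ) (by simp)]
    conv_rhs => rw [Finset.sum_comm]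
    rw [Finset.sum_comm]
    refine Finset.sum_congr rfl fun i _ => ?_
    rw [Finset.sum_comm]
    exact Finset.sum_congr rfl fun _ _ => Finset.sum_congr rfl fun _ _ => by ring
  rw [this]
  simp [hS.left b hb]

theorem Kills.pair_right {hx : IsMarked ε x} {S : Fin n → Fin n → Fin n → ℤ} (hS : hx.Kills S)
    {b : Fin n → Fin n → ℤ} (hb : b ∈ hx.rel₂) (a : Fin n → ℤ) :
    pair₃ S (fun i j k => a i * b j k) = 0 := by
  have : pair₃ S (fun i j k => a i * b j k) = ∑ i, (∑ j, ∑ k, S i j k * b j k) * a i := by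
    simp only [pair₃, Finset.sum_mul]
    exact Finset.sum_congr rfl fun _ _ => Finset.sum_congr rfl fun _ _ =>
      Finset.sum_congr rfl fun _ _ => by ring
  rw [this]
  simp [hS.right b hb]

/-- `cross` only depends on the arguments of degree `2` modulo `K`. -/
theorem Kills.pair_cross_congr {hx : IsMarked ε x} {S : Fin n → Fin n → Fin n → ℤ} (hS : hx.Kills S)
    (a a' : Fin n → ℤ) {b₁ b₂ b₁' b₂' : Fin n → Fin n → ℤ} (hb : b₁ - b₂ ∈ hx.rel₂)
    (hb' : b₁' - b₂' ∈ hx.rel₂) :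
    pair₃ S (cross a b₁ a' b₁') = pair₃ S (cross a b₂ a' b₂') := by
  rw [← sub_eq_zero, ← pair₃_sub]
  have : cross a b₁ a' b₁' - cross a b₂ a' b₂' =
      (fun i j k => a i * (b₁' - b₂') j k) + (fun i j k => (b₁ - b₂) i j * a' k) := by
    ext i j k
    simp [cross]
    ring
  rw [this, pair₃_add, hS.pair_right hb', hS.pair_left hb, add_zero]

/-- The 2-cochain of `G` which is the obstruction to extending the coefficients of degree at
most `2` to degree `3`, paired with `S`. -/
def obstr (hx : IsMarked ε x) (S : Fin n → Fin n → Fin n → ℤ) (g h : G) : ℤ :=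
  pair₃ S (cross (ε g) (hx.coef₂ g) (ε h) (hx.coef₂ h))

theorem Kills.obstr_cocycle {hx : IsMarked ε x} {S : Fin n → Fin n → Fin n → ℤ} (hS : hx.Kills S)
    (g h k : G) : hx.obstr S h k - hx.obstr S (g * h) k + hx.obstr S g (h * k) - hx.obstr S g h = 0 := by
  have e1 : hx.obstr S (g * h) k = pair₃ S (cross (fun i => ε g i + ε h i)
      (fun i j => hx.coef₂ g i j + hx.coef₂ h i j + ε g i * ε h j) (ε k) (hx.coef₂ k)) := by
    rw [obstr, show ε (g * h) = fun i => ε g i + ε h i from funext (hx.mul g h)]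
    refine hS.pair_cross_congr _ _ ?_ (by simp [zero_mem])
    rw [← neg_sub]
    exact neg_mem (hx.coef₂_mul g h)
  have e2 : hx.obstr S g (h * k) = pair₃ S (cross (ε g) (hx.coef₂ g) (fun i => ε h i + ε k i)
      (fun i j => hx.coef₂ h i j + hx.coef₂ k i j + ε h i * ε k j)) := by
    rw [obstr, show ε (h * k) = fun i => ε h i + ε k i from funext (hx.mul h k)]
    refine hS.pair_cross_congr _ _ (by simp [zero_mem]) ?_
    rw [← neg_sub]
    exact neg_mem (hx.coef₂_mul h k)
  rw [e1, e2]
  simp only [obstr, ← pair₃_sub, ← pair₃_add]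
  rw [← pair₃_zero S]
  congr 1
  ext i j k
  simp [cross]
  ring

/-- `Σ ε(g) ⊗ ε(h)` is a relation of degree `2` for every bar cycle. -/
theorem barEval_mem_rel₂ (hx : IsMarked ε x) {c : G × G →₀ ℤ} (hc : barBdry G c = 0) :
    barEval (fun g h i j => ε g i * ε h j) c ∈ hx.rel₂ := by
  have e : barEval (fun g h i j => ε g i * ε h j) = barEval (fun g h i j =>
        hx.coef₂ g i j + hx.coef₂ h i j + ε g i * ε h j - hx.coef₂ (g * h) i j) -
      barEval₁ hx.coef₂ ∘ₗ barBdry G := by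
    refine Finsupp.lhom_ext' fun p => LinearMap.ext_ring ?_
    obtain ⟨g, h⟩ := p
    simp only [LinearMap.comp_apply, Finsupp.lsingle_apply, LinearMap.sub_apply]
    ext i j
    simp
  rw [e]
  simp only [LinearMap.sub_apply, LinearMap.comp_apply, hc, map_zero, sub_zero]
  rw [barEval, Finsupp.linearCombination_apply]
  exact hx.rel₂.sum_mem fun p _ => hx.rel₂.zsmul_mem (hx.coef₂_mul p.1 p.2) _

theorem barEval_apply₂ (F : G → G → Fin n → Fin n → ℤ) (c : G × G →₀ ℤ) (i j : Fin n) :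
    barEval F c i j = barEval (fun g h => F g h i j) c := by
  simp [barEval, Finsupp.linearCombination_apply, Finsupp.sum, Finset.sum_apply]

theorem obstr_one_left (hx : IsMarked ε x) {S : Fin n → Fin n → Fin n → ℤ} (hS : hx.Kills S) (g : G)
    {m : G} (hm : m ∈ (⊤ : Subgroup G).lowerCentralSeries 2) : hx.obstr S m g = 0 := by
  have h1 : ε m = 0 := funext fun i => hx.lowerCentralSeries_eq_zero (by norm_num) hm i
  rw [obstr, hS.pair_cross_congr (b₂ := 0) (b₂' := hx.coef₂ g) _ _
    (by simpa using hx.coef₂_gamma_three hm) (by simp [zero_mem]), h1]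
  simp [pair₃, cross]

theorem obstr_one_right (hx : IsMarked ε x) {S : Fin n → Fin n → Fin n → ℤ} (hS : hx.Kills S) (g : G)
    {m : G} (hm : m ∈ (⊤ : Subgroup G).lowerCentralSeries 2) : hx.obstr S g m = 0 := by
  have h1 : ε m = 0 := funext fun i => hx.lowerCentralSeries_eq_zero (by norm_num) hm i
  rw [obstr, hS.pair_cross_congr (b₂ := hx.coef₂ g) (b₂' := 0) _ _ (by simp [zero_mem])
    (by simpa using hx.coef₂_gamma_three hm), h1]
  simp [pair₃, cross]

/-- Elements of `γ₄ G` bound chains without contribution in degrees `2` and `3`. -/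
theorem exists_chain_gamma_four (hx : IsMarked ε x) {k : G}
    (hk : k ∈ (⊤ : Subgroup G).lowerCentralSeries 3) :
    ∃ c : G × G →₀ ℤ, barBdry G c = Finsupp.single k 1 ∧
      (∀ i j, barEval (fun g h => ε g i * ε h j) c = 0) ∧
      ∀ S, hx.Kills S → barEval (hx.obstr S) c = 0 := by
  have h3 : (⊤ : Subgroup G).lowerCentralSeries 3 ≤ (⊤ : Subgroup G).lowerCentralSeries 2 :=
    (⊤ : Subgroup G).lowerCentralSeries_antitone (by norm_num)
  have e3 : ∀ k ∈ (⊤ : Subgroup G).lowerCentralSeries 3, ∀ i, ε k i = 0 := fun k hk =>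
    hx.lowerCentralSeries_eq_zero (by norm_num) hk
  have h1 : (1 : G) ∈ (⊤ : Subgroup G).lowerCentralSeries 2 := one_mem _
  have hc : ∀ k ∈ (⊤ : Subgroup G).lowerCentralSeries 3, k ∈ Subgroup.closure
    {g | ∃ g₁ ∈ (⊤ : Subgroup G).lowerCentralSeries 2, ∃ g₂ ∈ (⊤ : Subgroup G), ⁅g₁, g₂⁆ = g} :=
    fun k hk => hk
  have := hc k hk
  induction this using Subgroup.closure_induction with
  | mem y hy =>
    obtain ⟨m, hm, l, -, rfl⟩ := hy
    have em := hx.lowerCentralSeries_eq_zero (by norm_num) hm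
    refine ⟨Finsupp.single (⁅m, l⁆, l * m) 1 + Finsupp.single (l, m) 1 - Finsupp.single (m, l) 1,
      ?_, fun i j => ?_, fun S hS => ?_⟩
    · have : ⁅m, l⁆ * (l * m) = m * l := by simp [commutatorElement_def, mul_assoc]
      simp only [map_add, map_sub, barBdry_single, this]
      abel
    · simp [em, e3 _ hk]
    · simp [hx.obstr_one_left hS _ hm, hx.obstr_one_right hS _ hm, hx.obstr_one_left hS _ (h3 hk)]
  | one =>
    refine ⟨Finsupp.single (1, 1) 1, by simp, fun i j => by simp [hx.one], fun S hS => ?_⟩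
    simp [hx.obstr_one_left hS _ h1]
  | mul y z hy hz ihy ihz =>
    obtain ⟨c, b, d, o⟩ := ihy hy
    obtain ⟨c', b', d', o'⟩ := ihz hz
    refine ⟨c + c' - Finsupp.single (y, z) 1, ?_, fun i j => ?_, fun S hS => ?_⟩
    · simp only [map_add, map_sub, barBdry_single, b, b']
      abel
    · simp [d, d', e3 y hy]
    · simp [o S hS, o' S hS, hx.obstr_one_left hS _ (h3 hy)]
  | inv y hy ihy =>
    obtain ⟨c, b, d, o⟩ := ihy hy
    refine ⟨Finsupp.single (y, y⁻¹) 1 + Finsupp.single (1, 1) 1 - c, ?_, fun i j => ?_, fun S hS => ?_⟩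
    · simp only [map_add, map_sub, barBdry_single, b, mul_inv_cancel, mul_one]
      abel
    · simp [d, e3 y hy, hx.one]
    · simp [o S hS, hx.obstr_one_left hS _ (h3 hy), hx.obstr_one_left hS _ h1]

theorem exists_chain_word (hx : IsMarked ε x) (w : FreeGroup (Fin n)) :
    ∃ c : G × G →₀ ℤ, barBdry G c = ∑ i, (magnus w).deg₁ i • Finsupp.single (x i) 1 -
        Finsupp.single (FreeGroup.lift x w) 1 ∧
      (∀ i j, barEval (fun g h => ε g i * ε h j) c = (magnus w).deg₂ i j) ∧
      ∀ S, hx.Kills S → barEval (hx.obstr S) c = pair₃ S (magnus w).deg₃ := by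
  have h1 : (1 : G) ∈ (⊤ : Subgroup G).lowerCentralSeries 2 := one_mem _
  have ob : ∀ S, hx.Kills S → ∀ v w : FreeGroup (Fin n),
      hx.obstr S (FreeGroup.lift x v) (FreeGroup.lift x w) =
        pair₃ S (cross (magnus v).deg₁ (magnus v).deg₂ (magnus w).deg₁ (magnus w).deg₂) := by
    intro S hS v w
    rw [obstr, hx.lift_eq, hx.lift_eq]
    refine hS.pair_cross_congr _ _ ?_ ?_ <;>
    · rw [← neg_sub]
      exact neg_mem (hx.coef₂_lift _)
  have hs : ∀ k : Fin n, ∑ i, (Pi.single (M := fun _ => ℤ) k 1 i) • Finsupp.single (x i) (1 : ℤ) =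
      Finsupp.single (x k) 1 := fun k => by
    rw [Finset.sum_eq_single k]
    · simp
    · intro i _ hi; simp [hi]
    · simp
  induction w using FreeGroup.induction_on with
  | C1 =>
    refine ⟨-Finsupp.single (1, 1) 1, by simp, fun i j => by simp [hx.one], fun S hS => ?_⟩
    simp only [map_neg, barEval_single, hx.obstr_one_left hS _ h1, map_one]
    exact (pair₃_zero S).symm
  | of k =>
    refine ⟨0, by simp only [map_zero, magnus_of_deg₁, hs, FreeGroup.lift_apply_of, sub_self], by simp, fun S hS => ?_⟩
    simp [pair₃]
  | inv_of k _ =>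
    refine ⟨-Finsupp.single (x k, (x k)⁻¹) 1 - Finsupp.single (1, 1) 1, ?_, fun i j => ?_,
      fun S hS => ?_⟩
    · simp only [map_sub, map_neg, barBdry_single, map_inv, MagnusGroup.inv_deg₁, neg_smul,
        Finset.sum_neg_distrib, magnus_of_deg₁, hs, FreeGroup.lift_apply_of, mul_inv_cancel, mul_one]
      abel
    · simp [hx.one, hx.inv, hx.basis]
    · have := ob S hS (FreeGroup.of k) (FreeGroup.of k)⁻¹
      simp only [map_inv, FreeGroup.lift_apply_of] at this
      simp only [map_sub, map_neg, barEval_single, this, hx.obstr_one_left hS _ h1, sub_zero,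
        ← pair₃_neg]
      congr 1
      ext i j l
      simp [cross]
      ring
  | mul v w hv hw =>
    obtain ⟨c, b, d, o⟩ := hv
    obtain ⟨c', b', d', o'⟩ := hw
    refine ⟨c + c' + Finsupp.single (FreeGroup.lift x v, FreeGroup.lift x w) 1, ?_, fun i j => ?_,
      fun S hS => ?_⟩
    · simp only [map_add, barBdry_single, b, b', map_mul, MagnusGroup.mul_deg₁, add_smul,
        Finset.sum_add_distrib]
      abel
    · simp only [map_add, d, d', barEval_single, hx.lift_eq, map_mul, MagnusGroup.mul_deg₂]
    · simp only [map_add, o S hS, o' S hS, barEval_single, ob S hS, ← pair₃_add]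
      congr 1
      ext i j l
      simp [cross]
      ring

/-- Every relation of `G / γ₄ G` comes from a bar cycle. -/
theorem exists_cycle_of_mem_relSub (hx : IsMarked ε x) {r : FreeGroup (Fin n)}
    (hr : r ∈ relSub x 3) :
    ∃ c : G × G →₀ ℤ, barBdry G c = 0 ∧
      (∀ i j, barEval (fun g h => ε g i * ε h j) c = (magnus r).deg₂ i j) ∧
      ∀ S, hx.Kills S → barEval (hx.obstr S) c = pair₃ S (magnus r).deg₃ := by
  obtain ⟨c, b, d, o⟩ := hx.exists_chain_word r
  obtain ⟨c', b', d', o'⟩ := hx.exists_chain_gamma_four hr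
  refine ⟨c + c', ?_, fun i j => ?_, fun S hS => ?_⟩
  · simp [b, b', hx.deg₁_of_mem_relSub (by norm_num) hr]
  · simp [d, d']
  · simp [o S hS, o' S hS]

end IsMarked

end Marked

open scoped commutatorElement

/-! ### Isomorphisms between quotients of marked groups -/

section Endo

variable {n : ℕ}

/-- Endomorphisms of the free group which induce the identity on the abelianization. -/
def IsUnipotent (Ψ : FreeGroup (Fin n) →* FreeGroup (Fin n)) : Prop :=
  ∀ i, (magnus (Ψ (FreeGroup.of i))).deg₁ = Pi.single i 1

/-- Alternating in the last two variables. -/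
structure IsAlt (C : Fin n → Fin n → Fin n → ℤ) : Prop where
  self : ∀ i j, C i j j = 0
  anti : ∀ i j k, C i k j = -C i j k

/-- The part of degree `2` of the images of the generators. -/
def endoCoef (Ψ : FreeGroup (Fin n) →* FreeGroup (Fin n)) (i : Fin n) : Fin n → Fin n → ℤ :=
  (magnus (Ψ (FreeGroup.of i))).deg₂

theorem IsUnipotent.magnus_apply {Ψ : FreeGroup (Fin n) →* FreeGroup (Fin n)} (hΨ : IsUnipotent Ψ)
    (w : FreeGroup (Fin n)) :
    magnus (Ψ w) = MagnusGroup.subst (endoCoef Ψ)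
      (fun i => (magnus (Ψ (FreeGroup.of i))).deg₃) (magnus w) := by
  have : magnus.comp Ψ = (MagnusGroup.subst (endoCoef Ψ)
      (fun i => (magnus (Ψ (FreeGroup.of i))).deg₃)).comp magnus := by
    refine FreeGroup.ext_hom _ _ fun i => ?_
    ext j
    · simp [MagnusGroup.subst, hΨ i]
    · simp [MagnusGroup.subst, endoCoef, Pi.single_apply]
    · simp [MagnusGroup.subst, MagnusGroup.derive, Pi.single_apply]
  exact DFunLike.congr_fun this w

theorem IsUnipotent.deg₁_apply {Ψ : FreeGroup (Fin n) →* FreeGroup (Fin n)} (hΨ : IsUnipotent Ψ)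
    (w : FreeGroup (Fin n)) : (magnus (Ψ w)).deg₁ = (magnus w).deg₁ := by
  rw [hΨ.magnus_apply]; rfl

theorem IsUnipotent.deg₂_apply {Ψ : FreeGroup (Fin n) →* FreeGroup (Fin n)} (hΨ : IsUnipotent Ψ)
    {w : FreeGroup (Fin n)} (hw : ∀ i, (magnus w).deg₁ i = 0) :
    (magnus (Ψ w)).deg₂ = (magnus w).deg₂ := by
  rw [hΨ.magnus_apply]
  ext i j
  simp [MagnusGroup.subst, hw]

theorem IsUnipotent.deg₃_apply {Ψ : FreeGroup (Fin n) →* FreeGroup (Fin n)} (hΨ : IsUnipotent Ψ)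
    {w : FreeGroup (Fin n)} (hw : ∀ i, (magnus w).deg₁ i = 0) :
    (magnus (Ψ w)).deg₃ = (magnus w).deg₃ + MagnusGroup.derive (endoCoef Ψ) (magnus w).deg₂ := by
  rw [hΨ.magnus_apply]
  ext i j k
  simp [MagnusGroup.subst, hw]

theorem IsUnipotent.isAlt {Ψ : FreeGroup (Fin n) →* FreeGroup (Fin n)} (hΨ : IsUnipotent Ψ) :
    IsAlt (endoCoef Ψ) := by
  have key : ∀ i j k, endoCoef Ψ i j k + endoCoef Ψ i k j = 0 := fun i j k => by
    have := magnus_shuffle (Ψ (FreeGroup.of i)) j k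
    rw [hΨ i] at this
    simp only [Pi.single_apply, endoCoef] at this ⊢
    split_ifs at this with h1 h2 h3 h4 <;> subst_vars <;> simp_all
  exact ⟨fun i j => by have := key i j j; linarith, fun i j k => by have := key i j k; linarith⟩

theorem exists_deg₂ (b : Fin n → Fin n → ℤ) (h : ∀ i, b i i = 0) (h' : ∀ i j, b j i = -b i j) :
    ∃ w ∈ commutator (FreeGroup (Fin n)), (magnus w).deg₂ = b := by
  let A : AddSubgroup (Fin n → Fin n → ℤ) :=
    { carrier := {b | ∃ w ∈ commutator (FreeGroup (Fin n)), (magnus w).deg₂ = b}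
      zero_mem' := ⟨1, one_mem _, rfl⟩
      add_mem' := by
        rintro _ _ ⟨w, hw, rfl⟩ ⟨w', hw', rfl⟩
        exact ⟨w * w', mul_mem hw hw', by ext; simp [deg₁_of_mem_commutator hw]⟩
      neg_mem' := by
        rintro _ ⟨w, hw, rfl⟩
        exact ⟨w⁻¹, inv_mem hw, by ext; simp [deg₁_of_mem_commutator hw]⟩ }
  have e : b = ∑ i, ∑ j, if i < j then
      b i j • (magnus ⁅FreeGroup.of i, FreeGroup.of j⁆).deg₂ else 0 := by
    ext k l
    simp only [map_commutatorElement, Finset.sum_apply]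
    have : ∀ i j, (if i < j then b i j • (⁅magnus (FreeGroup.of i), magnus (FreeGroup.of j)⁆).deg₂
        else 0) k l = (if i = k ∧ j = l ∧ k < l then b k l else 0) +
          (if i = l ∧ j = k ∧ l < k then b k l else 0) := by
      intro i j
      by_cases hij : i < j
      · simp only [hij, if_true, Pi.smul_apply, MagnusGroup.commutator_deg₂, magnus_of_deg₁,
          Pi.single_apply, smul_eq_mul]
        by_cases h1 : k = i ∧ l = j
        · obtain ⟨rfl, rfl⟩ := h1
          simp [hij, hij.ne, hij.ne']
        · by_cases h2 : k = j ∧ l = i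
          · obtain ⟨rfl, rfl⟩ := h2
            simp [hij, hij.ne', h' l k]
          · have e1 : ¬(i = k ∧ j = l ∧ k < l) := fun h => h1 ⟨h.1.symm, h.2.1.symm⟩
            have e2 : ¬(i = l ∧ j = k ∧ l < k) := fun h => h2 ⟨h.2.1.symm, h.1.symm⟩
            simp only [e1, e2, if_false]
            rw [not_and_or] at h1 h2
            rcases h1 with h1 | h1 <;> rcases h2 with h2 | h2 <;> simp [h1, h2]
      · have e1 : ¬(i = k ∧ j = l ∧ k < l) := fun ⟨a, b, c⟩ => hij (a ▸ b ▸ c)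
        have e2 : ¬(i = l ∧ j = k ∧ l < k) := fun ⟨a, b, c⟩ => hij (a ▸ b ▸ c)
        simp [hij, e1, e2]
    simp only [this, Finset.sum_add_distrib]
    rcases lt_trichotomy k l with hkl | rfl | hkl
    · simp [hkl, hkl.not_gt, ite_and]
    · simp [h]
    · simp [hkl, hkl.not_gt, ite_and]
  rw [e]
  refine A.sum_mem fun i _ => A.sum_mem fun j _ => ?_
  split_ifs
  · exact A.zsmul_mem ⟨_, Subgroup.commutator_mem_commutator (Subgroup.mem_top _)
      (Subgroup.mem_top _), rfl⟩ _
  · exact A.zero_mem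

theorem IsAlt.exists_unipotent {C : Fin n → Fin n → Fin n → ℤ} (hC : IsAlt C) :
    ∃ Ψ : FreeGroup (Fin n) →* FreeGroup (Fin n), IsUnipotent Ψ ∧ endoCoef Ψ = C := by
  choose c hc e using fun i => exists_deg₂ (C i) (hC.self i) (hC.anti i)
  refine ⟨FreeGroup.lift fun i => FreeGroup.of i * c i, fun i => ?_, ?_⟩
  · ext j
    simp [deg₁_of_mem_commutator (hc i)]
  · ext i j k
    simp [endoCoef, deg₁_of_mem_commutator (hc i), e]

end Endo

section Iso

variable {n : ℕ} {G G' : Type*} [Group G] [Group G'] {ε : G → Fin n → ℤ} {x : Fin n → G}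
  {ε' : G' → Fin n → ℤ} {x' : Fin n → G'}

/-- The quotients by the `k`-th terms of the lower central series are isomorphic by an isomorphism
compatible with the markings. -/
def IsoMod (ε : G → Fin n → ℤ) (ε' : G' → Fin n → ℤ) (k : ℕ) : Prop :=
  ∃ F : (G ⧸ (⊤ : Subgroup G).lowerCentralSeries k) ≃*
      (G' ⧸ (⊤ : Subgroup G').lowerCentralSeries k),
    ∀ g g', F (QuotientGroup.mk g) = QuotientGroup.mk g' → ε g = ε' g'

theorem IsoMod.symm {k : ℕ} (h : IsoMod ε ε' k) : IsoMod ε' ε k := by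
  obtain ⟨F, hF⟩ := h
  refine ⟨F.symm, fun g g' e => (hF g' g ?_).symm⟩
  rw [← e, MulEquiv.apply_symm_apply]

theorem IsoMod.exists_unipotent (hx : IsMarked ε x) (hx' : IsMarked ε' x') {k : ℕ}
    (h : IsoMod ε ε' k) : ∃ Ψ : FreeGroup (Fin n) →* FreeGroup (Fin n), IsUnipotent Ψ ∧
      ∀ w ∈ relSub x k, Ψ w ∈ relSub x' k := by
  obtain ⟨F, hF⟩ := h
  choose v hv using fun i => hx'.mk_lift_surjective k (F (QuotientGroup.mk (x i)))
  have e : ((QuotientGroup.mk' ((⊤ : Subgroup G').lowerCentralSeries k)).comp (FreeGroup.lift x')).comp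
      (FreeGroup.lift v) = F.toMonoidHom.comp
        ((QuotientGroup.mk' ((⊤ : Subgroup G).lowerCentralSeries k)).comp (FreeGroup.lift x)) := by
    refine FreeGroup.ext_hom _ _ fun i => ?_
    simpa using hv i
  refine ⟨FreeGroup.lift v, fun i => ?_, fun w hw => ?_⟩
  · rw [FreeGroup.lift_apply_of, ← hx'.lift_eq, ← hF (x i) _ (hv i).symm, hx.basis]
  · rw [mem_relSub, ← QuotientGroup.eq_one_iff]
    have := DFunLike.congr_fun e w
    refine this.trans ?_
    have h1 : (QuotientGroup.mk (FreeGroup.lift x w) :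
      G ⧸ (⊤ : Subgroup G).lowerCentralSeries k) = 1 := (QuotientGroup.eq_one_iff _).mpr hw
    change F (QuotientGroup.mk (FreeGroup.lift x w)) = 1
    rw [h1, map_one]

theorem isoMod_of_unipotent (hx : IsMarked ε x) (hx' : IsMarked ε' x') {k : ℕ} (hk : 1 ≤ k)
    {Ψ : FreeGroup (Fin n) →* FreeGroup (Fin n)} (hΨ : IsUnipotent Ψ)
    (h : ∀ w, w ∈ relSub x k ↔ Ψ w ∈ relSub x' k) : IsoMod ε ε' k := by
  set p := (QuotientGroup.mk' ((⊤ : Subgroup G).lowerCentralSeries k)).comp (FreeGroup.lift x) with hp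
  set p' := (QuotientGroup.mk' ((⊤ : Subgroup G').lowerCentralSeries k)).comp (FreeGroup.lift x') with hp'
  have ker : ∀ w, p w = 1 ↔ p' (Ψ w) = 1 := fun w => by
    have h1 : p w = 1 ↔ w ∈ relSub x k := QuotientGroup.eq_one_iff _
    have h2 : p' (Ψ w) = 1 ↔ Ψ w ∈ relSub x' k := QuotientGroup.eq_one_iff _
    rw [h1, h2, h]
  have surj' : Function.Surjective (p'.comp Ψ) := by
    have hx'' : IsMarked ε' (fun i => FreeGroup.lift x' (Ψ (FreeGroup.of i))) :=
      ⟨hx'.mul, fun i => by rw [hx'.lift_eq, hΨ i], hx'.ker⟩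
    have e : (p'.comp Ψ) = (QuotientGroup.mk' ((⊤ : Subgroup G').lowerCentralSeries k)).comp
        (FreeGroup.lift fun i => FreeGroup.lift x' (Ψ (FreeGroup.of i))) :=
      FreeGroup.ext_hom _ _ fun i => by simp [hp']
    rw [e]
    exact hx''.mk_lift_surjective k
  have surj : Function.Surjective p := hx.mk_lift_surjective k
  let e1 := QuotientGroup.quotientKerEquivOfSurjective p surj
  let e2 := QuotientGroup.quotientKerEquivOfSurjective (p'.comp Ψ) surj'
  have hker : p.ker = (p'.comp Ψ).ker := by
    ext w
    exact ker w
  let F := e1.symm.trans ((QuotientGroup.quotientMulEquivOfEq hker).trans e2)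
  have hF : ∀ w, F (p w) = p' (Ψ w) := fun w => by
    have : e1.symm (p w) = QuotientGroup.mk w := by
      rw [MulEquiv.symm_apply_eq]; rfl
    simp only [F, MulEquiv.trans_apply, this]
    rfl
  refine ⟨F, fun g g' e => ?_⟩
  obtain ⟨w, hw⟩ := surj (QuotientGroup.mk g)
  rw [← hw, hF] at e
  have a1 := QuotientGroup.eq.mp hw
  have a2 := QuotientGroup.eq.mp e
  ext i
  have b1 := hx.lowerCentralSeries_eq_zero hk a1 i
  have b2 := hx'.lowerCentralSeries_eq_zero hk a2 i
  rw [hx.mul, hx.inv, hx.lift_eq] at b1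
  rw [hx'.mul, hx'.inv, hx'.lift_eq, hΨ.deg₁_apply] at b2
  linarith

theorem IsoMod.rel₂_eq (hx : IsMarked ε x) (hx' : IsMarked ε' x') {k : ℕ} (hk : 2 ≤ k) (hk' : k ≤ 3)
    (h : IsoMod ε ε' k) : hx.rel₂ = hx'.rel₂ := by
  refine le_antisymm ?_ ?_
  · rintro _ ⟨r, hr, rfl⟩
    obtain ⟨Ψ, hΨ, hN⟩ := h.exists_unipotent hx hx'
    rw [← hΨ.deg₂_apply (hx.deg₁_of_mem_relSub (by norm_num) hr)]
    exact hx'.deg₂_mem_rel₂ (relSub_antitone x' hk (hN _ (relSub_antitone x hk' hr)))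
  · rintro _ ⟨r, hr, rfl⟩
    obtain ⟨Ψ, hΨ, hN⟩ := h.symm.exists_unipotent hx' hx
    rw [← hΨ.deg₂_apply (hx'.deg₁_of_mem_relSub (by norm_num) hr)]
    exact hx.deg₂_mem_rel₂ (relSub_antitone x hk (hN _ (relSub_antitone x' hk' hr)))

theorem relSub_two_le (hx : IsMarked ε x) (hx' : IsMarked ε' x') (h : hx.rel₂ = hx'.rel₂)
    (w : FreeGroup (Fin n)) (hw : w ∈ relSub x 2) : w ∈ relSub x' 2 := by
  have h2 := hx.deg₂_mem_rel₂ hw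
  rw [h] at h2
  obtain ⟨r, hr, e⟩ := h2
  have hw1 := hx.deg₁_of_mem_relSub (by norm_num) hw
  have hr1 := hx'.deg₁_of_mem_relSub (by norm_num) hr
  rw [← inv_mul_cancel_right w r]
  refine mul_mem (lowerCentralSeries_le_relSub x' 2 (mem_gamma_three_of_deg₂ ?_ ?_))
    (relSub_antitone x' (by norm_num) hr)
  · simp [hw1, hr1]
  · simp [hw1, hr1, e]

/-- The isomorphism class of `G / γ₃ G` is determined by the relations of degree `2`. -/
theorem isoMod_two_iff (hx : IsMarked ε x) (hx' : IsMarked ε' x') :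
    IsoMod ε ε' 2 ↔ hx.rel₂ = hx'.rel₂ := by
  refine ⟨fun h => h.rel₂_eq hx hx' le_rfl (by norm_num), fun h => ?_⟩
  exact isoMod_of_unipotent hx hx' (by norm_num) (Ψ := MonoidHom.id _) (fun i => by simp)
    fun w => ⟨relSub_two_le hx hx' h w, relSub_two_le hx' hx h.symm w⟩

/-- Bracket-like forms vanishing on `[H, K]`. -/
structure IsMarked.KillsBrackets (hx : IsMarked ε x) (T : Fin n → Fin n → Fin n → ℤ) : Prop
    extends IsBracketLike T where
  rel : ∀ b ∈ hx.rel₂, ∀ i, ∑ j, ∑ k, (if j < k then T i j k * b j k else 0) = 0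

/-- A sum over all pairs of indices as a sum over increasing pairs, for an antisymmetric factor. -/
theorem sum_mul_antisymm (s b : Fin n → Fin n → ℤ) (hb : ∀ i j, b j i = -b i j) :
    ∑ j, ∑ k, s j k * b j k = ∑ j, ∑ k, if j < k then (s j k - s k j) * b j k else 0 := by
  have e1 : ∑ j, ∑ k, s j k * b j k = ∑ j, ∑ k, (if j < k then s j k * b j k else 0) +
      ∑ j, ∑ k, (if k < j then s j k * b j k else 0) := by
    simp only [← Finset.sum_add_distrib]
    refine Finset.sum_congr rfl fun j _ => Finset.sum_congr rfl fun k _ => ?_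
    rcases lt_trichotomy j k with h | rfl | h
    · simp [h, h.not_gt]
    · have : b j j = 0 := by have := hb j j; linarith
      simp [this]
    · simp [h, h.not_gt]
  rw [e1, Finset.sum_comm (f := fun j k => if k < j then s j k * b j k else 0)]
  simp only [← Finset.sum_add_distrib]
  refine Finset.sum_congr rfl fun j _ => Finset.sum_congr rfl fun k _ => ?_
  split_ifs
  · rw [hb j k]; ring
  · rfl

theorem IsMarked.KillsBrackets.kills {hx : IsMarked ε x} {T : Fin n → Fin n → Fin n → ℤ}
    (hT : hx.KillsBrackets T) : hx.Kills (symLift T) := by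
  refine ⟨fun b hb k => ?_, fun b hb i => ?_⟩
  · rw [sum_mul_antisymm _ _ (hx.rel₂_antisymm hb)]
    refine Finset.sum_eq_zero fun i _ => Finset.sum_eq_zero fun j _ => ?_
    rw [symLift_symm T j i k]
    simp
  · rw [sum_mul_antisymm _ _ (hx.rel₂_antisymm hb)]
    simp only [hT.symLift_sub]
    exact hT.rel b hb i

/-- The coefficients of degree `3` of a relation are determined by those of degree `2`, up to
elements of `K ⊗ H + H ⊗ K`. -/
def IsMarked.Determined (hx : IsMarked ε x) : Prop :=
  ∀ r ∈ relSub x 3, ∀ r' ∈ relSub x 3, (magnus r).deg₂ = (magnus r').deg₂ →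
    ∀ S, hx.Kills S → pair₃ S (magnus r).deg₃ = pair₃ S (magnus r').deg₃

/-- Lie elements of degree `3` are in `K ⊗ H + H ⊗ K` if they are killed by all forms
vanishing on `[H, K]`. -/
def IsMarked.Separated (hx : IsMarked ε x) : Prop :=
  ∀ y ∈ (⊤ : Subgroup (FreeGroup (Fin n))).lowerCentralSeries 2,
    (∀ T, hx.KillsBrackets T → pair₃ (symLift T) (magnus y).deg₃ = 0) →
    (magnus y).deg₃ ∈ tensorSpan hx.rel₂

theorem IsMarked.Separated.mem_relSub {hx : IsMarked ε x} (hs : hx.Separated)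
    {w r : FreeGroup (Fin n)} (hr : r ∈ relSub x 3) (h₁ : ∀ i, (magnus w).deg₁ i = 0)
    (h₂ : (magnus w).deg₂ = (magnus r).deg₂)
    (h₃ : ∀ T, hx.KillsBrackets T → pair₃ (symLift T) (magnus w).deg₃ =
      pair₃ (symLift T) (magnus r).deg₃) : w ∈ relSub x 3 := by
  have hr1 := hx.deg₁_of_mem_relSub (by norm_num) hr
  have hy : w * r⁻¹ ∈ (⊤ : Subgroup (FreeGroup (Fin n))).lowerCentralSeries 2 :=
    mem_gamma_three_of_deg₂ (by simp [h₁, hr1]) (by simp [h₁, hr1, h₂])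
  have e : (magnus (w * r⁻¹)).deg₃ = (magnus w).deg₃ - (magnus r).deg₃ := by
    ext i j k
    simp [h₁, hr1, sub_eq_add_neg]
  rw [← inv_mul_cancel_right w r]
  refine mul_mem (hx.mem_relSub_of_mem_tensorSpan hy (hs _ hy fun T hT => ?_)) hr
  rw [e, pair₃_sub, h₃ T hT, sub_self]

/-- Classification of the quotients `G / γ₄ G`. -/
theorem isoMod_three_iff (hx : IsMarked ε x) (hx' : IsMarked ε' x')
    (hd' : hx'.Determined) (hs : hx.Separated) (hs' : hx'.Separated) :
    IsoMod ε ε' 3 ↔ hx.rel₂ = hx'.rel₂ ∧ ∃ C, IsAlt C ∧ ∀ T, hx'.KillsBrackets T →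
      ∀ r ∈ relSub x 3, ∀ r' ∈ relSub x' 3, (magnus r).deg₂ = (magnus r').deg₂ →
        pair₃ (symLift T) (magnus r').deg₃ = pair₃ (symLift T) (magnus r).deg₃ +
          pair₃ (symLift T) (MagnusGroup.derive C (magnus r).deg₂) := by
  constructor
  · intro h
    refine ⟨h.rel₂_eq hx hx' (by norm_num) le_rfl, ?_⟩
    obtain ⟨Ψ, hΨ, hN⟩ := h.exists_unipotent hx hx'
    refine ⟨endoCoef Ψ, hΨ.isAlt, fun T hT r hr r' hr' e => ?_⟩
    have hr1 := hx.deg₁_of_mem_relSub (by norm_num) hr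
    rw [← pair₃_add, ← hΨ.deg₃_apply hr1]
    refine hd' _ hr' _ (hN _ hr) ?_ _ hT.kills
    rw [hΨ.deg₂_apply hr1, e]
  · rintro ⟨hK, C, hC, H⟩
    obtain ⟨Ψ, hΨ, rfl⟩ := hC.exists_unipotent
    have kb : ∀ T, hx.KillsBrackets T → hx'.KillsBrackets T := fun T hT =>
      ⟨hT.toIsBracketLike, hK ▸ hT.rel⟩
    have forward : ∀ w ∈ relSub x 3, Ψ w ∈ relSub x' 3 := by
      intro w hw
      have hw1 := hx.deg₁_of_mem_relSub (by norm_num) hw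
      obtain ⟨r', hr', e⟩ : (magnus w).deg₂ ∈ hx'.rel₂ := hK ▸ ⟨w, hw, rfl⟩
      refine hs'.mem_relSub hr' (by rw [hΨ.deg₁_apply]; exact hw1) (by rw [hΨ.deg₂_apply hw1, e])
        fun T hT => ?_
      rw [H T hT w hw r' hr' e.symm, hΨ.deg₃_apply hw1, pair₃_add]
    refine isoMod_of_unipotent hx hx' (by norm_num) hΨ fun w => ⟨forward w, fun hw => ?_⟩
    have hw1 := hx'.deg₁_of_mem_relSub (by norm_num) hw
    rw [hΨ.deg₁_apply] at hw1
    obtain ⟨r, hr, e⟩ : (magnus (Ψ w)).deg₂ ∈ hx.rel₂ := hK ▸ ⟨_, hw, rfl⟩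
    rw [hΨ.deg₂_apply hw1] at e
    have hr1 := hx.deg₁_of_mem_relSub (by norm_num) hr
    refine hs.mem_relSub hr hw1 e.symm fun T hT => ?_
    have := hd' _ hw _ (forward r hr) (by rw [hΨ.deg₂_apply hw1, hΨ.deg₂_apply hr1, e]) _
      (kb T hT).kills
    rw [hΨ.deg₃_apply hw1, hΨ.deg₃_apply hr1, pair₃_add, pair₃_add, e] at this
    linarith

end Iso

/-! ### Singular simplices in low dimensions and homotopy classes of paths -/

section Paths

variable {U : Type u} [TopologicalSpace U]

/-- A singular 1-simplex as a path. -/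
def edgePath (a : Simplex U 1) : Path (a (stdSimplex.vertex 0)) (a (stdSimplex.vertex 1)) where
  toFun t := a (stdSimplexHomeomorphUnitInterval.symm t)
  continuous_toFun := a.continuous.comp stdSimplexHomeomorphUnitInterval.symm.continuous
  source' := congrArg a (by
    rw [Homeomorph.symm_apply_eq]; exact stdSimplexHomeomorphUnitInterval_zero.symm)
  target' := congrArg a (by
    rw [Homeomorph.symm_apply_eq]; exact stdSimplexHomeomorphUnitInterval_one.symm)

theorem edgePath_pathSimplex_apply {x y : U} (γ : Path x y) (t : unitInterval) :
    edgePath (pathSimplex γ) t = γ t :=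
  congrArg γ (stdSimplexHomeomorphUnitInterval.apply_symm_apply t)

theorem pathSimplex_edgePath (a : Simplex U 1) : pathSimplex (edgePath a) = a := by
  ext s
  exact congrArg a (stdSimplexHomeomorphUnitInterval.symm_apply_apply s)

theorem map_succAbove_apply {n : ℕ} (i : Fin (n + 2)) (y : stdSimplex ℝ (Fin (n + 1)))
    (j : Fin (n + 1)) : stdSimplex.map i.succAbove y (i.succAbove j) = y j := by
  change (stdSimplex.map i.succAbove y : Fin (n + 2) → ℝ) _ = _
  rw [stdSimplex.map_coe, FunOnFinite.linearMap_apply_apply]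
  have : (Finset.univ.filter fun k => i.succAbove k = i.succAbove j) = {j} := by
    ext k; simp
  rw [this, Finset.sum_singleton]

theorem map_succAbove_self {n : ℕ} (i : Fin (n + 2)) (y : stdSimplex ℝ (Fin (n + 1))) :
    stdSimplex.map i.succAbove y i = 0 := by
  change (stdSimplex.map i.succAbove y : Fin (n + 2) → ℝ) _ = _
  rw [stdSimplex.map_coe, FunOnFinite.linearMap_apply_apply]
  have : (Finset.univ.filter fun k => i.succAbove k = i) = ∅ := by
    ext k; simp [Fin.succAbove_ne]
  rw [this, Finset.sum_empty]

section Holonomy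

variable {w : U} (τ : ∀ x, Path w x)

/-- The inverse of the class of the loop obtained by closing up a path along `τ`. (The product of
the fundamental group composes loops from right to left.) -/
def holonomy {x y : U} (γ : Path x y) : FundamentalGroup U w :=
  (FundamentalGroup.fromPath
    (Path.Homotopic.Quotient.mk (((τ x).trans γ).trans (τ y).symm)))⁻¹

theorem holonomy_congr {x y x' y' : U} {γ : Path x y} {γ' : Path x' y'} (h : ∀ t, γ t = γ' t) :
    holonomy τ γ = holonomy τ γ' := by
  obtain rfl : x = x' := by have := h 0; simpa using this
  obtain rfl : y = y' := by have := h 1; simpa using this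
  obtain rfl : γ = γ' := Path.ext (funext h)
  rfl

theorem holonomy_homotopic {x y : U} {γ γ' : Path x y} (h : γ.Homotopic γ') :
    holonomy τ γ = holonomy τ γ' := by
  unfold holonomy
  congr 2
  rw [Path.Homotopic.Quotient.eq]
  exact ((Path.Homotopic.refl _).hcomp h).hcomp (Path.Homotopic.refl _)

open CategoryTheory in
theorem holonomy_trans {x y z : U} (γ : Path x y) (δ : Path y z) :
    holonomy τ (γ.trans δ) = holonomy τ γ * holonomy τ δ := by
  rw [holonomy, holonomy, holonomy, ← mul_inv_rev]
  congr 1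
  let m {a b : U} (p : Path a b) : FundamentalGroupoid.mk a ⟶ FundamentalGroupoid.mk b :=
    Path.Homotopic.Quotient.mk p
  have ht {a b c : U} (p : Path a b) (q : Path b c) : m (p.trans q) = m p ≫ m q := rfl
  have hs {a b : U} (p : Path a b) : m p.symm = Groupoid.inv (m p) := rfl
  change m _ = m _ ≫ m _
  simp only [ht, hs, Category.assoc]
  simp

theorem holonomy_loop (h : τ w = Path.refl w) (γ : Path w w) :
    holonomy τ γ = (FundamentalGroup.fromPath (Path.Homotopic.Quotient.mk γ))⁻¹ := by
  rw [holonomy, h]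
  congr 2
  rw [Path.refl_symm, Path.Homotopic.Quotient.eq]
  exact Path.Homotopic.trans ⟨Path.Homotopy.transRefl _⟩ ⟨Path.Homotopy.reflTrans _⟩

/-- The holonomy of a singular 1-simplex. -/
def edgeClass (a : Simplex U 1) : FundamentalGroup U w := holonomy τ (edgePath a)

theorem edgeClass_pathSimplex {x y : U} (γ : Path x y) :
    edgeClass τ (pathSimplex γ) = holonomy τ γ :=
  holonomy_congr τ (edgePath_pathSimplex_apply γ)

theorem edgeClass_refl (x : U) : edgeClass τ (pathSimplex (Path.refl x)) = 1 := by
  rw [edgeClass_pathSimplex]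
  have h := holonomy_trans τ (Path.refl x) (Path.refl x)
  rw [Path.refl_trans_refl] at h
  exact (mul_eq_left.mp h.symm)

/-- The edges of the standard 2-simplex. -/
def stdEdge (i : Fin 3) {a b : Fin 3} (ha : i.succAbove (0 : Fin 2) = a)
    (hb : i.succAbove (1 : Fin 2) = b) :
    Path (stdSimplex.vertex (S := ℝ) a) (stdSimplex.vertex (S := ℝ) b) where
  toFun t := stdSimplex.map i.succAbove (stdSimplexHomeomorphUnitInterval.symm t)
  continuous_toFun :=
    (stdSimplex.continuous_map _).comp stdSimplexHomeomorphUnitInterval.symm.continuous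
  source' := by
    rw [← ha, ← stdSimplex.map_vertex]
    congr 1
    rw [Homeomorph.symm_apply_eq]; exact stdSimplexHomeomorphUnitInterval_zero.symm
  target' := by
    rw [← hb, ← stdSimplex.map_vertex]
    congr 1
    rw [Homeomorph.symm_apply_eq]; exact stdSimplexHomeomorphUnitInterval_one.symm

theorem edgeClass_face (σ : Simplex U 2) :
    edgeClass τ (face 1 σ) = edgeClass τ (face 2 σ) * edgeClass τ (face 0 σ) := by
  have : ContractibleSpace (stdSimplex ℝ (Fin 3)) :=
    (convex_stdSimplex ℝ (Fin 3)).contractibleSpace ⟨_, single_mem_stdSimplex ℝ 0⟩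
  let e₀ : Path (stdSimplex.vertex (S := ℝ) (1 : Fin 3)) (stdSimplex.vertex 2) :=
    stdEdge 0 (by decide) (by decide)
  let e₁ : Path (stdSimplex.vertex (S := ℝ) (0 : Fin 3)) (stdSimplex.vertex 2) :=
    stdEdge 1 (by decide) (by decide)
  let e₂ : Path (stdSimplex.vertex (S := ℝ) (0 : Fin 3)) (stdSimplex.vertex 1) :=
    stdEdge 2 (by decide) (by decide)
  have hp : e₁.Homotopic (e₂.trans e₀) := SimplyConnectedSpace.paths_homotopic _ _
  have h0 : edgeClass τ (face 0 σ) = holonomy τ (e₀.map σ.continuous) :=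
    holonomy_congr τ fun t => rfl
  have h1 : edgeClass τ (face 1 σ) = holonomy τ (e₁.map σ.continuous) :=
    holonomy_congr τ fun t => rfl
  have h2 : edgeClass τ (face 2 σ) = holonomy τ (e₂.map σ.continuous) :=
    holonomy_congr τ fun t => rfl
  rw [h0, h1, h2, holonomy_homotopic τ (hp.map σ), Path.map_trans, holonomy_trans]

end Holonomy

/-! #### Explicit 2-simplices -/

/-- The 2-simplex spanned by two composable paths. -/
def concatSimplex {x y z : U} (γ : Path x y) (δ : Path y z) : Simplex U 2 where
  toFun s := (γ.trans δ).extend (s 2 + s 1 / 2)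
  continuous_toFun := by
    refine (γ.trans δ).continuous_extend.comp ?_
    have h : ∀ i : Fin 3, Continuous fun s : stdSimplex ℝ (Fin 3) => s i :=
      fun i => (continuous_apply i).comp continuous_subtype_val
    exact (h 2).add ((h 1).div_const 2)

theorem map_succAbove_coords (y : stdSimplex ℝ (Fin 2)) :
    ((stdSimplex.map (Fin.succAbove (0 : Fin 3)) y) 0 = 0 ∧
      (stdSimplex.map (Fin.succAbove (0 : Fin 3)) y) 1 = y 0 ∧
      (stdSimplex.map (Fin.succAbove (0 : Fin 3)) y) 2 = y 1) ∧
    ((stdSimplex.map (Fin.succAbove (1 : Fin 3)) y) 0 = y 0 ∧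
      (stdSimplex.map (Fin.succAbove (1 : Fin 3)) y) 1 = 0 ∧
      (stdSimplex.map (Fin.succAbove (1 : Fin 3)) y) 2 = y 1) ∧
    ((stdSimplex.map (Fin.succAbove (2 : Fin 3)) y) 0 = y 0 ∧
      (stdSimplex.map (Fin.succAbove (2 : Fin 3)) y) 1 = y 1 ∧
      (stdSimplex.map (Fin.succAbove (2 : Fin 3)) y) 2 = 0) :=
  ⟨⟨map_succAbove_self 0 y, map_succAbove_apply (0 : Fin 3) y 0,
    map_succAbove_apply (0 : Fin 3) y 1⟩,
   ⟨map_succAbove_apply (1 : Fin 3) y 0, map_succAbove_self 1 y,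
    map_succAbove_apply (1 : Fin 3) y 1⟩,
   ⟨map_succAbove_apply (2 : Fin 3) y 0, map_succAbove_apply (2 : Fin 3) y 1,
    map_succAbove_self 2 y⟩⟩

theorem unitInterval_coe (y : stdSimplex ℝ (Fin 2)) :
    ((stdSimplexHomeomorphUnitInterval y : unitInterval) : ℝ) = y 1 := rfl

theorem face_concatSimplex {x y z : U} (γ : Path x y) (δ : Path y z) :
    face 2 (concatSimplex γ δ) = pathSimplex γ ∧ face 0 (concatSimplex γ δ) = pathSimplex δ ∧
      face 1 (concatSimplex γ δ) = pathSimplex (γ.trans δ) := by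
  refine ⟨?_, ?_, ?_⟩ <;> ext s
  · obtain ⟨-, -, -, h1, h2⟩ := map_succAbove_coords s
    have hs := s.2.1 1
    have hs' := stdSimplex.le_one s 1
    change (γ.trans δ).extend ((stdSimplex.map (Fin.succAbove (2 : Fin 3)) s) 2 +
      (stdSimplex.map (Fin.succAbove (2 : Fin 3)) s) 1 / 2) = γ (stdSimplexHomeomorphUnitInterval s)
    rw [h1, h2, Path.extend_apply _ ⟨by linarith [stdSimplex.zero_le s 1], by linarith⟩, Path.trans_apply, dif_pos (by simp; linarith)]
    congr 1
    apply Subtype.ext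
    simp only [unitInterval_coe]
    ring
  · obtain ⟨⟨-, h1, h2⟩, -, -⟩ := map_succAbove_coords s
    have h0 := stdSimplex.zero_le s 0
    have h3 := stdSimplex.zero_le s 1
    have h4 : s 0 + s 1 = 1 := stdSimplex.add_eq_one s
    change (γ.trans δ).extend ((stdSimplex.map (Fin.succAbove (0 : Fin 3)) s) 2 +
      (stdSimplex.map (Fin.succAbove (0 : Fin 3)) s) 1 / 2) = δ (stdSimplexHomeomorphUnitInterval s)
    rw [h1, h2, Path.extend_apply _ ⟨by linarith, by linarith⟩]
    by_cases h5 : s 1 = 0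
    · rw [Path.trans_apply, dif_pos (by simp; linarith)]
      have e1 : stdSimplexHomeomorphUnitInterval s = 0 := Subtype.ext h5
      rw [e1, Path.source]
      have e2 : s 0 = 1 := by linarith
      convert γ.target
      simp [h5, e2]
    · rw [Path.trans_apply, dif_neg (by
        have : 0 < s 1 := lt_of_le_of_ne h3 (Ne.symm h5)
        simp; linarith)]
      congr 1
      apply Subtype.ext
      simp only [unitInterval_coe]
      linarith
  · obtain ⟨-, ⟨-, h1, h2⟩, -⟩ := map_succAbove_coords s
    change (γ.trans δ).extend ((stdSimplex.map (Fin.succAbove (1 : Fin 3)) s) 2 +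
      (stdSimplex.map (Fin.succAbove (1 : Fin 3)) s) 1 / 2) = (γ.trans δ) (stdSimplexHomeomorphUnitInterval s)
    rw [h1, h2, zero_div, add_zero]
    exact Path.extend_extends' _ (stdSimplexHomeomorphUnitInterval s)

/-- The two triangles of the square of a homotopy. -/
def homotopySimplex {x y : U} {γ δ : Path x y} (H : γ.Homotopy δ) (b : Bool) : Simplex U 2 where
  toFun s := H (Set.projIcc 0 1 zero_le_one (if b then s 1 + s 2 else s 2),
    Set.projIcc 0 1 zero_le_one (if b then s 2 else s 1 + s 2))
  continuous_toFun := by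
    have h : ∀ i : Fin 3, Continuous fun s : stdSimplex ℝ (Fin 3) => s i :=
      fun i => (continuous_apply i).comp continuous_subtype_val
    refine H.continuous.comp (Continuous.prodMk (continuous_projIcc.comp ?_)
      (continuous_projIcc.comp ?_)) <;> cases b
    · exact h 2
    · exact (h 1).add (h 2)
    · exact (h 1).add (h 2)
    · exact h 2

theorem face_homotopySimplex {x y : U} {γ δ : Path x y} (H : γ.Homotopy δ) :
    face 2 (homotopySimplex H false) = pathSimplex γ ∧
      face 0 (homotopySimplex H false) = pathSimplex (Path.refl y) ∧
      face 2 (homotopySimplex H true) = pathSimplex (Path.refl x) ∧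
      face 0 (homotopySimplex H true) = pathSimplex δ ∧
      face 1 (homotopySimplex H false) = face 1 (homotopySimplex H true) := by
  have hp : ∀ s : stdSimplex ℝ (Fin 2), Set.projIcc (0 : ℝ) 1 zero_le_one (s 1) =
      stdSimplexHomeomorphUnitInterval s := fun s =>
    Set.projIcc_of_mem zero_le_one (stdSimplexHomeomorphUnitInterval s).2
  have h01 : Set.projIcc (0 : ℝ) 1 zero_le_one 0 = 0 := Set.projIcc_left _
  have h11 : Set.projIcc (0 : ℝ) 1 zero_le_one 1 = 1 := Set.projIcc_right _
  refine ⟨?_, ?_, ?_, ?_, ?_⟩ <;> ext s <;>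
    obtain ⟨⟨-, h1, h2⟩, ⟨-, h3, h4⟩, ⟨-, h5, h6⟩⟩ := map_succAbove_coords s
  · change H (Set.projIcc 0 1 zero_le_one ((stdSimplex.map (Fin.succAbove (2 : Fin 3)) s) 2),
      Set.projIcc 0 1 zero_le_one ((stdSimplex.map (Fin.succAbove (2 : Fin 3)) s) 1 + (stdSimplex.map (Fin.succAbove (2 : Fin 3)) s) 2)) = γ (stdSimplexHomeomorphUnitInterval s)
    rw [h5, h6, add_zero, h01, hp]
    exact H.apply_zero _
  · change H (Set.projIcc 0 1 zero_le_one ((stdSimplex.map (Fin.succAbove (0 : Fin 3)) s) 2),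
      Set.projIcc 0 1 zero_le_one ((stdSimplex.map (Fin.succAbove (0 : Fin 3)) s) 1 + (stdSimplex.map (Fin.succAbove (0 : Fin 3)) s) 2)) = y
    rw [h1, h2, stdSimplex.add_eq_one, h11]
    exact H.target _
  · change H (Set.projIcc 0 1 zero_le_one ((stdSimplex.map (Fin.succAbove (2 : Fin 3)) s) 1 + (stdSimplex.map (Fin.succAbove (2 : Fin 3)) s) 2),
      Set.projIcc 0 1 zero_le_one ((stdSimplex.map (Fin.succAbove (2 : Fin 3)) s) 2)) = x
    rw [h6, h01]
    exact H.source _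
  · change H (Set.projIcc 0 1 zero_le_one ((stdSimplex.map (Fin.succAbove (0 : Fin 3)) s) 1 + (stdSimplex.map (Fin.succAbove (0 : Fin 3)) s) 2),
      Set.projIcc 0 1 zero_le_one ((stdSimplex.map (Fin.succAbove (0 : Fin 3)) s) 2)) = δ (stdSimplexHomeomorphUnitInterval s)
    rw [h1, h2, stdSimplex.add_eq_one, h11, hp]
    exact H.apply_one _
  · change H (Set.projIcc 0 1 zero_le_one ((stdSimplex.map (Fin.succAbove (1 : Fin 3)) s) 2),
      Set.projIcc 0 1 zero_le_one ((stdSimplex.map (Fin.succAbove (1 : Fin 3)) s) 1 + (stdSimplex.map (Fin.succAbove (1 : Fin 3)) s) 2)) =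
      H (Set.projIcc 0 1 zero_le_one ((stdSimplex.map (Fin.succAbove (1 : Fin 3)) s) 1 + (stdSimplex.map (Fin.succAbove (1 : Fin 3)) s) 2),
      Set.projIcc 0 1 zero_le_one ((stdSimplex.map (Fin.succAbove (1 : Fin 3)) s) 2))
    rw [h3, h4, zero_add]

end Paths

/-! ### Singular chains and the bar complex of the fundamental group -/

section Bar

variable {U : Type u} [TopologicalSpace U] {w : U}

/-- Singular 2-chains mapped to the bar complex of the fundamental group. -/
def singToBar (τ : ∀ x, Path w x) :
    Chain U 2 →ₗ[ℤ] (FundamentalGroup U w × FundamentalGroup U w →₀ ℤ) :=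
  Finsupp.lmapDomain ℤ ℤ fun σ => (edgeClass τ (face 2 σ), edgeClass τ (face 0 σ))

theorem singToBar_chainOf (τ : ∀ x, Path w x) (σ : Simplex U 2) :
    singToBar τ (chainOf σ) = Finsupp.single (edgeClass τ (face 2 σ), edgeClass τ (face 0 σ)) 1 := by
  simp [singToBar, Finsupp.mapDomain_single]

theorem barBdry_singToBar (τ : ∀ x, Path w x) (c : Chain U 2) :
    barBdry _ (singToBar τ c) = Finsupp.lmapDomain ℤ ℤ (edgeClass τ) (bdry U 1 c) := by
  suffices H : barBdry _ ∘ₗ singToBar τ = Finsupp.lmapDomain ℤ ℤ (edgeClass τ) ∘ₗ bdry U 1 from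
    LinearMap.congr_fun H c
  refine Finsupp.lhom_ext' fun σ => LinearMap.ext_ring ?_
  change barBdry _ (singToBar τ (chainOf σ)) =
    Finsupp.lmapDomain ℤ ℤ (edgeClass τ) (bdry U 1 (chainOf σ))
  rw [singToBar_chainOf, barBdry_single, bdry_one_chainOf]
  simp only [map_add, map_sub, Finsupp.lmapDomain_apply, Finsupp.mapDomain_single,
    edgeClass_face τ σ]
  abel

theorem barEval_singToBar (τ : ∀ x, Path w x)
    (F : FundamentalGroup U w → FundamentalGroup U w → ℤ) (c : Chain U 2) :
    barEval F (singToBar τ c) =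
      cochainOf (fun σ : Simplex U 2 => F (edgeClass τ (face 2 σ)) (edgeClass τ (face 0 σ))) c := by
  suffices H : barEval F ∘ₗ singToBar τ = cochainOf (fun σ : Simplex U 2 =>
      F (edgeClass τ (face 2 σ)) (edgeClass τ (face 0 σ))) from LinearMap.congr_fun H c
  refine cochain_ext fun σ => ?_
  rw [LinearMap.comp_apply, singToBar_chainOf, barEval_single, cochainOf_chainOf]

theorem bdry_concatSimplex {x y z : U} (γ : Path x y) (δ : Path y z) :
    bdry U 1 (chainOf (concatSimplex γ δ)) = chainOf (pathSimplex δ) -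
      chainOf (pathSimplex (γ.trans δ)) + chainOf (pathSimplex γ) := by
  obtain ⟨h2, h0, h1⟩ := face_concatSimplex γ δ
  rw [bdry_one_chainOf, h0, h1, h2]

/-- The difference of the two triangles of a homotopy of loops. -/
theorem exists_bdry_of_homotopic (τ : ∀ x, Path w x) {x : U} {γ δ : Path x x}
    (h : γ.Homotopic δ) :
    ∃ c : Chain U 2, bdry U 1 c = chainOf (pathSimplex γ) - chainOf (pathSimplex δ) ∧
      ∀ F : FundamentalGroup U w → FundamentalGroup U w → ℤ, (∀ g, F g 1 = 0) → (∀ g, F 1 g = 0) →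
        barEval F (singToBar τ c) = 0 := by
  obtain ⟨H⟩ := h
  obtain ⟨h1, h2, h3, h4, h5⟩ := face_homotopySimplex H
  refine ⟨chainOf (homotopySimplex H false) - chainOf (homotopySimplex H true), ?_, ?_⟩
  · rw [map_sub, bdry_one_chainOf, bdry_one_chainOf, h1, h2, h3, h4, h5]
    abel
  · intro F hF hF'
    rw [map_sub, map_sub, singToBar_chainOf, singToBar_chainOf, barEval_single, barEval_single,
      h1, h2, h3, h4, edgeClass_refl, hF, hF', sub_zero]

theorem chainOf_refl_mem_range (x : U) :
    chainOf (pathSimplex (Path.refl x)) ∈ LinearMap.range (bdry U 1) := by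
  refine ⟨chainOf (concatSimplex (Path.refl x) (Path.refl x)), ?_⟩
  rw [bdry_concatSimplex, Path.refl_trans_refl, sub_self, zero_add]

/-- A loop representing the inverse of an element of the fundamental group. -/
def repLoop (g : FundamentalGroup U w) : Path w w :=
  (Path.Homotopic.Quotient.mk_surjective (FundamentalGroup.toPath g⁻¹)).choose

theorem mk_repLoop (g : FundamentalGroup U w) :
    FundamentalGroup.fromPath (Path.Homotopic.Quotient.mk (repLoop g)) = g⁻¹ :=
  (Path.Homotopic.Quotient.mk_surjective (FundamentalGroup.toPath g⁻¹)).choose_spec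

theorem homotopic_of_fromPath {γ δ : Path w w}
    (h : FundamentalGroup.fromPath (Path.Homotopic.Quotient.mk γ) =
      FundamentalGroup.fromPath (Path.Homotopic.Quotient.mk δ)) : γ.Homotopic δ :=
  Path.Homotopic.Quotient.exact h

theorem holonomy_repLoop {τ : ∀ x, Path w x} (hτ : τ w = Path.refl w) (g : FundamentalGroup U w) :
    holonomy τ (repLoop g) = g := by
  rw [holonomy_loop τ hτ, mk_repLoop, inv_inv]

theorem homotopic_of_holonomy {τ : ∀ x, Path w x} (hτ : τ w = Path.refl w) {γ δ : Path w w}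
    (h : holonomy τ γ = holonomy τ δ) : γ.Homotopic δ := by
  rw [holonomy_loop τ hτ, holonomy_loop τ hτ, inv_inj] at h
  exact homotopic_of_fromPath h

theorem exists_chain_of_pair {τ : ∀ x, Path w x} (hτ : τ w = Path.refl w)
    (g h : FundamentalGroup U w) :
    ∃ c : Chain U 2, bdry U 1 c = chainOf (pathSimplex (repLoop g)) +
        chainOf (pathSimplex (repLoop h)) - chainOf (pathSimplex (repLoop (g * h))) ∧
      ∀ F : FundamentalGroup U w → FundamentalGroup U w → ℤ, (∀ g, F g 1 = 0) → (∀ g, F 1 g = 0) →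
        barEval F (singToBar τ c) = F g h := by
  have hh : ((repLoop g).trans (repLoop h)).Homotopic (repLoop (g * h)) :=
    homotopic_of_holonomy hτ (by
      rw [holonomy_trans, holonomy_repLoop hτ, holonomy_repLoop hτ, holonomy_repLoop hτ])
  obtain ⟨c, hc, hF⟩ := exists_bdry_of_homotopic τ hh
  refine ⟨chainOf (concatSimplex (repLoop g) (repLoop h)) + c, ?_, fun F h1 h2 => ?_⟩
  · rw [map_add, bdry_concatSimplex, hc]
    abel
  · obtain ⟨e2, e0, -⟩ := face_concatSimplex (repLoop g) (repLoop h)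
    rw [map_add, map_add, hF F h1 h2, singToBar_chainOf, barEval_single, e2, e0,
      edgeClass_pathSimplex, edgeClass_pathSimplex, holonomy_repLoop hτ, holonomy_repLoop hτ,
      add_zero]

/-- A bar cycle comes from a singular cycle, up to normalized cochains. -/
theorem exists_cycle_of_barCycle {τ : ∀ x, Path w x} (hτ : τ w = Path.refl w)
    {c : FundamentalGroup U w × FundamentalGroup U w →₀ ℤ} (hc : barBdry _ c = 0) :
    ∃ z : Cycles U 1, ∀ F : FundamentalGroup U w → FundamentalGroup U w → ℤ,
      (∀ g, F g 1 = 0) → (∀ g, F 1 g = 0) → barEval F (singToBar τ z.1) = barEval F c := by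
  choose C hC hF using fun p : FundamentalGroup U w × FundamentalGroup U w =>
    exists_chain_of_pair hτ p.1 p.2
  let B := Finsupp.linearCombination ℤ C
  have hB : ∀ c, bdry U 1 (B c) = Finsupp.linearCombination ℤ
      (fun g : FundamentalGroup U w => chainOf (pathSimplex (repLoop g))) (barBdry _ c) := by
    intro c
    suffices H : bdry U 1 ∘ₗ B = Finsupp.linearCombination ℤ
      (fun g : FundamentalGroup U w => chainOf (pathSimplex (repLoop g))) ∘ₗ barBdry _ from
      LinearMap.congr_fun H c
    refine Finsupp.lhom_ext' fun p => LinearMap.ext_ring ?_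
    change bdry U 1 (B (Finsupp.single p 1)) =
      Finsupp.linearCombination ℤ _ (barBdry _ (Finsupp.single (p.1, p.2) 1))
    rw [barBdry_single, Finsupp.linearCombination_single, one_smul, hC]
    simp only [map_add, map_sub, Finsupp.linearCombination_single, one_smul]
  refine ⟨⟨B c, by rw [LinearMap.mem_ker, hB, hc, map_zero]⟩, fun F h1 h2 => ?_⟩
  suffices H : barEval F ∘ₗ singToBar τ ∘ₗ B = barEval F from LinearMap.congr_fun H c
  refine Finsupp.lhom_ext' fun p => LinearMap.ext_ring ?_
  change barEval F (singToBar τ (B (Finsupp.single p 1))) = barEval F (Finsupp.single (p.1, p.2) 1)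
  rw [Finsupp.linearCombination_single, one_smul, hF p F h1 h2, barEval_single]

/-! #### The Hurewicz homomorphism -/

theorem loopClass_eq_iff {x y : U} (γ : Path x x) (δ : Path y y) :
    loopClass γ = loopClass δ ↔
      chainOf (pathSimplex γ) - chainOf (pathSimplex δ) ∈ LinearMap.range (bdry U 1) :=
  Submodule.Quotient.eq _

theorem loopClass_trans {x : U} (γ δ : Path x x) :
    loopClass (γ.trans δ) = loopClass γ + loopClass δ := by
  refine (Submodule.Quotient.eq _).mpr ⟨-chainOf (concatSimplex γ δ), ?_⟩
  rw [map_neg, bdry_concatSimplex]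
  change _ = chainOf (pathSimplex (γ.trans δ)) -
    (chainOf (pathSimplex γ) + chainOf (pathSimplex δ))
  abel

theorem loopClass_homotopic {x : U} {γ δ : Path x x} (h : γ.Homotopic δ) :
    loopClass γ = loopClass δ := by
  rw [loopClass_eq_iff]
  obtain ⟨H⟩ := h
  obtain ⟨h1, h2, h3, h4, h5⟩ := face_homotopySimplex H
  refine ⟨chainOf (homotopySimplex H false) - chainOf (homotopySimplex H true), ?_⟩
  rw [map_sub, bdry_one_chainOf, bdry_one_chainOf, h1, h2, h3, h4, h5]
  abel

/-- The negative of the Hurewicz homomorphism. -/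
def hurewicz (g : FundamentalGroup U w) : HomologyOne U := loopClass (repLoop g)

theorem hurewicz_mul (g h : FundamentalGroup U w) :
    hurewicz (g * h) = hurewicz g + hurewicz h := by
  rw [hurewicz, hurewicz, hurewicz, ← loopClass_trans]
  refine loopClass_homotopic (homotopic_of_fromPath ?_)
  rw [mk_repLoop, mul_inv_rev, ← mk_repLoop, ← mk_repLoop]
  rfl

theorem hurewicz_fromPath (γ : Path w w) :
    hurewicz (FundamentalGroup.fromPath (Path.Homotopic.Quotient.mk γ)) = -loopClass γ := by
  rw [eq_neg_iff_add_eq_zero, hurewicz, ← loopClass_trans]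
  have h : ((repLoop (FundamentalGroup.fromPath (Path.Homotopic.Quotient.mk γ))).trans γ).Homotopic
      (Path.refl w) := by
    refine homotopic_of_fromPath ?_
    have := mk_repLoop (FundamentalGroup.fromPath (Path.Homotopic.Quotient.mk γ))
    change FundamentalGroup.fromPath (Path.Homotopic.Quotient.mk γ) *
      FundamentalGroup.fromPath (Path.Homotopic.Quotient.mk (repLoop _)) = 1
    rw [this, mul_inv_cancel]
  rw [loopClass_homotopic h]
  exact (Submodule.Quotient.mk_eq_zero _).mpr (chainOf_refl_mem_range w)

/-- The Hurewicz homomorphism on chains of group elements. -/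
def repChain (w : U) : (FundamentalGroup U w →₀ ℤ) →ₗ[ℤ] Chain U 1 :=
  Finsupp.linearCombination ℤ fun g => chainOf (pathSimplex (repLoop g))

theorem repChain_mem (c : FundamentalGroup U w →₀ ℤ) : repChain w c ∈ Cycles U 0 := by
  rw [LinearMap.mem_ker]
  suffices H : bdry U 0 ∘ₗ repChain w = 0 from LinearMap.congr_fun H c
  refine Finsupp.lhom_ext' fun g => LinearMap.ext_ring ?_
  change bdry U 0 (repChain w (Finsupp.single g 1)) = 0
  rw [repChain, Finsupp.linearCombination_single, one_smul, bdry_pathSimplex, sub_self]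

/-- The homomorphism `C_0 → C_1` sending each point `x` to the path `τ x`. -/
def tailsOf (τ : ∀ x, Path w x) : Chain U 0 →ₗ[ℤ] Chain U 1 :=
  Finsupp.lift _ ℤ _ fun σ => chainOf (pathSimplex (τ (σ default)))

theorem tailsOf_bdry (τ : ∀ x, Path w x) (a : Simplex U 1) :
    tailsOf τ (bdry U 0 (chainOf a)) =
      chainOf (pathSimplex (τ (a (stdSimplex.vertex 1)))) -
        chainOf (pathSimplex (τ (a (stdSimplex.vertex 0)))) := by
  have h : ∀ x, tailsOf τ (chainOf (pointSimplex x)) = chainOf (pathSimplex (τ x)) := fun x => by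
    simp [tailsOf]
  conv_lhs => rw [← pathSimplex_edgePath a]
  rw [bdry_pathSimplex, map_sub, h, h]

theorem exists_closing_chain (τ : ∀ x, Path w x) (a : Simplex U 1) :
    ∃ c : Chain U 2, bdry U 1 c = chainOf a - tailsOf τ (bdry U 0 (chainOf a)) -
      chainOf (pathSimplex (repLoop (edgeClass τ a))) := by
  rw [tailsOf_bdry]
  set x := a (stdSimplex.vertex 0)
  set y := a (stdSimplex.vertex 1)
  set γ : Path x y := edgePath a with hγ
  have h1 := bdry_concatSimplex (τ x) γ
  have h2 := bdry_concatSimplex ((τ x).trans γ) (τ y).symm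
  have h3 := bdry_concatSimplex (τ y) (τ y).symm
  obtain ⟨d, hd, -⟩ := exists_bdry_of_homotopic τ
    (⟨(Path.Homotopy.reflTransSymm (τ y)).symm⟩ : Path.Homotopic ((τ y).trans (τ y).symm) (Path.refl w))
  obtain ⟨e, he⟩ := chainOf_refl_mem_range w
  have hl : (((τ x).trans γ).trans (τ y).symm).Homotopic (repLoop (edgeClass τ a)) := by
    refine homotopic_of_fromPath ?_
    rw [mk_repLoop, edgeClass, holonomy, inv_inv]
  obtain ⟨k, hk, -⟩ := exists_bdry_of_homotopic τ hl
  have ha : chainOf a = chainOf (pathSimplex γ) := by rw [hγ, pathSimplex_edgePath]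
  refine ⟨chainOf (concatSimplex (τ x) γ) + chainOf (concatSimplex ((τ x).trans γ) (τ y).symm) -
    chainOf (concatSimplex (τ y) (τ y).symm) - d - e + k, ?_⟩
  rw [map_add, map_sub, map_sub, map_sub, map_add, h1, h2, h3, hd, he, hk, ha]
  abel

/-- Every singular 1-chain is homologous to a combination of the paths `τ` and of loops. -/
theorem exists_closing (τ : ∀ x, Path w x) :
    ∃ D : Chain U 1 →ₗ[ℤ] Chain U 2, ∀ c, bdry U 1 (D c) = c - tailsOf τ (bdry U 0 c) -
      repChain w (Finsupp.lmapDomain ℤ ℤ (edgeClass τ) c) := by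
  choose D hD using exists_closing_chain τ
  refine ⟨Finsupp.linearCombination ℤ D, fun c => ?_⟩
  suffices H : bdry U 1 ∘ₗ Finsupp.linearCombination ℤ D = LinearMap.id - tailsOf τ ∘ₗ bdry U 0 -
      repChain w ∘ₗ Finsupp.lmapDomain ℤ ℤ (edgeClass τ) from LinearMap.congr_fun H c
  refine Finsupp.lhom_ext' fun a => LinearMap.ext_ring ?_
  change bdry U 1 (Finsupp.linearCombination ℤ D (chainOf a)) = chainOf a -
    tailsOf τ (bdry U 0 (chainOf a)) - repChain w (Finsupp.lmapDomain ℤ ℤ (edgeClass τ) (chainOf a))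
  rw [Finsupp.linearCombination_single, one_smul, hD, Finsupp.lmapDomain_apply,
    Finsupp.mapDomain_single, repChain, Finsupp.linearCombination_single, one_smul]

theorem exists_based_paths [PathConnectedSpace U] (w : U) :
    ∃ τ : ∀ x, Path w x, τ w = Path.refl w := by
  classical
  refine ⟨fun x => if h : x = w then (Path.refl w).cast rfl h else PathConnectedSpace.somePath w x,
    ?_⟩
  simp

theorem hurewicz_surjective [PathConnectedSpace U] :
    Function.Surjective (hurewicz : FundamentalGroup U w → HomologyOne U) := by
  obtain ⟨τ, hτ⟩ := exists_based_paths w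
  obtain ⟨D, hD⟩ := exists_closing τ
  have hrep : ∀ c : FundamentalGroup U w →₀ ℤ, ∃ g : FundamentalGroup U w,
      hurewicz g = Submodule.Quotient.mk ⟨repChain w c, repChain_mem c⟩ := by
    intro c
    let M : FundamentalGroup U w →* Multiplicative (HomologyOne U) :=
      { toFun := fun g => Multiplicative.ofAdd (hurewicz g)
        map_one' := by
          have := hurewicz_mul (1 : FundamentalGroup U w) 1
          rw [one_mul] at this
          rw [left_eq_add.mp this]
          rfl
        map_mul' := fun g h => by rw [hurewicz_mul]; rfl }
    induction c using Finsupp.induction_linear with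
    | zero =>
      refine ⟨1, (congrArg Multiplicative.toAdd (map_one M)).trans ?_⟩
      rw [toAdd_one, eq_comm, Submodule.Quotient.mk_eq_zero]
      refine ⟨0, ?_⟩
      rw [map_zero]
      exact (map_zero (repChain w)).symm
    | add a b ha hb =>
      obtain ⟨g, hg⟩ := ha
      obtain ⟨h, hh⟩ := hb
      refine ⟨g * h, ?_⟩
      rw [hurewicz_mul, hg, hh, ← Submodule.Quotient.mk_add]
      congr 1
      exact Subtype.ext (map_add _ _ _).symm
    | single g n =>
      refine ⟨g ^ n, ?_⟩
      have h1 : hurewicz (g ^ n) = n • hurewicz g :=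
        (congrArg Multiplicative.toAdd (map_zpow M g n)).trans (toAdd_zpow _ _)
      rw [h1, hurewicz, loopClass, ← Submodule.Quotient.mk_smul]
      congr 1
      refine Subtype.ext ?_
      change n • chainOf (pathSimplex (repLoop g)) = repChain w (Finsupp.single g n)
      rw [repChain, Finsupp.linearCombination_single]
  intro h
  obtain ⟨⟨c, hc⟩, rfl⟩ := Submodule.Quotient.mk_surjective _ h
  obtain ⟨g, hg⟩ := hrep (Finsupp.lmapDomain ℤ ℤ (edgeClass τ) c)
  refine ⟨g, hg.trans ?_⟩
  rw [eq_comm, Submodule.Quotient.eq]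
  refine ⟨D c, ?_⟩
  rw [hD, LinearMap.mem_ker.mp hc, map_zero, sub_zero]
  rfl

theorem mem_commutator_of_hurewicz [PathConnectedSpace U] {g : FundamentalGroup U w}
    (h : hurewicz g = 0) : g ∈ commutator (FundamentalGroup U w) := by
  obtain ⟨τ, hτ⟩ := exists_based_paths w
  obtain ⟨c, hc⟩ := (Submodule.Quotient.mk_eq_zero _).mp h
  change bdry U 1 c = chainOf (pathSimplex (repLoop g)) at hc
  let χ : Chain U 1 →ₗ[ℤ] Additive (Abelianization (FundamentalGroup U w)) :=
    Finsupp.linearCombination ℤ fun a => Additive.ofMul (Abelianization.of (edgeClass τ a))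
  have hχ : χ ∘ₗ bdry U 1 = 0 := by
    refine Finsupp.lhom_ext' fun σ => LinearMap.ext_ring ?_
    change χ (bdry U 1 (chainOf σ)) = 0
    rw [bdry_one_chainOf, map_add, map_sub]
    simp only [χ, Finsupp.linearCombination_single, one_smul, edgeClass_face τ σ, map_mul,
      ofMul_mul]
    abel
  have h1 : χ (chainOf (pathSimplex (repLoop g))) = 0 := by
    rw [← hc]; exact LinearMap.congr_fun hχ c
  simp only [χ, Finsupp.linearCombination_single, one_smul, edgeClass_pathSimplex,
    holonomy_repLoop hτ] at h1
  exact (QuotientGroup.eq_one_iff g).mp h1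

end Bar

open scoped commutatorElement

/-! ### Dual bases of `H_1` and `H^1`, and universal coefficients -/

section Frames

variable {U : Type u} [TopologicalSpace U]

theorem kronecker_mk (n : ℕ) (ω : Cocycles U n) (c : Cycles U n) :
    kronecker U n (Submodule.Quotient.mk ω) (Submodule.Quotient.mk c) = ω.1 c.1 := rfl

variable [PathConnectedSpace U] (w : U)

theorem closeUp_cycle (c : Cycles U 0) : closeUp w c.1 = Submodule.Quotient.mk c := by
  change Submodule.Quotient.mk _ = _
  congr 1
  refine Subtype.ext ?_
  change c.1 - tails w (bdry U 0 c.1) = c.1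
  rw [LinearMap.mem_ker.mp c.2, map_zero, sub_zero]

theorem kronecker_zero_injective (w : U) : Function.Injective (kronecker U 0) := by
  rw [injective_iff_map_eq_zero]
  intro x hx
  obtain ⟨ω, rfl⟩ := Submodule.Quotient.mk_surjective _ x
  rw [Submodule.Quotient.mk_eq_zero]
  refine ⟨ω.1 ∘ₗ tails w, LinearMap.ext fun c => ?_⟩
  have h : ω.1 (c - tails w (bdry U 0 c)) = 0 :=
    LinearMap.congr_fun hx (Submodule.Quotient.mk ⟨c - tails w (bdry U 0 c), by
      rw [LinearMap.mem_ker, map_sub, bdry_tails_bdry, sub_self]⟩)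
  rw [map_sub, sub_eq_zero] at h
  exact h.symm

theorem kronecker_zero_surjective (w : U) : Function.Surjective (kronecker U 0) := by
  intro l
  refine ⟨Submodule.Quotient.mk ⟨l ∘ₗ closeUp w, ?_⟩, LinearMap.ext fun h => ?_⟩
  · change (l ∘ₗ closeUp w) ∘ₗ bdry U 1 = 0
    rw [LinearMap.comp_assoc, closeUp_bdry, LinearMap.comp_zero]
  · obtain ⟨c, rfl⟩ := Submodule.Quotient.mk_surjective _ h
    rw [kronecker_mk]
    exact congrArg l (closeUp_cycle w c)

/-- Dual bases of `H^1(U)` and `H_1(U)`. -/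
structure Frame (U : Type u) [TopologicalSpace U] (n : ℕ) where
  ξ : Module.Basis (Fin n) ℤ (CohomologyOne U)
  e : Module.Basis (Fin n) ℤ (HomologyOne U)
  dual : ∀ i j, kronecker U 0 (ξ i) (e j) = if i = j then 1 else 0

variable {n : ℕ}

theorem Frame.kronecker_ξ (B : Frame U n) (i : Fin n) (c : HomologyOne U) :
    kronecker U 0 (B.ξ i) c = B.e.repr c i := by
  suffices H : kronecker U 0 (B.ξ i) = B.e.coord i from LinearMap.congr_fun H c
  refine B.e.ext fun j => ?_
  rw [B.dual, Module.Basis.coord_apply, Module.Basis.repr_self, Finsupp.single_apply]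
  simp [eq_comm]

theorem Frame.sum_e (B : Frame U n) (c : HomologyOne U) :
    c = ∑ i, kronecker U 0 (B.ξ i) c • B.e i := by
  conv_lhs => rw [← B.e.sum_repr c]
  simp only [B.kronecker_ξ]

/-- A basis of `H_1` has a dual basis. -/
theorem exists_frame_of_basis (w : U) (e : Module.Basis (Fin n) ℤ (HomologyOne U)) :
    ∃ B : Frame U n, B.e = e := by
  let K : CohomologyOne U ≃ₗ[ℤ] Module.Dual ℤ (HomologyOne U) :=
    LinearEquiv.ofBijective (kronecker U 0) ⟨kronecker_zero_injective w, kronecker_zero_surjective w⟩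
  refine ⟨⟨e.dualBasis.map K.symm, e, fun i j => ?_⟩, rfl⟩
  have h : kronecker U 0 (K.symm (e.dualBasis i)) = e.dualBasis i := K.apply_symm_apply _
  rw [Module.Basis.map_apply, h, Module.Basis.dualBasis_apply_self]
  simp [eq_comm]

/-- If `H_1` is free of finite rank, then a basis of `H^1` has a dual basis. -/
theorem exists_frame_of_cobasis (w : U) {m : ℕ} (e : Module.Basis (Fin m) ℤ (HomologyOne U))
    (ξ : Module.Basis (Fin n) ℤ (CohomologyOne U)) : ∃ B : Frame U n, B.ξ = ξ := by
  have : Module.Free ℤ (HomologyOne U) := Module.Free.of_basis e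
  have : Module.Finite ℤ (HomologyOne U) := Module.Finite.of_basis e
  let K : CohomologyOne U ≃ₗ[ℤ] Module.Dual ℤ (HomologyOne U) :=
    LinearEquiv.ofBijective (kronecker U 0) ⟨kronecker_zero_injective w, kronecker_zero_surjective w⟩
  let d := (ξ.map K).dualBasis
  let E := Module.evalEquiv ℤ (HomologyOne U)
  refine ⟨⟨ξ, d.map E.symm, fun i j => ?_⟩, rfl⟩
  have h : kronecker U 0 (ξ i) = (ξ.map K) i := rfl
  have h2 : ∀ f : Module.Dual ℤ (HomologyOne U), f (E.symm (d j)) = d j f := fun f => by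
    conv_rhs => rw [← E.apply_symm_apply (d j)]
    rfl
  rw [h, Module.Basis.map_apply d, h2, Module.Basis.dualBasis_apply_self]

/-- A basis of `H_1` from a basis of the abelianized fundamental group. -/
theorem exists_basis_of_abelianization
    (h : Nonempty (Additive (Abelianization (FundamentalGroup U w)) ≃+ (Fin n → ℤ))) :
    Nonempty (Module.Basis (Fin n) ℤ (HomologyOne U)) := by
  obtain ⟨h⟩ := h
  let M : FundamentalGroup U w →* Multiplicative (HomologyOne U) :=
    MonoidHom.mk' (fun g => Multiplicative.ofAdd (hurewicz g)) fun g h => by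
      rw [hurewicz_mul]; rfl
  let A : Additive (Abelianization (FundamentalGroup U w)) →+ HomologyOne U :=
    MonoidHom.toAdditiveLeft (Abelianization.lift M)
  have hA : ∀ g, A (Additive.ofMul (Abelianization.of g)) = hurewicz g := fun g => rfl
  have hinj : Function.Injective A := by
    rw [injective_iff_map_eq_zero]
    intro a ha
    obtain ⟨g, hg⟩ := QuotientGroup.mk_surjective (Additive.toMul a)
    have : a = Additive.ofMul (Abelianization.of g) := congrArg Additive.ofMul hg.symm
    rw [this, hA] at ha
    rw [this]
    exact (QuotientGroup.eq_one_iff g).mpr (mem_commutator_of_hurewicz ha)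
  have hsurj : Function.Surjective A := fun c => by
    obtain ⟨g, hg⟩ := hurewicz_surjective (w := w) c
    exact ⟨_, (hA g).trans hg⟩
  let E : (Fin n → ℤ) ≃+ HomologyOne U := h.symm.trans (AddEquiv.ofBijective A ⟨hinj, hsurj⟩)
  let E' : (Fin n → ℤ) ≃ₗ[ℤ] HomologyOne U := E.toLinearEquiv fun c x => by
    have := map_intCast_smul E ℤ ℤ c x
    simpa using this
  exact ⟨(Pi.basisFun ℤ (Fin n)).map E'⟩

/-- A contraction of 1-chains onto combinations of fixed representatives of a basis of `H_1`. -/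
theorem Frame.exists_contraction (B : Frame U n) (w : U) : ∃ S : Chain U 1 →ₗ[ℤ] Chain U 2,
    ∀ c : Chain U 2, bdry U 1 (c - S (bdry U 1 c)) = 0 := by
  choose q hq using fun i => Submodule.Quotient.mk_surjective _ (B.e i)
  let Q : Chain U 1 →ₗ[ℤ] Chain U 1 :=
    ∑ i, (LinearMap.toSpanSingleton ℤ (Chain U 1) (q i).1) ∘ₗ kronecker U 0 (B.ξ i) ∘ₗ closeUp w
  have hQ : ∀ c, Q c = ∑ i, kronecker U 0 (B.ξ i) (closeUp w c) • (q i).1 := fun c => by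
    simp [Q]
  have key : ∀ a : Simplex U 1, ∃ d : Chain U 2,
      bdry U 1 d = chainOf a - tails w (bdry U 0 (chainOf a)) - Q (chainOf a) := by
    intro a
    let y : Cycles U 0 := ⟨chainOf a - tails w (bdry U 0 (chainOf a)), by
      rw [LinearMap.mem_ker, map_sub, bdry_tails_bdry, sub_self]⟩
    have h1 : closeUp w (chainOf a) = Submodule.Quotient.mk y := rfl
    have h2 : (Submodule.Quotient.mk y : HomologyOne U) = Submodule.Quotient.mk
        (∑ i, kronecker U 0 (B.ξ i) (closeUp w (chainOf a)) • q i) := by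
      rw [← h1]
      conv_lhs => rw [B.sum_e (closeUp w (chainOf a))]
      rw [← Submodule.mkQ_apply, map_sum]
      refine Finset.sum_congr rfl fun i _ => ?_
      rw [map_smul, Submodule.mkQ_apply, hq]
    obtain ⟨d, hd⟩ := (Submodule.Quotient.eq _).mp h2
    refine ⟨d, hd.trans ?_⟩
    rw [hQ]
    simp [y]
  choose S hS using key
  have hS' : ∀ c, bdry U 1 (Finsupp.linearCombination ℤ S c) =
      c - tails w (bdry U 0 c) - Q c := by
    intro c
    suffices H : bdry U 1 ∘ₗ Finsupp.linearCombination ℤ S =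
      LinearMap.id - tails w ∘ₗ bdry U 0 - Q from LinearMap.congr_fun H c
    refine Finsupp.lhom_ext' fun a => LinearMap.ext_ring ?_
    change bdry U 1 (Finsupp.linearCombination ℤ S (chainOf a)) =
      chainOf a - tails w (bdry U 0 (chainOf a)) - Q (chainOf a)
    rw [Finsupp.linearCombination_single, one_smul, hS]
  refine ⟨Finsupp.linearCombination ℤ S, fun c => ?_⟩
  have h3 : closeUp w (bdry U 1 c) = 0 := LinearMap.congr_fun (closeUp_bdry w) c
  rw [map_sub, hS', bdry_bdry, map_zero, hQ, h3]
  simp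

theorem Frame.kronecker_one_injective (B : Frame U n) (w : U) : Function.Injective (kronecker U 1) := by
  obtain ⟨S, hS⟩ := B.exists_contraction w
  rw [injective_iff_map_eq_zero]
  intro x hx
  obtain ⟨ω, rfl⟩ := Submodule.Quotient.mk_surjective _ x
  rw [Submodule.Quotient.mk_eq_zero]
  refine ⟨ω.1 ∘ₗ S, LinearMap.ext fun c => ?_⟩
  have h : ω.1 (c - S (bdry U 1 c)) = 0 :=
    LinearMap.congr_fun hx (Submodule.Quotient.mk ⟨c - S (bdry U 1 c), hS c⟩)
  rw [map_sub, sub_eq_zero] at h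
  exact h.symm

theorem bdry_bdry_one (c : Chain U 3) : bdry U 1 (bdry U 2 c) = 0 := by
  suffices H : bdry U 1 ∘ₗ bdry U 2 = 0 from LinearMap.congr_fun H c
  refine Finsupp.lhom_ext' fun σ => LinearMap.ext_ring ?_
  change bdry U 1 (bdry U 2 (chainOf σ)) = 0
  have i1 : face 0 (face 1 σ) = face 0 (face 0 σ) := face_face (i := 0) (j := 0) (by decide) σ
  have i2 : face 0 (face 2 σ) = face 1 (face 0 σ) := face_face (i := 0) (j := 1) (by decide) σ
  have i3 : face 0 (face 3 σ) = face 2 (face 0 σ) := face_face (i := 0) (j := 2) (by decide) σ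
  have i4 : face 1 (face 2 σ) = face 1 (face 1 σ) := face_face (i := 1) (j := 1) (by decide) σ
  have i5 : face 1 (face 3 σ) = face 2 (face 1 σ) := face_face (i := 1) (j := 2) (by decide) σ
  have i6 : face 2 (face 3 σ) = face 2 (face 2 σ) := face_face (i := 2) (j := 2) (by decide) σ
  rw [bdry_two_chainOf, map_sub, map_add, map_sub, bdry_one_chainOf, bdry_one_chainOf,
    bdry_one_chainOf, bdry_one_chainOf, i1, i2, i3, i4, i5, i6]
  abel

theorem Frame.kronecker_one_surjective (B : Frame U n) (w : U) : Function.Surjective (kronecker U 1) := by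
  obtain ⟨S, hS⟩ := B.exists_contraction w
  intro l
  let P : Chain U 2 →ₗ[ℤ] Cycles U 1 :=
    (LinearMap.id - S ∘ₗ bdry U 1).codRestrict (Cycles U 1) hS
  have hP : ∀ c, (P c).1 = c - S (bdry U 1 c) := fun c => rfl
  refine ⟨Submodule.Quotient.mk ⟨l ∘ₗ Submodule.mkQ _ ∘ₗ P, ?_⟩, LinearMap.ext fun h => ?_⟩
  · rw [LinearMap.mem_ker]
    refine LinearMap.ext fun c => ?_
    change l (Submodule.Quotient.mk (P (bdry U 2 c))) = 0
    have : (Submodule.Quotient.mk (P (bdry U 2 c)) : HomologyTwo U) = 0 := by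
      rw [Submodule.Quotient.mk_eq_zero]
      refine ⟨c, ?_⟩
      change _ = (P (bdry U 2 c)).1
      rw [hP, bdry_bdry_one, map_zero, sub_zero]
    rw [this, map_zero]
  · obtain ⟨c, rfl⟩ := Submodule.Quotient.mk_surjective _ h
    rw [kronecker_mk]
    change l (Submodule.Quotient.mk (P c.1)) = l (Submodule.Quotient.mk c)
    congr 2
    refine Subtype.ext ?_
    rw [hP, LinearMap.mem_ker.mp c.2, map_zero, sub_zero]

/-- The matrix of `Δ̄`: its entries are the values of the cup products of the basis of `H^1`. -/
def Frame.delta (B : Frame U n) : HomologyTwo U →ₗ[ℤ] Fin n → Fin n → ℤ :=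
  LinearMap.pi fun i => LinearMap.pi fun j => kronecker U 1 (cup (B.ξ i) (B.ξ j))

theorem Frame.delta_apply (B : Frame U n) (z : HomologyTwo U) (i j : Fin n) :
    B.delta z i j = kronecker U 1 (cup (B.ξ i) (B.ξ j)) z := rfl

/-- Coordinates on `H_1 ⊗ H_1`. -/
def Frame.coord₂ (B : Frame U n) (i j : Fin n) : HomologyOne U ⊗[ℤ] HomologyOne U →ₗ[ℤ] ℤ :=
  (TensorProduct.lid ℤ ℤ).toLinearMap ∘ₗ
    TensorProduct.map (kronecker U 0 (B.ξ i)) (kronecker U 0 (B.ξ j))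

theorem Frame.coord₂_tmul (B : Frame U n) (i j : Fin n) (x y : HomologyOne U) :
    B.coord₂ i j (x ⊗ₜ y) = kronecker U 0 (B.ξ i) x * kronecker U 0 (B.ξ j) y := by
  simp [Frame.coord₂]

theorem Frame.delta_eq (B : Frame U n) (z : HomologyTwo U) (i j : Fin n) :
    B.delta z i j = B.coord₂ i j (comultBar w z) := kronecker_cup w _ _ z

theorem Frame.sum_coord₂ (B : Frame U n) (t : HomologyOne U ⊗[ℤ] HomologyOne U) :
    t = ∑ i, ∑ j, B.coord₂ i j t • (B.e i ⊗ₜ B.e j) := by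
  induction t with
  | zero => simp
  | add x y hx hy =>
    conv_lhs => rw [hx, hy]
    simp only [map_add, add_smul, Finset.sum_add_distrib]
  | tmul x y =>
    conv_lhs => rw [B.sum_e x, B.sum_e y]
    simp only [TensorProduct.sum_tmul, TensorProduct.tmul_sum, B.coord₂_tmul,
      TensorProduct.smul_tmul_smul]
    exact Finset.sum_comm

variable {w} in
theorem Frame.delta_injective (B : Frame U n) (h : Function.Injective (comultBar w)) :
    Function.Injective B.delta := by
  intro z z' hz
  apply h
  rw [B.sum_coord₂ (comultBar w z), B.sum_coord₂ (comultBar w z')]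
  simp only [← B.delta_eq w, hz]

/-! #### The marking of the fundamental group -/

/-- The coordinates of the image of an element of the fundamental group in `H_1`. -/
def Frame.mark (B : Frame U n) (w : U) (g : FundamentalGroup U w) (i : Fin n) : ℤ :=
  kronecker U 0 (B.ξ i) (hurewicz g)

/-- Elements of the fundamental group above the basis of `H_1`. -/
def Frame.gens (B : Frame U n) (w : U) (i : Fin n) : FundamentalGroup U w :=
  (hurewicz_surjective (B.e i)).choose

theorem Frame.isMarked (B : Frame U n) (w : U) : IsMarked (B.mark w) (B.gens w) where
  mul g h := by
    intro i
    rw [Frame.mark, hurewicz_mul, map_add]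
    rfl
  basis i := by
    ext j
    rw [Frame.mark, Frame.gens, (hurewicz_surjective (B.e i)).choose_spec, B.dual, Pi.single_apply]
  ker g hg := by
    refine mem_commutator_of_hurewicz ?_
    rw [B.sum_e (hurewicz g)]
    refine Finset.sum_eq_zero fun i _ => ?_
    have : B.mark w g i = 0 := by exact hg i
    rw [Frame.mark] at this
    rw [this, zero_smul]

theorem Frame.mark_mul (B : Frame U n) (g h : FundamentalGroup U w) (i : Fin n) :
    B.mark w (g * h) i = B.mark w g i + B.mark w h i := by
  rw [Frame.mark, hurewicz_mul, map_add]
  rfl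

variable {w}

/-- The 1-cocycle with values the markings of the edges. -/
def Frame.edgeCocycle (B : Frame U n) (τ : ∀ x, Path w x) (i : Fin n) : Cocycles U 0 :=
  ⟨cochainOf fun a => B.mark w (edgeClass τ a) i, by
    rw [LinearMap.mem_ker]
    refine cochain_ext fun σ => ?_
    rw [LinearMap.dualMap_apply, bdry_one_chainOf, map_add, map_sub, cochainOf_chainOf,
      cochainOf_chainOf, cochainOf_chainOf, edgeClass_face τ σ, B.mark_mul]
    simp⟩

theorem Frame.mk_edgeCocycle (B : Frame U n) (τ : ∀ x, Path w x) (i : Fin n) :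
    Submodule.Quotient.mk (B.edgeCocycle τ i) = B.ξ i := by
  refine kronecker_zero_injective w (LinearMap.ext fun h => ?_)
  obtain ⟨c, rfl⟩ := Submodule.Quotient.mk_surjective _ h
  obtain ⟨D, hD⟩ := exists_closing τ
  have h1 : (Submodule.Quotient.mk c : HomologyOne U) = Submodule.Quotient.mk
      ⟨repChain w (Finsupp.lmapDomain ℤ ℤ (edgeClass τ) c.1), repChain_mem _⟩ := by
    rw [Submodule.Quotient.eq]
    refine ⟨D c.1, ?_⟩
    rw [hD, LinearMap.mem_ker.mp c.2, map_zero, sub_zero]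
    rfl
  rw [h1, ← h1, kronecker_mk, h1]
  let R : Chain U 1 →ₗ[ℤ] Cycles U 0 :=
    (repChain w ∘ₗ Finsupp.lmapDomain ℤ ℤ (edgeClass τ)).codRestrict _ fun c => repChain_mem _
  suffices H : (B.edgeCocycle τ i).1 = kronecker U 0 (B.ξ i) ∘ₗ Submodule.mkQ _ ∘ₗ R from
    LinearMap.congr_fun H c.1
  refine cochain_ext fun a => ?_
  have h2 : R (chainOf a) = ⟨chainOf (pathSimplex (repLoop (edgeClass τ a))), by
      rw [LinearMap.mem_ker, bdry_pathSimplex, sub_self]⟩ := by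
    refine Subtype.ext ?_
    change repChain w (Finsupp.lmapDomain ℤ ℤ (edgeClass τ) (chainOf a)) = _
    rw [Finsupp.lmapDomain_apply, Finsupp.mapDomain_single, repChain,
      Finsupp.linearCombination_single, one_smul]
  change cochainOf _ (chainOf a) = kronecker U 0 (B.ξ i) (Submodule.Quotient.mk (R (chainOf a)))
  rw [cochainOf_chainOf, h2]
  rfl

theorem Frame.delta_mk (B : Frame U n) (τ : ∀ x, Path w x) (z : Cycles U 1) (i j : Fin n) :
    B.delta (Submodule.Quotient.mk z) i j =
      barEval (fun g h => B.mark w g i * B.mark w h j) (singToBar τ z.1) := by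
  rw [B.delta_apply, ← B.mk_edgeCocycle τ i, ← B.mk_edgeCocycle τ j, cup_mk]
  change cupCochain U _ z.1 = _
  rw [barEval_singToBar]
  refine LinearMap.congr_fun (cochain_ext fun σ => ?_) z.1
  rw [cupCochain_chainOf, cochainOf_chainOf]
  change cochainOf _ _ * cochainOf _ _ = _
  rw [cochainOf_chainOf, cochainOf_chainOf]

theorem Frame.mark_one (B : Frame U n) (i : Fin n) : B.mark w 1 i = 0 := (B.isMarked w).one i

theorem Frame.exists_cycle_of_mem_relSub (B : Frame U n) {τ : ∀ x, Path w x}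
    (hτ : τ w = Path.refl w) {r : FreeGroup (Fin n)} (hr : r ∈ relSub (B.gens w) 3) :
    ∃ z : Cycles U 1, B.delta (Submodule.Quotient.mk z) = (magnus r).deg₂ ∧
      ∀ S, (B.isMarked w).Kills S →
        barEval ((B.isMarked w).obstr S) (singToBar τ z.1) = pair₃ S (magnus r).deg₃ := by
  obtain ⟨c, hc, h1, h2⟩ := (B.isMarked w).exists_cycle_of_mem_relSub hr
  obtain ⟨z, hz⟩ := exists_cycle_of_barCycle hτ hc
  refine ⟨z, ?_, fun S hS => ?_⟩
  · ext i j
    rw [B.delta_mk τ, hz _ (fun g => by rw [B.mark_one, mul_zero])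
      (fun g => by rw [B.mark_one, zero_mul]), h1]
  · rw [hz _ (fun g => (B.isMarked w).obstr_one_right hS g (one_mem _))
      (fun g => (B.isMarked w).obstr_one_left hS g (one_mem _)), h2 S hS]

theorem Frame.mem_rel₂_iff (B : Frame U n) (b : Fin n → Fin n → ℤ) :
    b ∈ (B.isMarked w).rel₂ ↔ ∃ z, B.delta z = b := by
  obtain ⟨τ, hτ⟩ := exists_based_paths w
  constructor
  · intro hb
    obtain ⟨r, hr, rfl⟩ := (B.isMarked w).mem_rel₂.mp hb
    obtain ⟨z, hz, -⟩ := B.exists_cycle_of_mem_relSub hτ hr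
    exact ⟨_, hz⟩
  · rintro ⟨z, rfl⟩
    obtain ⟨z, rfl⟩ := Submodule.Quotient.mk_surjective _ z
    have h := (B.isMarked w).barEval_mem_rel₂ (c := singToBar τ z.1) (by
      rw [barBdry_singToBar, LinearMap.mem_ker.mp z.2, map_zero])
    convert h using 1
    ext i j
    rw [B.delta_mk τ, IsMarked.barEval_apply₂]

theorem Frame.obstr_bdry (B : Frame U n) (τ : ∀ x, Path w x) {S : Fin n → Fin n → Fin n → ℤ}
    (hS : (B.isMarked w).Kills S) (c : Chain U 3) :
    barEval ((B.isMarked w).obstr S) (singToBar τ (bdry U 2 c)) = 0 := by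
  suffices H : barEval ((B.isMarked w).obstr S) ∘ₗ singToBar τ ∘ₗ bdry U 2 = 0 from
    LinearMap.congr_fun H c
  refine cochain_ext fun σ => ?_
  have i1 : face 0 (face 1 σ) = face 0 (face 0 σ) := face_face (i := 0) (j := 0) (by decide) σ
  have i2 : face 0 (face 2 σ) = face 1 (face 0 σ) := face_face (i := 0) (j := 1) (by decide) σ
  have i3 : face 0 (face 3 σ) = face 2 (face 0 σ) := face_face (i := 0) (j := 2) (by decide) σ
  have i5 : face 1 (face 3 σ) = face 2 (face 1 σ) := face_face (i := 1) (j := 2) (by decide) σ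
  have i6 : face 2 (face 3 σ) = face 2 (face 2 σ) := face_face (i := 2) (j := 2) (by decide) σ
  have h := hS.obstr_cocycle (edgeClass τ (face 2 (face 2 σ))) (edgeClass τ (face 2 (face 0 σ)))
    (edgeClass τ (face 0 (face 0 σ)))
  change barEval _ (singToBar τ (bdry U 2 (chainOf σ))) = 0
  rw [bdry_two_chainOf]
  simp only [map_sub, map_add, singToBar_chainOf, barEval_single]
  rw [i1, i2, i3, ← i5, i6, edgeClass_face τ (face 3 σ), edgeClass_face τ (face 0 σ), i6, i3]
  linarith

theorem Frame.barEval_obstr (B : Frame U n) (hinj : Function.Injective (comultBar w))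
    {τ : ∀ x, Path w x} (hτ : τ w = Path.refl w) {S : Fin n → Fin n → Fin n → ℤ}
    (hS : (B.isMarked w).Kills S) {r : FreeGroup (Fin n)} (hr : r ∈ relSub (B.gens w) 3)
    (z : Cycles U 1) (hz : B.delta (Submodule.Quotient.mk z) = (magnus r).deg₂) :
    barEval ((B.isMarked w).obstr S) (singToBar τ z.1) = pair₃ S (magnus r).deg₃ := by
  obtain ⟨z', h1, h2⟩ := B.exists_cycle_of_mem_relSub hτ hr
  obtain ⟨d, hd⟩ := (Submodule.Quotient.eq _).mp (B.delta_injective hinj (hz.trans h1.symm))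
  rw [← h2 S hS, ← sub_eq_zero, ← map_sub, ← map_sub, ← B.obstr_bdry τ hS d, hd]
  rfl

theorem Frame.determined (B : Frame U n) (hinj : Function.Injective (comultBar w)) :
    (B.isMarked w).Determined := by
  obtain ⟨τ, hτ⟩ := exists_based_paths w
  intro r hr r' hr' h S hS
  obtain ⟨z, h1, h2⟩ := B.exists_cycle_of_mem_relSub hτ hr
  rw [← h2 S hS, B.barEval_obstr hinj hτ hS hr' z (h1.trans h)]

end Frames

/-! ### Coordinates in tensor and exterior products -/

section Coordinates

attribute [local instance 10] ZSMul.toSMul instMulActionIntOfSubtractionMonoid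
  AddGroup.intSMulWithZero instSMulWithZeroInt AddSubgroupClass.instZSMul

variable {M : Type*} [AddCommGroup M] [Module ℤ M] {n : ℕ} (ξ : Module.Basis (Fin n) ℤ M)

theorem sum_smul_alternating {N : Type*} [AddCommGroup N] [Module ℤ N] (s : Fin n → Fin n → ℤ)
    (a : Fin n → Fin n → N) (h₀ : ∀ i, a i i = 0) (ha : ∀ i j, a j i = -a i j) :
    ∑ j, ∑ k, s j k • a j k = ∑ j, ∑ k, if j < k then (s j k - s k j) • a j k else 0 := by
  have e1 : ∑ j, ∑ k, s j k • a j k = ∑ j, ∑ k, (if j < k then s j k • a j k else 0) +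
      ∑ j, ∑ k, (if k < j then s j k • a j k else 0) := by
    simp only [← Finset.sum_add_distrib]
    refine Finset.sum_congr rfl fun j _ => Finset.sum_congr rfl fun k _ => ?_
    rcases lt_trichotomy j k with h | rfl | h
    · simp [h, h.not_gt]
    · simp [h₀]
    · simp [h, h.not_gt]
  rw [e1, Finset.sum_comm (f := fun j k => if k < j then s j k • a j k else 0)]
  simp only [← Finset.sum_add_distrib]
  refine Finset.sum_congr rfl fun j _ => Finset.sum_congr rfl fun k _ => ?_
  split_ifs
  · rw [ha j k, smul_neg, sub_smul, sub_eq_add_neg]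
  · rw [add_zero]

theorem sum_smul_alternating_eq_zero {N : Type*} [AddCommGroup N] [Module ℤ N]
    (s : Fin n → Fin n → ℤ) (a : Fin n → Fin n → N) (h₀ : ∀ i, a i i = 0)
    (ha : ∀ i j, a j i = -a i j) (hs : ∀ i j, s j i = s i j) : ∑ j, ∑ k, s j k • a j k = 0 := by
  rw [sum_smul_alternating s a h₀ ha]
  refine Finset.sum_eq_zero fun j _ => Finset.sum_eq_zero fun k _ => ?_
  rw [hs j k, sub_self, zero_smul, ite_self]

/-- The coordinates of an element of `M ⊗ M`. -/
def tcoord₂ (i j : Fin n) : M ⊗[ℤ] M →ₗ[ℤ] ℤ :=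
  (TensorProduct.lid ℤ ℤ).toLinearMap ∘ₗ TensorProduct.map (ξ.coord i) (ξ.coord j)

@[simp]
theorem tcoord₂_tmul (i j : Fin n) (x y : M) :
    tcoord₂ ξ i j (x ⊗ₜ y) = ξ.coord i x * ξ.coord j y := by
  simp [tcoord₂]

theorem sum_coord_smul (x : M) : x = ∑ i, ξ.coord i x • ξ i := (ξ.sum_repr x).symm

theorem coord_basis (i j : Fin n) : ξ.coord i (ξ j) = if i = j then 1 else 0 := by
  rw [Module.Basis.coord_apply, Module.Basis.repr_self, Finsupp.single_apply]
  simp [eq_comm]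

theorem sum_tcoord₂ (t : M ⊗[ℤ] M) : t = ∑ i, ∑ j, tcoord₂ ξ i j t • (ξ i ⊗ₜ[ℤ] ξ j) := by
  induction t with
  | zero => simp
  | add x y hx hy =>
    conv_lhs => rw [hx, hy]
    simp only [map_add, add_smul, Finset.sum_add_distrib]
  | tmul x y =>
    conv_lhs => rw [sum_coord_smul ξ x, sum_coord_smul ξ y]
    simp only [TensorProduct.sum_tmul, TensorProduct.tmul_sum, tcoord₂_tmul,
      TensorProduct.smul_tmul_smul]
    exact Finset.sum_comm

/-- The element of `M ⊗ M` with given coordinates. -/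
def tensor₂ (c : Fin n → Fin n → ℤ) : M ⊗[ℤ] M := ∑ i, ∑ j, c i j • (ξ i ⊗ₜ[ℤ] ξ j)

theorem tcoord₂_tensor₂ (c : Fin n → Fin n → ℤ) (i j : Fin n) :
    tcoord₂ ξ i j (tensor₂ ξ c) = c i j := by
  simp only [tensor₂, map_sum, map_smul, tcoord₂_tmul, coord_basis, smul_eq_mul]
  rw [Finset.sum_eq_single i (fun b _ hb => by simp [hb.symm]) (by simp),
    Finset.sum_eq_single j (fun b _ hb => by simp [hb.symm]) (by simp)]
  simp

theorem tensor₂_tcoord₂ (t : M ⊗[ℤ] M) : tensor₂ ξ (fun i j => tcoord₂ ξ i j t) = t :=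
  (sum_tcoord₂ ξ t).symm

/-- The coordinates of an element of `M ⊗ M ⊗ M`. -/
def tcoord₃ (i j k : Fin n) : M ⊗[ℤ] (M ⊗[ℤ] M) →ₗ[ℤ] ℤ :=
  (TensorProduct.lid ℤ ℤ).toLinearMap ∘ₗ TensorProduct.map (ξ.coord i) (tcoord₂ ξ j k)

@[simp]
theorem tcoord₃_tmul (i j k : Fin n) (x : M) (t : M ⊗[ℤ] M) :
    tcoord₃ ξ i j k (x ⊗ₜ t) = ξ.coord i x * tcoord₂ ξ j k t := by
  simp [tcoord₃]

/-- The element of `M ⊗ M ⊗ M` with given coordinates. -/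
def tensor₃ (S : Fin n → Fin n → Fin n → ℤ) : M ⊗[ℤ] (M ⊗[ℤ] M) :=
  ∑ i, ∑ j, ∑ k, S i j k • tri (ξ i) (ξ j) (ξ k)

theorem tensor₃_tcoord₃ (t : M ⊗[ℤ] (M ⊗[ℤ] M)) :
    tensor₃ ξ (fun i j k => tcoord₃ ξ i j k t) = t := by
  induction t with
  | zero => simp [tensor₃]
  | add x y hx hy =>
    conv_rhs => rw [← hx, ← hy]
    simp only [tensor₃, map_add, add_smul, Finset.sum_add_distrib]
  | tmul x t =>
    conv_rhs => rw [sum_coord_smul ξ x, sum_tcoord₂ ξ t]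
    rw [TensorProduct.sum_tmul]
    refine Finset.sum_congr rfl fun i _ => ?_
    simp only [tcoord₃_tmul, TensorProduct.tmul_sum, tri, ← TensorProduct.smul_tmul',
      TensorProduct.tmul_smul, smul_smul]
    simp only [mul_comm]

theorem tcoord₃_tensor₃ (S : Fin n → Fin n → Fin n → ℤ) (i j k : Fin n) :
    tcoord₃ ξ i j k (tensor₃ ξ S) = S i j k := by
  simp only [tensor₃, map_sum, map_smul, tri, tcoord₃_tmul, tcoord₂_tmul, coord_basis, smul_eq_mul]
  rw [Finset.sum_eq_single i (fun b _ hb => by simp [hb.symm]) (by simp),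
    Finset.sum_eq_single j (fun b _ hb => by simp [hb.symm]) (by simp),
    Finset.sum_eq_single k (fun b _ hb => by simp [hb.symm]) (by simp)]
  simp

theorem tensor₃_eq_right (S : Fin n → Fin n → Fin n → ℤ) :
    tensor₃ ξ S = ∑ i, ξ i ⊗ₜ[ℤ] tensor₂ ξ (S i) := by
  simp only [tensor₃, tensor₂, tri, TensorProduct.tmul_sum, TensorProduct.tmul_smul]

theorem tensor₃_eq_left (S : Fin n → Fin n → Fin n → ℤ) :
    tensor₃ ξ S = ∑ k, TensorProduct.assoc ℤ M M M
      (tensor₂ ξ (fun i j => S i j k) ⊗ₜ[ℤ] ξ k) := by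
  simp only [tensor₃, tensor₂, tri, TensorProduct.sum_tmul, ← TensorProduct.smul_tmul', map_sum,
    map_smul, TensorProduct.assoc_tmul]
  simp only [fun i => Finset.sum_comm (s := (Finset.univ : Finset (Fin n)))
    (t := (Finset.univ : Finset (Fin n)))
    (f := fun j k => S i j k • ξ i ⊗ₜ[ℤ] (ξ j ⊗ₜ[ℤ] ξ k))]
  rw [Finset.sum_comm]

/-! #### The exterior square -/

theorem eta₂_tmul (x y : M) : eta₂ M (x ⊗ₜ y) = exteriorPower.ιMulti ℤ 2 ![x, y] := by
  simp [eta₂]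

theorem eta₂_self (x : M) : eta₂ M (x ⊗ₜ x) = 0 := by
  rw [eta₂_tmul]
  exact AlternatingMap.map_eq_zero_of_eq _ _ (i := 0) (j := 1) rfl (by decide)

theorem eta₂_swap (x y : M) : eta₂ M (y ⊗ₜ x) = -eta₂ M (x ⊗ₜ y) := by
  have h := eta₂_self (x + y)
  rw [TensorProduct.add_tmul, TensorProduct.tmul_add, TensorProduct.tmul_add, map_add, map_add,
    map_add, eta₂_self, eta₂_self, zero_add, add_zero] at h
  exact eq_neg_of_add_eq_zero_right h

theorem eta₂_surjective : Function.Surjective (eta₂ M) := by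
  rw [← LinearMap.range_eq_top, eq_top_iff, ← exteriorPower.ιMulti_span ℤ 2 M, Submodule.span_le]
  rintro _ ⟨v, rfl⟩
  refine ⟨v 0 ⊗ₜ v 1, ?_⟩
  rw [eta₂_tmul]
  congr 1
  ext i
  fin_cases i <;> rfl

theorem wedgeCoord_eta₂ (j k : Fin n) (t : M ⊗[ℤ] M) :
    wedgeCoord ξ j k (eta₂ M t) = tcoord₂ ξ j k t - tcoord₂ ξ k j t := by
  suffices H : wedgeCoord ξ j k ∘ₗ eta₂ M = tcoord₂ ξ j k - tcoord₂ ξ k j from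
    LinearMap.congr_fun H t
  refine TensorProduct.ext' fun x y => ?_
  rw [LinearMap.comp_apply, eta₂_tmul, wedgeCoord, exteriorPower.pairingDual_ιMulti_ιMulti,
    Matrix.det_fin_two]
  simp

theorem wedgeCoord_self (j : Fin n) (r : ⋀[ℤ]^2 M) : wedgeCoord ξ j j r = 0 := by
  obtain ⟨t, rfl⟩ := eta₂_surjective r
  rw [wedgeCoord_eta₂, sub_self]

theorem wedgeCoord_anti (j k : Fin n) (r : ⋀[ℤ]^2 M) :
    wedgeCoord ξ k j r = -wedgeCoord ξ j k r := by
  obtain ⟨t, rfl⟩ := eta₂_surjective r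
  rw [wedgeCoord_eta₂, wedgeCoord_eta₂, neg_sub]

theorem eta₂_eq_sum (t : M ⊗[ℤ] M) :
    eta₂ M t = ∑ j, ∑ k, tcoord₂ ξ j k t • eta₂ M (ξ j ⊗ₜ ξ k) := by
  conv_lhs => rw [sum_tcoord₂ ξ t]
  simp only [map_sum, map_smul]

theorem sum_wedgeCoord (r : ⋀[ℤ]^2 M) :
    r = ∑ j, ∑ k, if j < k then wedgeCoord ξ j k r • eta₂ M (ξ j ⊗ₜ ξ k) else 0 := by
  obtain ⟨t, rfl⟩ := eta₂_surjective r
  conv_lhs => rw [eta₂_eq_sum ξ t]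
  rw [sum_smul_alternating _ _ (fun i => eta₂_self _) (fun i j => eta₂_swap _ _)]
  simp only [wedgeCoord_eta₂]

/-- The increasing half of a tensor, a section of `η₂`. -/
def halfTensor (r : ⋀[ℤ]^2 M) : M ⊗[ℤ] M :=
  tensor₂ ξ fun j k => if j < k then wedgeCoord ξ j k r else 0

theorem eta₂_halfTensor (r : ⋀[ℤ]^2 M) : eta₂ M (halfTensor ξ r) = r := by
  conv_rhs => rw [sum_wedgeCoord ξ r]
  rw [halfTensor, tensor₂, map_sum]
  refine Finset.sum_congr rfl fun j _ => ?_
  rw [map_sum]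
  refine Finset.sum_congr rfl fun k _ => ?_
  rw [map_smul, ite_smul, zero_smul]

/-- Contraction of the first factor of `M ⊗ Λ² M`. -/
def contract (i : Fin n) : M ⊗[ℤ] (⋀[ℤ]^2 M) →ₗ[ℤ] ⋀[ℤ]^2 M :=
  (TensorProduct.lid ℤ _).toLinearMap ∘ₗ TensorProduct.map (ξ.coord i) LinearMap.id

@[simp]
theorem contract_tmul (i : Fin n) (x : M) (r : ⋀[ℤ]^2 M) :
    contract ξ i (x ⊗ₜ r) = ξ.coord i x • r := by
  simp [contract]

theorem alphaCoord_tmul (i j k : Fin n) (x : M) (r : ⋀[ℤ]^2 M) :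
    alphaCoord ξ i j k (x ⊗ₜ r) = ξ.coord i x * wedgeCoord ξ j k r := by
  simp [alphaCoord]

theorem alphaCoord_eq (i j k : Fin n) (t : M ⊗[ℤ] (⋀[ℤ]^2 M)) :
    alphaCoord ξ i j k t = wedgeCoord ξ j k (contract ξ i t) := by
  suffices H : alphaCoord ξ i j k = wedgeCoord ξ j k ∘ₗ contract ξ i from LinearMap.congr_fun H t
  refine TensorProduct.ext' fun x y => ?_
  rw [alphaCoord_tmul, LinearMap.comp_apply, contract_tmul, map_smul, smul_eq_mul]

theorem sum_contract (t : M ⊗[ℤ] (⋀[ℤ]^2 M)) : t = ∑ i, ξ i ⊗ₜ[ℤ] contract ξ i t := by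
  induction t with
  | zero => simp
  | add x y hx hy =>
    conv_lhs => rw [hx, hy]
    simp only [map_add, TensorProduct.tmul_add, Finset.sum_add_distrib]
  | tmul x r =>
    conv_lhs => rw [sum_coord_smul ξ x]
    simp only [TensorProduct.sum_tmul, contract_tmul, TensorProduct.smul_tmul]

theorem alphaCoord_self (i j : Fin n) (t : M ⊗[ℤ] (⋀[ℤ]^2 M)) : alphaCoord ξ i j j t = 0 := by
  rw [alphaCoord_eq, wedgeCoord_self]

theorem alphaCoord_anti (i j k : Fin n) (t : M ⊗[ℤ] (⋀[ℤ]^2 M)) :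
    alphaCoord ξ i k j t = -alphaCoord ξ i j k t := by
  rw [alphaCoord_eq, alphaCoord_eq, wedgeCoord_anti]

/-- The element of `M ⊗ Λ² M` with given coordinates. -/
def bracketTensor (T : Fin n → Fin n → Fin n → ℤ) : M ⊗[ℤ] (⋀[ℤ]^2 M) :=
  ∑ i, ξ i ⊗ₜ[ℤ] ∑ j, ∑ k, if j < k then T i j k • eta₂ M (ξ j ⊗ₜ ξ k) else 0

theorem bracketTensor_alphaCoord (t : M ⊗[ℤ] (⋀[ℤ]^2 M)) :
    bracketTensor ξ (fun i j k => alphaCoord ξ i j k t) = t := by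
  conv_rhs => rw [sum_contract ξ t]
  refine Finset.sum_congr rfl fun i _ => ?_
  conv_rhs => rw [sum_wedgeCoord ξ (contract ξ i t)]
  simp only [alphaCoord_eq]

theorem wedgeCoord_sum {a : Fin n → Fin n → ℤ} (h₀ : ∀ j, a j j = 0)
    (h₁ : ∀ j k, a k j = -a j k) (j k : Fin n) :
    wedgeCoord ξ j k (∑ p, ∑ q, if p < q then a p q • eta₂ M (ξ p ⊗ₜ ξ q) else 0) = a j k := by
  have e : (∑ p, ∑ q, if p < q then a p q • eta₂ M (ξ p ⊗ₜ ξ q) else 0) =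
      eta₂ M (tensor₂ ξ fun p q => if p < q then a p q else 0) := by
    simp only [tensor₂, map_sum, map_smul, ite_smul, zero_smul, apply_ite (eta₂ M), map_zero]
  rw [e, wedgeCoord_eta₂, tcoord₂_tensor₂, tcoord₂_tensor₂]
  rcases lt_trichotomy j k with h | rfl | h
  · simp [h, h.not_gt]
  · simp [h₀]
  · simp [h, h.not_gt, h₁ j k]

theorem contract_bracketTensor (T : Fin n → Fin n → Fin n → ℤ) (i : Fin n) :
    contract ξ i (bracketTensor ξ T) =
      ∑ j, ∑ k, if j < k then T i j k • eta₂ M (ξ j ⊗ₜ ξ k) else 0 := by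
  rw [bracketTensor, map_sum, Finset.sum_eq_single i]
  · rw [contract_tmul, coord_basis, if_pos rfl, one_smul]
  · intro b _ hb
    rw [contract_tmul, coord_basis, if_neg hb.symm, zero_smul]
  · simp

theorem alphaCoord_bracketTensor {T : Fin n → Fin n → Fin n → ℤ} (hT : IsBracketLike T)
    (i j k : Fin n) : alphaCoord ξ i j k (bracketTensor ξ T) = T i j k := by
  rw [alphaCoord_eq, contract_bracketTensor, wedgeCoord_sum ξ (hT.self i) (hT.anti i)]

/-- A determinant as a linear form on the exterior algebra. -/
def detForm (i j k : Fin n) : ExteriorAlgebra ℤ M →ₗ[ℤ] ℤ :=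
  ExteriorAlgebra.liftAlternating fun m => if h : m = 3 then
    h ▸ (Matrix.detRowAlternating.compLinearMap
      (LinearMap.pi ![ξ.coord i, ξ.coord j, ξ.coord k]) : M [⋀^Fin 3]→ₗ[ℤ] ℤ) else 0

theorem detForm_wedge (i j k : Fin n) (x y z : M) :
    detForm ξ i j k (ExteriorAlgebra.ιMulti ℤ 3 ![x, y, z]) =
      Matrix.det !![ξ.coord i x, ξ.coord j x, ξ.coord k x;
        ξ.coord i y, ξ.coord j y, ξ.coord k y; ξ.coord i z, ξ.coord j z, ξ.coord k z] := by
  rw [detForm, ExteriorAlgebra.liftAlternating_apply_ιMulti, dif_pos rfl]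
  refine congrArg (Matrix.det (n := Fin 3) (R := ℤ)) (Matrix.ext fun a b => ?_)
  fin_cases a <;> fin_cases b <;> rfl

theorem wedge₁₂_tmul_eta₂ (x y z : M) :
    wedge₁₂ M (x ⊗ₜ eta₂ M (y ⊗ₜ z)) =
      ExteriorAlgebra.ι ℤ x * (ExteriorAlgebra.ι ℤ y * ExteriorAlgebra.ι ℤ z) := by
  rw [eta₂_tmul]
  simp [wedge₁₂, ExteriorAlgebra.ιMulti_apply, List.ofFn_succ]

theorem detForm_wedge₁₂ (i j k : Fin n) (t : M ⊗[ℤ] (⋀[ℤ]^2 M)) :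
    detForm ξ i j k (wedge₁₂ M t) =
      alphaCoord ξ i j k t + alphaCoord ξ j k i t + alphaCoord ξ k i j t := by
  suffices H : detForm ξ i j k ∘ₗ wedge₁₂ M =
      alphaCoord ξ i j k + alphaCoord ξ j k i + alphaCoord ξ k i j from LinearMap.congr_fun H t
  refine TensorProduct.ext' fun x r => ?_
  obtain ⟨s, rfl⟩ := eta₂_surjective r
  induction s with
  | zero => simp
  | add a b ha hb => rw [map_add, TensorProduct.tmul_add, map_add, map_add, ha, hb]
  | tmul y z =>
    have e : ExteriorAlgebra.ι ℤ x * (ExteriorAlgebra.ι ℤ y * ExteriorAlgebra.ι ℤ z) =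
        ExteriorAlgebra.ιMulti ℤ 3 ![x, y, z] := by
      simp [ExteriorAlgebra.ιMulti_apply, List.ofFn_succ]
    rw [LinearMap.comp_apply, wedge₁₂_tmul_eta₂, e, detForm_wedge, Matrix.det_fin_three]
    simp only [LinearMap.add_apply, alphaCoord_tmul, wedgeCoord_eta₂, tcoord₂_tmul]
    simp
    ring

theorem isBracketLike_of_wedge₁₂ {t : M ⊗[ℤ] (⋀[ℤ]^2 M)} (ht : wedge₁₂ M t = 0) :
    IsBracketLike fun i j k => alphaCoord ξ i j k t where
  self i j := alphaCoord_self ξ i j t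
  anti i j k := alphaCoord_anti ξ i j k t
  jacobi i j k := by rw [← detForm_wedge₁₂, ht, map_zero]

theorem wedge₁₂_bracketTensor {T : Fin n → Fin n → Fin n → ℤ} (hT : IsBracketLike T) :
    wedge₁₂ M (bracketTensor ξ T) = 0 := by
  have h1 : ∀ i, (∑ j, ∑ k, if j < k then T i j k • eta₂ M (ξ j ⊗ₜ ξ k) else 0) =
      ∑ j, ∑ k, symLift T i j k • eta₂ M (ξ j ⊗ₜ ξ k) := by
    intro i
    rw [sum_smul_alternating _ _ (fun i => eta₂_self _) (fun i j => eta₂_swap _ _)]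
    simp only [hT.symLift_sub]
  rw [bracketTensor]
  simp only [h1, TensorProduct.tmul_sum, TensorProduct.tmul_smul, map_sum, map_smul,
    wedge₁₂_tmul_eta₂, ← mul_assoc]
  have h2 : ∀ i, (∑ j, ∑ k, symLift T i j k • (ExteriorAlgebra.ι ℤ (ξ i) *
      ExteriorAlgebra.ι ℤ (ξ j) * ExteriorAlgebra.ι ℤ (ξ k))) =
      ∑ k, ∑ j, symLift T i j k • (ExteriorAlgebra.ι ℤ (ξ i) *
      ExteriorAlgebra.ι ℤ (ξ j) * ExteriorAlgebra.ι ℤ (ξ k)) := fun i => Finset.sum_comm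
  simp only [h2]
  rw [Finset.sum_comm]
  refine Finset.sum_eq_zero fun k _ => ?_
  refine sum_smul_alternating_eq_zero (fun i j => symLift T i j k)
    (fun i j => ExteriorAlgebra.ι ℤ (ξ i) *
      ExteriorAlgebra.ι ℤ (ξ j) * ExteriorAlgebra.ι ℤ (ξ k)) (fun i => ?_) (fun i j => ?_)
    (fun i j => symLift_symm T _ _ _)
  · simp
  · rw [← neg_mul, ← eq_neg_of_add_eq_zero_left (ExteriorAlgebra.ι_add_mul_swap (ξ j) (ξ i))]

/-- The map `p` in coordinates. -/
theorem pMap_sum {N : Type*} [AddCommGroup N] [Module ℤ N] {T : Fin n → Fin n → Fin n → ℤ}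
    (h₀ : ∀ i j, T i j j = 0) (h₁ : ∀ i j k, T i k j = -T i j k)
    (G : Fin n → Fin n → Fin n → N) :
    ((∑ i, ∑ j, ∑ k, if i < j ∧ j < k then
        T j i k • (G i j k + G j i k) + T k i j • (G i k j + G k i j) else 0) +
      ∑ i, ∑ j, if i < j then T i i j • G i i j - T j i j • G j j i else 0) =
    ∑ p, ∑ q, ∑ r, symLift T p q r • G p q r := by
  have hpt : ∀ p q r, symLift T p q r • G p q r =
      (if p < q ∧ q < r then T q p r • G p q r else 0) +
      (if q < p ∧ p < r then T p q r • G p q r else 0) +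
      (if p < r ∧ r < q then T q p r • G p q r else 0) +
      (if q < r ∧ r < p then T p q r • G p q r else 0) +
      (if p = q then (if p < r then T p p r • G p p r else 0) else 0) +
      (if p = q then (if r < p then -(T p r p • G p p r) else 0) else 0) := by
    intro p q r
    rcases lt_trichotomy p q with h | rfl | h
    · rcases lt_trichotomy q r with h' | rfl | h'
      · have := h.trans h'
        simp [symLift, h, h', this, h.ne, h'.ne, h.not_gt, h'.not_gt, this.not_gt]
      · simp [symLift, h, h.ne, h.not_gt]
      · by_cases h3 : p < r
        · simp [symLift, h, h', h3, h.ne, h'.ne', h.not_gt, h'.not_gt, h3.not_gt]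
        · simp [symLift, h, h3, h.ne, h.not_gt, h'.not_gt]
    · rcases lt_trichotomy p r with h' | rfl | h'
      · simp [symLift, h', h'.not_gt]
      · simp [symLift, h₀]
      · simp [symLift, h', h'.not_gt, h₁ p p r]
    · rcases lt_trichotomy p r with h' | rfl | h'
      · have := h.trans h'
        simp [symLift, h, h', this, h.ne', h'.ne, h.not_gt, h'.not_gt, this.not_gt]
      · simp [symLift, h, h.ne', h.not_gt]
      · by_cases h3 : q < r
        · simp [symLift, h, h', h3, h.ne', h'.ne', h.not_gt, h'.not_gt, h3.not_gt]
        · simp [symLift, h, h3, h.ne', h.not_gt, h'.not_gt]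
  simp only [hpt, Finset.sum_add_distrib]
  have e1 : ∀ i j k, (if i < j ∧ j < k then
        T j i k • (G i j k + G j i k) + T k i j • (G i k j + G k i j) else 0) =
      (if i < j ∧ j < k then T j i k • G i j k else 0) +
      (if i < j ∧ j < k then T j i k • G j i k else 0) +
      (if i < j ∧ j < k then T k i j • G i k j else 0) +
      (if i < j ∧ j < k then T k i j • G k i j else 0) := by
    intro i j k
    split_ifs
    · rw [smul_add, smul_add]; abel
    · simp
  have e2 : ∀ i j, (if i < j then T i i j • G i i j - T j i j • G j j i else 0) =
      (if i < j then T i i j • G i i j else 0) + (if i < j then -(T j i j • G j j i) else 0) := by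
    intro i j
    split_ifs
    · abel
    · simp
  simp only [e1, e2, Finset.sum_add_distrib, ← add_assoc]
  congr 1
  · congr 1
    · congr 1
      · congr 1
        · congr 1
          rw [Finset.sum_comm]
        · refine Finset.sum_congr rfl fun i _ => ?_
          rw [Finset.sum_comm]
      · rw [Finset.sum_congr rfl fun i _ => Finset.sum_comm, Finset.sum_comm]
    · refine Finset.sum_congr rfl fun i _ => ?_
      rw [Finset.sum_comm]
      simp
  · rw [Finset.sum_comm]
    refine Finset.sum_congr rfl fun i _ => ?_
    rw [Finset.sum_comm]
    simp

theorem pMap_eq (t : M ⊗[ℤ] (⋀[ℤ]^2 M)) :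
    pMap ξ t = tensor₃ ξ (symLift fun i j k => alphaCoord ξ i j k t) := by
  rw [tensor₃, ← pMap_sum (T := fun i j k => alphaCoord ξ i j k t)
    (fun i j => alphaCoord_self ξ i j t) (fun i j k => alphaCoord_anti ξ i j k t)]
  have hite : ∀ (P : Prop) [Decidable P] (f g : M ⊗[ℤ] (⋀[ℤ]^2 M) →ₗ[ℤ] M ⊗[ℤ] (M ⊗[ℤ] M)),
      (if P then f else g) t = if P then f t else g t := fun P _ f g => by split_ifs <;> rfl
  simp only [pMap, LinearMap.add_apply, LinearMap.sum_apply, hite, LinearMap.sub_apply,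
    LinearMap.zero_apply, scaled, LinearMap.comp_apply, LinearMap.toSpanSingleton_apply]

end Coordinates

section Relations

attribute [local instance 10] ZSMul.toSMul instMulActionIntOfSubtractionMonoid
  AddGroup.intSMulWithZero instSMulWithZeroInt AddSubgroupClass.instZSMul

variable {U : Type u} [TopologicalSpace U] [PathConnectedSpace U] {n : ℕ} (B : Frame U n) (w : U)

/-! ### The kernels of the cup products in coordinates -/

theorem Frame.kronecker_muBar (t : CohomologyOne U ⊗[ℤ] CohomologyOne U) (z : HomologyTwo U) :
    kronecker U 1 (muBar U t) z = ∑ i, ∑ j, tcoord₂ B.ξ i j t * B.delta z i j := by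
  conv_lhs => rw [sum_tcoord₂ B.ξ t]
  simp only [map_sum, map_smul, LinearMap.sum_apply, LinearMap.smul_apply, smul_eq_mul]
  rfl

theorem Frame.mem_R2_iff (w : U) (t : CohomologyOne U ⊗[ℤ] CohomologyOne U) :
    t ∈ R2 U ↔ ∀ z, ∑ i, ∑ j, tcoord₂ B.ξ i j t * B.delta z i j = 0 := by
  simp only [← B.kronecker_muBar]
  constructor
  · intro h z
    rw [R2, LinearMap.mem_ker] at h
    rw [h, map_zero, LinearMap.zero_apply]
  · intro h
    exact B.kronecker_one_injective w ((LinearMap.ext h).trans (map_zero _).symm)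

theorem Frame.kronecker_muBarBar (r : ⋀[ℤ]^2 (CohomologyOne U)) (z : HomologyTwo U) :
    kronecker U 1 (muBarBar U r) z =
      ∑ j, ∑ k, if j < k then wedgeCoord B.ξ j k r * B.delta z j k else 0 := by
  conv_lhs => rw [← eta₂_halfTensor B.ξ r]
  rw [muBarBar_eta₂, B.kronecker_muBar]
  simp only [halfTensor, tcoord₂_tensor₂, ite_mul, zero_mul]

theorem Frame.mem_RBar2_iff (w : U) (r : ⋀[ℤ]^2 (CohomologyOne U)) :
    r ∈ RBar2 U ↔
      ∀ z, ∑ j, ∑ k, (if j < k then wedgeCoord B.ξ j k r * B.delta z j k else 0) = 0 := by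
  simp only [← B.kronecker_muBarBar]
  constructor
  · intro h z
    rw [RBar2, LinearMap.mem_ker] at h
    rw [h, map_zero, LinearMap.zero_apply]
  · intro h
    exact B.kronecker_one_injective w ((LinearMap.ext h).trans (map_zero _).symm)

theorem Frame.contract_mem {t : CohomologyOne U ⊗[ℤ] (⋀[ℤ]^2 (CohomologyOne U))}
    (ht : t ∈ QBar3 U) (i : Fin n) : contract B.ξ i t ∈ RBar2 U := by
  obtain ⟨s, rfl⟩ := ht.1
  clear ht
  induction s with
  | zero => simp
  | add a b ha hb =>
    rw [map_add, map_add]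
    exact add_mem ha hb
  | tmul x r =>
    rw [TensorProduct.map_tmul, contract_tmul]
    exact Submodule.smul_mem _ _ r.2

theorem Frame.killsBrackets_of_mem {t : CohomologyOne U ⊗[ℤ] (⋀[ℤ]^2 (CohomologyOne U))}
    (ht : t ∈ QBar3 U) :
    (B.isMarked w).KillsBrackets fun i j k => alphaCoord B.ξ i j k t where
  toIsBracketLike := isBracketLike_of_wedge₁₂ B.ξ ht.2
  rel b hb i := by
    obtain ⟨z, rfl⟩ := (B.mem_rel₂_iff b).mp hb
    simp only [alphaCoord_eq]
    exact (B.mem_RBar2_iff w _).mp (B.contract_mem ht i) z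

theorem Frame.bracketTensor_mem {T : Fin n → Fin n → Fin n → ℤ}
    (hT : (B.isMarked w).KillsBrackets T) : bracketTensor B.ξ T ∈ QBar3 U := by
  refine ⟨?_, wedge₁₂_bracketTensor B.ξ hT.toIsBracketLike⟩
  refine Submodule.sum_mem _ fun i _ => ?_
  have h : (∑ j, ∑ k, if j < k then T i j k • eta₂ _ (B.ξ j ⊗ₜ B.ξ k) else 0) ∈ RBar2 U := by
    refine (B.mem_RBar2_iff w _).mpr fun z => ?_
    simp only [wedgeCoord_sum B.ξ (hT.self i) (hT.anti i)]
    exact hT.rel _ ((B.mem_rel₂_iff _).mpr ⟨z, rfl⟩) i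
  exact ⟨B.ξ i ⊗ₜ ⟨_, h⟩, rfl⟩

/-- The slices of a tensor `S` killing the relations are in `R²`. -/
def Frame.leftPart {S : Fin n → Fin n → Fin n → ℤ} (hS : (B.isMarked w).Kills S) (k : Fin n) :
    R2 U :=
  ⟨tensor₂ B.ξ fun i j => S i j k, (B.mem_R2_iff w _).mpr fun z => by
    simp only [tcoord₂_tensor₂]
    exact hS.left _ ((B.mem_rel₂_iff _).mpr ⟨z, rfl⟩) k⟩

/-- The slices of a tensor `S` killing the relations are in `R²`. -/
def Frame.rightPart {S : Fin n → Fin n → Fin n → ℤ} (hS : (B.isMarked w).Kills S) (i : Fin n) :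
    R2 U :=
  ⟨tensor₂ B.ξ (S i), (B.mem_R2_iff w _).mpr fun z => by
    simp only [tcoord₂_tensor₂]
    exact hS.right _ ((B.mem_rel₂_iff _).mpr ⟨z, rfl⟩) i⟩

theorem Frame.inclLeft_leftPart {S : Fin n → Fin n → Fin n → ℤ} (hS : (B.isMarked w).Kills S) :
    inclLeft (R2 U) (∑ k, B.leftPart w hS k ⊗ₜ B.ξ k) = tensor₃ B.ξ S := by
  rw [tensor₃_eq_left, map_sum]
  rfl

theorem Frame.inclRight_rightPart {S : Fin n → Fin n → Fin n → ℤ} (hS : (B.isMarked w).Kills S) :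
    inclRight (R2 U) (∑ i, B.ξ i ⊗ₜ B.rightPart w hS i) = tensor₃ B.ξ S := by
  rw [tensor₃_eq_right, map_sum]
  rfl

theorem Frame.tensor₃_mem {S : Fin n → Fin n → Fin n → ℤ} (hS : (B.isMarked w).Kills S) :
    tensor₃ B.ξ S ∈ Q3 U :=
  ⟨⟨_, B.inclLeft_leftPart w hS⟩, ⟨_, B.inclRight_rightPart w hS⟩⟩

theorem tcoord₃_assoc {M : Type*} [AddCommGroup M] [Module ℤ M] (ξ : Module.Basis (Fin n) ℤ M)
    (i j k : Fin n) (r : M ⊗[ℤ] M) (x : M) :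
    tcoord₃ ξ i j k (TensorProduct.assoc ℤ M M M (r ⊗ₜ x)) = tcoord₂ ξ i j r * ξ.coord k x := by
  induction r with
  | zero => simp
  | add a b ha hb => rw [TensorProduct.add_tmul, map_add, map_add, ha, hb, map_add, add_mul]
  | tmul y z =>
    rw [TensorProduct.assoc_tmul, tcoord₃_tmul, tcoord₂_tmul, tcoord₂_tmul, mul_assoc]

theorem Frame.kills_of_mem {q : CohomologyOne U ⊗[ℤ] (CohomologyOne U ⊗[ℤ] CohomologyOne U)}
    (hq : q ∈ Q3 U) : (B.isMarked w).Kills fun i j k => tcoord₃ B.ξ i j k q := by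
  obtain ⟨⟨a, ha⟩, ⟨b, hb⟩⟩ := hq
  refine ⟨fun c hc k => ?_, fun c hc i => ?_⟩ <;>
    obtain ⟨z, rfl⟩ := (B.mem_rel₂_iff c).mp hc
  · rw [← ha]
    clear ha hb
    induction a with
    | zero => simp
    | add a b ha hb =>
      simp only [map_add, add_mul, Finset.sum_add_distrib, ha, hb, add_zero]
    | tmul r x =>
      have h := (B.mem_R2_iff w _).mp r.2 z
      have e : ∀ i j, tcoord₃ B.ξ i j k (inclLeft (R2 U) (r ⊗ₜ x)) =
        tcoord₂ B.ξ i j r.1 * B.ξ.coord k x := fun i j => tcoord₃_assoc B.ξ i j k _ _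
      simp only [e, mul_right_comm _ (B.ξ.coord k x), ← Finset.sum_mul, h, zero_mul]
  · rw [← hb]
    clear ha hb
    induction b with
    | zero => simp
    | add a b ha hb =>
      simp only [map_add, add_mul, Finset.sum_add_distrib, ha, hb, add_zero]
    | tmul x r =>
      have h := (B.mem_R2_iff w _).mp r.2 z
      have e : ∀ j k, tcoord₃ B.ξ i j k (inclRight (R2 U) (x ⊗ₜ r)) =
        B.ξ.coord i x * tcoord₂ B.ξ j k r.1 := fun j k => tcoord₃_tmul B.ξ i j k _ _
      simp only [e, mul_assoc, ← Finset.mul_sum, h, mul_zero]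

/-! ### Adapting the paths to a choice of cocycles -/

variable {w}

theorem cocycle_trans (ω : Cocycles U 0) {x y z : U} (γ : Path x y) (δ : Path y z) :
    ω.1 (chainOf (pathSimplex (γ.trans δ))) =
      ω.1 (chainOf (pathSimplex γ)) + ω.1 (chainOf (pathSimplex δ)) := by
  obtain ⟨h2, h0, h1⟩ := face_concatSimplex γ δ
  have := cocycle_chainOf ω (concatSimplex γ δ)
  rw [h0, h1, h2] at this
  rw [this, add_comm]

theorem cocycle_refl (ω : Cocycles U 0) (x : U) :
    ω.1 (chainOf (pathSimplex (Path.refl x))) = 0 := by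
  have := cocycle_trans ω (Path.refl x) (Path.refl x)
  rw [Path.refl_trans_refl] at this
  linarith

theorem Frame.cocycle_repLoop (ω : Cocycles U 0) (i : Fin n) (h : Submodule.Quotient.mk ω = B.ξ i)
    (g : FundamentalGroup U w) : ω.1 (chainOf (pathSimplex (repLoop g))) = B.mark w g i := by
  rw [Frame.mark, ← h]
  rfl

theorem Frame.exists_gauge (w : U) (ω : Fin n → Cocycles U 0)
    (hω : ∀ i, Submodule.Quotient.mk (ω i) = B.ξ i) :
    ∃ τ : ∀ x, Path w x, τ w = Path.refl w ∧
      ∀ i a, (ω i).1 (chainOf a) = B.mark w (edgeClass τ a) i := by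
  classical
  have key : ∀ x : U, ∃ p : Path w x, ∀ i, (ω i).1 (chainOf (pathSimplex p)) = 0 := by
    intro x
    let p := PathConnectedSpace.somePath w x
    obtain ⟨g, hg⟩ := hurewicz_surjective (w := w)
      (∑ i, (-(ω i).1 (chainOf (pathSimplex p))) • B.e i)
    refine ⟨(repLoop g).trans p, fun i => ?_⟩
    rw [cocycle_trans, B.cocycle_repLoop (ω i) i (hω i), Frame.mark, hg, map_sum]
    simp only [map_smul, B.dual, smul_eq_mul, mul_ite, mul_one, mul_zero, Finset.sum_ite_eq,
      Finset.mem_univ, if_true]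
    ring
  choose p hp using key
  let τ : ∀ x, Path w x := fun x => if h : x = w then (Path.refl w).cast rfl h else p x
  have hτ : τ w = Path.refl w := by simp [τ]
  have h0 : ∀ x i, (ω i).1 (chainOf (pathSimplex (τ x))) = 0 := by
    intro x i
    by_cases h : x = w
    · subst h
      rw [hτ, cocycle_refl]
    · have : τ x = p x := dif_neg h
      rw [this, hp]
  refine ⟨τ, hτ, fun i a => ?_⟩
  obtain ⟨c, hc⟩ := exists_closing_chain τ a
  have h1 : (ω i).1 (bdry U 1 c) = 0 := LinearMap.congr_fun (ω i).2 c
  rw [hc, tailsOf_bdry, map_sub, map_sub, map_sub, h0, h0,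
    B.cocycle_repLoop (ω i) i (hω i)] at h1
  linarith

/-! ### The standard admissible choices -/

variable (τ : ∀ x, Path w x)

/-- The map `ν` given by the quadratic Magnus coefficients, on all of `H^1 ⊗ H^1`. -/
def Frame.nuHat : CohomologyOne U ⊗[ℤ] CohomologyOne U →ₗ[ℤ] Cochain U 1 :=
  -∑ i, ∑ j, LinearMap.toSpanSingleton ℤ (Cochain U 1)
    (cochainOf fun a => (B.isMarked w).coef₂ (edgeClass τ a) i j) ∘ₗ tcoord₂ B.ξ i j

theorem Frame.nuHat_chainOf (t : CohomologyOne U ⊗[ℤ] CohomologyOne U) (a : Simplex U 1) :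
    B.nuHat τ t (chainOf a) =
      -∑ i, ∑ j, tcoord₂ B.ξ i j t * (B.isMarked w).coef₂ (edgeClass τ a) i j := by
  simp [Frame.nuHat, cochainOf_chainOf]

theorem cupCochain_map_chainOf {M : Type*} [AddCommGroup M] [Module ℤ M]
    (ξ : Module.Basis (Fin n) ℤ M) (f g : M →ₗ[ℤ] Cochain U 1) (t : M ⊗[ℤ] M) (σ : Simplex U 2) :
    cupCochain U (TensorProduct.map f g t) (chainOf σ) = ∑ i, ∑ j, tcoord₂ ξ i j t *
      (f (ξ i) (chainOf (face 2 σ)) * g (ξ j) (chainOf (face 0 σ))) := by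
  conv_lhs => rw [sum_tcoord₂ ξ t]
  simp only [map_sum, map_smul, LinearMap.sum_apply, LinearMap.smul_apply, smul_eq_mul,
    TensorProduct.map_tmul, cupCochain_chainOf]

variable {τ}

theorem Frame.cobdry_nuHat {κ : CohomologyOne U →ₗ[ℤ] Cocycles U 0}
    (hκ : ∀ i a, (κ (B.ξ i)).1 (chainOf a) = B.mark w (edgeClass τ a) i) (r : R2 U) :
    cupCochain U (TensorProduct.map ((Cocycles U 0).subtype ∘ₗ κ) ((Cocycles U 0).subtype ∘ₗ κ)
      (r : CohomologyOne U ⊗[ℤ] CohomologyOne U)) = cobdry U 1 (B.nuHat τ r.1) := by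
  refine cochain_ext fun σ => ?_
  rw [cupCochain_map_chainOf B.ξ, LinearMap.dualMap_apply, bdry_one_chainOf, map_add, map_sub,
    B.nuHat_chainOf, B.nuHat_chainOf, B.nuHat_chainOf, edgeClass_face τ σ]
  have h1 := (B.isMarked w).coef₂_mul (edgeClass τ (face 2 σ)) (edgeClass τ (face 0 σ))
  obtain ⟨z, hz⟩ := (B.mem_rel₂_iff _).mp h1
  have h2 := (B.mem_R2_iff w _).mp r.2 z
  rw [hz] at h2
  rw [← sub_eq_zero, ← h2]
  simp only [LinearMap.comp_apply, Submodule.subtype_apply, hκ]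
  simp only [mul_sub, mul_add, Finset.sum_add_distrib, Finset.sum_sub_distrib]
  ring

theorem Frame.coef₂_shuffle (g : FundamentalGroup U w) (i j : Fin n) :
    (B.isMarked w).coef₂ g i j + (B.isMarked w).coef₂ g j i + (if i = j then B.mark w g i else 0) =
      B.mark w g i * B.mark w g j := by
  rw [← (B.isMarked w).deg₁_sec g]
  exact magnus_shuffle _ i j

theorem Frame.nuHat_diag {κ : CohomologyOne U →ₗ[ℤ] Cocycles U 0}
    (hκ : ∀ i a, (κ (B.ξ i)).1 (chainOf a) = B.mark w (edgeClass τ a) i) (i : Fin n) :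
    B.nuHat τ (B.ξ i ⊗ₜ B.ξ i) = zeta (κ (B.ξ i)).1 := by
  refine cochain_ext fun a => ?_
  rw [B.nuHat_chainOf, zeta, cochainOf_chainOf, hκ]
  simp only [tcoord₂_tmul, coord_basis, ite_mul, one_mul, zero_mul, mul_ite, mul_one, mul_zero,
    Finset.sum_ite_eq', Finset.mem_univ, if_true]
  have h := B.coef₂_shuffle (edgeClass τ a) i i
  rw [if_pos rfl] at h
  have : B.mark w (edgeClass τ a) i - B.mark w (edgeClass τ a) i ^ 2 =
      2 * -(B.isMarked w).coef₂ (edgeClass τ a) i i := by linarith [sq (B.mark w (edgeClass τ a) i)]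
  rw [this, Int.mul_ediv_cancel_left _ two_ne_zero]

theorem Frame.nuHat_symm {κ : CohomologyOne U →ₗ[ℤ] Cocycles U 0}
    (hκ : ∀ i a, (κ (B.ξ i)).1 (chainOf a) = B.mark w (edgeClass τ a) i) {i j : Fin n}
    (hij : i ≠ j) : B.nuHat τ (B.ξ i ⊗ₜ B.ξ j + B.ξ j ⊗ₜ B.ξ i) =
      zeta (κ (B.ξ i + B.ξ j)).1 - zeta (κ (B.ξ i)).1 - zeta (κ (B.ξ j)).1 := by
  rw [← B.nuHat_diag hκ i, ← B.nuHat_diag hκ j]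
  refine cochain_ext fun a => ?_
  rw [map_add, map_add, Submodule.coe_add]
  simp only [LinearMap.add_apply, LinearMap.sub_apply, B.nuHat_chainOf, zeta, cochainOf_chainOf, hκ]
  simp only [tcoord₂_tmul, coord_basis, ite_mul, one_mul, zero_mul, mul_ite, mul_one, mul_zero,
    Finset.sum_ite_eq', Finset.mem_univ, if_true]
  have h := B.coef₂_shuffle (edgeClass τ a) i i
  have h' := B.coef₂_shuffle (edgeClass τ a) j j
  have h'' := B.coef₂_shuffle (edgeClass τ a) i j
  rw [if_pos rfl] at h h'
  rw [if_neg hij] at h''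
  have : B.mark w (edgeClass τ a) i + B.mark w (edgeClass τ a) j -
      (B.mark w (edgeClass τ a) i + B.mark w (edgeClass τ a) j) ^ 2 =
      2 * (-(B.isMarked w).coef₂ (edgeClass τ a) i i - (B.isMarked w).coef₂ (edgeClass τ a) j j -
        (B.isMarked w).coef₂ (edgeClass τ a) i j - (B.isMarked w).coef₂ (edgeClass τ a) j i) := by
    linear_combination h + h' + 2 * h''
  rw [this, Int.mul_ediv_cancel_left _ two_ne_zero]
  ring

end Relations

/-! ### Evaluation of the Massey class -/

section Evaluation

attribute [local instance 10] ZSMul.toSMul instMulActionIntOfSubtractionMonoid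
  AddGroup.intSMulWithZero instSMulWithZeroInt AddSubgroupClass.instZSMul

variable {U : Type u} [TopologicalSpace U] [PathConnectedSpace U] {n : ℕ} (B : Frame U n) {w : U}

theorem Frame.finite_homologyTwo (B : Frame U n) (hinj : Function.Injective (comultBar w)) :
    Module.Finite ℤ (HomologyTwo U) :=
  Module.Finite.of_injective B.delta (B.delta_injective hinj)

theorem Frame.free_homologyTwo (B : Frame U n) (hinj : Function.Injective (comultBar w)) :
    Module.Free ℤ (HomologyTwo U) :=
  Module.Free.of_equiv (LinearEquiv.ofInjective B.delta (B.delta_injective hinj)).symm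

theorem Frame.free_cohomologyTwo (B : Frame U n) (hinj : Function.Injective (comultBar w)) :
    Module.Free ℤ (CohomologyTwo U) := by
  have := B.finite_homologyTwo hinj
  have := B.free_homologyTwo hinj
  exact Module.Free.of_equiv (LinearEquiv.ofBijective (kronecker U 1)
    ⟨B.kronecker_one_injective w, B.kronecker_one_surjective w⟩).symm

theorem Frame.finite_cohomologyTwo (B : Frame U n) (hinj : Function.Injective (comultBar w)) :
    Module.Finite ℤ (CohomologyTwo U) := by
  have := B.finite_homologyTwo hinj
  have := B.free_homologyTwo hinj
  exact Module.Finite.equiv (LinearEquiv.ofBijective (kronecker U 1)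
    ⟨B.kronecker_one_injective w, B.kronecker_one_surjective w⟩).symm

theorem exists_extend_ker {A A' A'' : Type*} [AddCommGroup A] [Module ℤ A] [AddCommGroup A']
    [Module ℤ A'] [AddCommGroup A''] [Module ℤ A''] (f : A →ₗ[ℤ] A')
    [Module.Finite ℤ A'] [Module.Free ℤ A'] (g : LinearMap.ker f →ₗ[ℤ] A'') :
    ∃ h : A →ₗ[ℤ] A'', ∀ x : LinearMap.ker f, h x = g x := by
  have : Module.Free ℤ (LinearMap.range f) := inferInstance
  obtain ⟨s, hs⟩ := Module.projective_lifting_property f.rangeRestrict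
    (LinearMap.id : LinearMap.range f →ₗ[ℤ] _) f.surjective_rangeRestrict
  have hs' : ∀ y, f (s y) = y := fun y => congrArg Subtype.val (LinearMap.congr_fun hs y)
  let π : A →ₗ[ℤ] LinearMap.ker f := (LinearMap.id - s ∘ₗ f.rangeRestrict).codRestrict _ fun x => by
    rw [LinearMap.mem_ker]
    change f (x - s (f.rangeRestrict x)) = 0
    rw [map_sub, hs', sub_eq_zero]
    rfl
  refine ⟨g ∘ₗ π, fun x => congrArg g (Subtype.ext ?_)⟩
  change x.1 - s (f.rangeRestrict x.1) = x.1
  have : f.rangeRestrict x.1 = 0 := Subtype.ext x.2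
  rw [this, map_zero, sub_zero]

/-- A homomorphism `R̄² → H^1` is given by alternating matrices. -/
theorem Frame.exists_alt (hinj : Function.Injective (comultBar w))
    (g : RBar2 U →ₗ[ℤ] CohomologyOne U) :
    ∃ h : CohomologyOne U ⊗[ℤ] CohomologyOne U →ₗ[ℤ] CohomologyOne U,
      IsAlt (fun l j k => B.ξ.coord l (h (B.ξ j ⊗ₜ B.ξ k))) ∧ ∀ r : R2 U, h r.1 = g (etaR U r) := by
  have := B.finite_cohomologyTwo hinj
  have := B.free_cohomologyTwo hinj
  obtain ⟨h, hh⟩ := exists_extend_ker (muBarBar U) g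
  refine ⟨h ∘ₗ eta₂ _, ⟨fun l j => ?_, fun l j k => ?_⟩, fun r => hh (etaR U r)⟩
  · rw [LinearMap.comp_apply, eta₂_self, map_zero, map_zero]
  · rw [LinearMap.comp_apply, eta₂_swap, map_neg, map_neg, LinearMap.comp_apply]

theorem Frame.kronecker_cup_right (x : CohomologyOne U) (k : Fin n) (z : HomologyTwo U) :
    kronecker U 1 (cup x (B.ξ k)) z = ∑ l, B.ξ.coord l x * B.delta z l k := by
  conv_lhs => rw [sum_coord_smul B.ξ x]
  simp only [map_sum, map_smul, LinearMap.sum_apply, LinearMap.smul_apply, smul_eq_mul]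
  rfl

theorem Frame.kronecker_cup_left (x : CohomologyOne U) (k : Fin n) (z : HomologyTwo U) :
    kronecker U 1 (cup (B.ξ k) x) z = ∑ l, B.ξ.coord l x * B.delta z k l := by
  conv_lhs => rw [sum_coord_smul B.ξ x]
  simp only [map_sum, map_smul, LinearMap.sum_apply, LinearMap.smul_apply, smul_eq_mul]
  rfl

theorem Frame.sum_kronecker_cup (h : CohomologyOne U ⊗[ℤ] CohomologyOne U →ₗ[ℤ] CohomologyOne U)
    (S : Fin n → Fin n → Fin n → ℤ) (z : HomologyTwo U) :
    (∑ k, kronecker U 1 (cup (h (tensor₂ B.ξ fun i j => S i j k)) (B.ξ k)) z) +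
      (∑ i, kronecker U 1 (cup (B.ξ i) (h (tensor₂ B.ξ (S i)))) z) =
    pair₃ S (MagnusGroup.derive (fun l j k => B.ξ.coord l (h (B.ξ j ⊗ₜ B.ξ k))) (B.delta z)) := by
  have e : ∀ (c : Fin n → Fin n → ℤ) l, B.ξ.coord l (h (tensor₂ B.ξ c)) =
      ∑ i, ∑ j, c i j * B.ξ.coord l (h (B.ξ i ⊗ₜ B.ξ j)) := by
    intro c l
    simp only [tensor₂, map_sum, map_smul, smul_eq_mul]
  have e1 : (∑ k, kronecker U 1 (cup (h (tensor₂ B.ξ fun i j => S i j k)) (B.ξ k)) z) =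
      ∑ i, ∑ j, ∑ k, S i j k *
        ∑ l, B.ξ.coord l (h (B.ξ i ⊗ₜ B.ξ j)) * B.delta z l k := by
    have : ∀ k, kronecker U 1 (cup (h (tensor₂ B.ξ fun i j => S i j k)) (B.ξ k)) z =
        ∑ i, ∑ j, S i j k * ∑ l, B.ξ.coord l (h (B.ξ i ⊗ₜ B.ξ j)) * B.delta z l k := by
      intro k
      rw [B.kronecker_cup_right]
      simp only [e, Finset.sum_mul, Finset.mul_sum, ← mul_assoc]
      rw [Finset.sum_comm]
      exact Finset.sum_congr rfl fun i _ => Finset.sum_comm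
    simp only [this]
    rw [Finset.sum_comm]
    exact Finset.sum_congr rfl fun i _ => Finset.sum_comm
  have e2 : ∀ i, kronecker U 1 (cup (B.ξ i) (h (tensor₂ B.ξ (S i)))) z =
      ∑ j, ∑ k, S i j k * ∑ l, B.ξ.coord l (h (B.ξ j ⊗ₜ B.ξ k)) * B.delta z i l := by
    intro i
    rw [B.kronecker_cup_left]
    simp only [e, Finset.sum_mul, Finset.mul_sum, ← mul_assoc]
    rw [Finset.sum_comm]
    exact Finset.sum_congr rfl fun i _ => Finset.sum_comm
  simp only [e1, e2, pair₃, MagnusGroup.derive, Finset.sum_add_distrib, mul_add]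

theorem assoc_symm_tensor₃ {M : Type*} [AddCommGroup M] [Module ℤ M]
    (ξ : Module.Basis (Fin n) ℤ M) (S : Fin n → Fin n → Fin n → ℤ) :
    (TensorProduct.assoc ℤ M M M).symm (tensor₃ ξ S) =
      ∑ k, tensor₂ ξ (fun i j => S i j k) ⊗ₜ[ℤ] ξ k := by
  rw [tensor₃_eq_left, LinearEquiv.symm_apply_eq, map_sum]

theorem Frame.kronecker_muBar_map
    (h : CohomologyOne U ⊗[ℤ] CohomologyOne U →ₗ[ℤ] CohomologyOne U)
    (S : Fin n → Fin n → Fin n → ℤ) (z : HomologyTwo U) :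
    kronecker U 1 (muBar U (TensorProduct.map LinearMap.id h (tensor₃ B.ξ S)) +
      muBar U (TensorProduct.map h LinearMap.id
        ((TensorProduct.assoc ℤ _ _ _).symm (tensor₃ B.ξ S)))) z =
    pair₃ S (MagnusGroup.derive (fun l j k => B.ξ.coord l (h (B.ξ j ⊗ₜ B.ξ k))) (B.delta z)) := by
  rw [assoc_symm_tensor₃, tensor₃_eq_right, ← B.sum_kronecker_cup]
  simp only [map_sum, TensorProduct.map_tmul, map_add, LinearMap.add_apply, LinearMap.sum_apply]
  rw [add_comm]
  rfl

/-- The tensor `S` with `p t = ∑ S_{ijk} ξᵢ ⊗ ξⱼ ⊗ ξₖ`. -/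
def Frame.tensorOf (t : CohomologyOne U ⊗[ℤ] (⋀[ℤ]^2 (CohomologyOne U))) :
    Fin n → Fin n → Fin n → ℤ :=
  symLift fun i j k => alphaCoord B.ξ i j k t

theorem Frame.kills_tensorOf (w : U) (t : QBar3 U) : (B.isMarked w).Kills (B.tensorOf t.1) :=
  (B.killsBrackets_of_mem w t.2).kills

theorem Frame.pMap_mem (w : U) (t : QBar3 U) : pMap B.ξ t.1 ∈ Q3 U := by
  rw [pMap_eq]
  exact B.tensor₃_mem w (B.kills_tensorOf w t)

theorem map_inclRight {M N : Type*} [AddCommGroup M] [Module ℤ M] [AddCommGroup N] [Module ℤ N]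
    {R : Submodule ℤ (M ⊗[ℤ] M)} (f : M →ₗ[ℤ] N) (h : M ⊗[ℤ] M →ₗ[ℤ] N) (b : M ⊗[ℤ] R) :
    TensorProduct.map f (h ∘ₗ R.subtype) b = TensorProduct.map f h (inclRight R b) := by
  rw [inclRight, ← LinearMap.comp_apply, ← TensorProduct.map_comp, LinearMap.comp_id]

theorem map_inclLeft {M N : Type*} [AddCommGroup M] [Module ℤ M] [AddCommGroup N] [Module ℤ N]
    {R : Submodule ℤ (M ⊗[ℤ] M)} (f : M →ₗ[ℤ] N) (h : M ⊗[ℤ] M →ₗ[ℤ] N) (a : R ⊗[ℤ] M) :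
    TensorProduct.map (h ∘ₗ R.subtype) f a =
      TensorProduct.map h f ((TensorProduct.assoc ℤ M M M).symm (inclLeft R a)) := by
  rw [inclLeft, LinearMap.comp_apply, LinearEquiv.coe_coe, LinearEquiv.symm_apply_apply,
    ← LinearMap.comp_apply, ← TensorProduct.map_comp, LinearMap.comp_id]

theorem Frame.kronecker_muBar_incl {g : R2 U →ₗ[ℤ] CohomologyOne U}
    {h : CohomologyOne U ⊗[ℤ] CohomologyOne U →ₗ[ℤ] CohomologyOne U}
    (hh : ∀ r : R2 U, h r.1 = g r) {a : R2 U ⊗[ℤ] CohomologyOne U}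
    {b : CohomologyOne U ⊗[ℤ] R2 U} {S : Fin n → Fin n → Fin n → ℤ}
    (ha : inclLeft (R2 U) a = tensor₃ B.ξ S) (hb : inclRight (R2 U) b = tensor₃ B.ξ S)
    (z : HomologyTwo U) :
    kronecker U 1 (muBar U (TensorProduct.map LinearMap.id g b) +
      muBar U (TensorProduct.map g LinearMap.id a)) z =
    pair₃ S (MagnusGroup.derive (fun l j k => B.ξ.coord l (h (B.ξ j ⊗ₜ B.ξ k))) (B.delta z)) := by
  obtain rfl : g = h ∘ₗ (R2 U).subtype := LinearMap.ext fun r => (hh r).symm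
  have e1 := map_inclRight LinearMap.id h b
  have e2 := map_inclLeft LinearMap.id h a
  rw [hb] at e1
  rw [ha] at e2
  rw [e1, e2]
  exact B.kronecker_muBar_map h S z

theorem Frame.eval_isDelta
    {g : RBar2 U →ₗ[ℤ] CohomologyOne U} {D : QBar3 U →ₗ[ℤ] CohomologyTwo U}
    (hD : IsDelta B.ξ g D) {h : CohomologyOne U ⊗[ℤ] CohomologyOne U →ₗ[ℤ] CohomologyOne U}
    (hh : ∀ r : R2 U, h r.1 = g (etaR U r)) (t : QBar3 U) (z : HomologyTwo U) :
    kronecker U 1 (D t) z = pair₃ (B.tensorOf t.1)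
      (MagnusGroup.derive (fun l j k => B.ξ.coord l (h (B.ξ j ⊗ₜ B.ξ k))) (B.delta z)) := by
  obtain ⟨a, b, ha, hb, hab⟩ := hD t
  have hp : pMap B.ξ t.1 = tensor₃ B.ξ (B.tensorOf t.1) := pMap_eq B.ξ t.1
  exact (congrArg (fun y => kronecker U 1 y z) hab).trans
    (B.kronecker_muBar_incl (g := g ∘ₗ etaR U) hh (ha.trans hp) (hb.trans hp) z)

/-- The cochain `μ((ν ⊗ κ + κ ⊗ ν)(q))` for the standard choice of `ν`. -/
def Frame.lamCochain (τ : ∀ x, Path w x) (κ : CohomologyOne U →ₗ[ℤ] Cocycles U 0) :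
    CohomologyOne U ⊗[ℤ] (CohomologyOne U ⊗[ℤ] CohomologyOne U) →ₗ[ℤ] Cochain U 2 :=
  cupCochain U ∘ₗ TensorProduct.map (B.nuHat τ) ((Cocycles U 0).subtype ∘ₗ κ) ∘ₗ
      (TensorProduct.assoc ℤ _ _ _).symm.toLinearMap +
    cupCochain U ∘ₗ TensorProduct.map ((Cocycles U 0).subtype ∘ₗ κ) (B.nuHat τ)

theorem Frame.lamCochain_apply (τ : ∀ x, Path w x) {κ : CohomologyOne U →ₗ[ℤ] Cocycles U 0}
    (hκ : ∀ i a, (κ (B.ξ i)).1 (chainOf a) = B.mark w (edgeClass τ a) i)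
    (S : Fin n → Fin n → Fin n → ℤ) (c : Chain U 2) :
    B.lamCochain τ κ (tensor₃ B.ξ S) c =
      -barEval ((B.isMarked w).obstr S) (singToBar τ c) := by
  rw [barEval_singToBar, ← LinearMap.neg_apply]
  refine LinearMap.congr_fun (cochain_ext fun σ => ?_) c
  rw [LinearMap.neg_apply, cochainOf_chainOf, Frame.lamCochain, LinearMap.add_apply]
  simp only [LinearMap.comp_apply, LinearEquiv.coe_coe]
  rw [assoc_symm_tensor₃, tensor₃_eq_right]
  simp only [map_sum, TensorProduct.map_tmul, LinearMap.add_apply, LinearMap.sum_apply,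
    cupCochain_chainOf, B.nuHat_chainOf, LinearMap.comp_apply, Submodule.subtype_apply, hκ,
    tcoord₂_tensor₂]
  rw [IsMarked.obstr, pair₃]
  simp only [cross, mul_add, Finset.sum_add_distrib, neg_add]
  rw [add_comm]
  congr 1
  · rw [← Finset.sum_neg_distrib]
    refine Finset.sum_congr rfl fun i _ => ?_
    simp only [mul_neg, Finset.mul_sum]
    refine congrArg Neg.neg (Finset.sum_congr rfl fun j _ => Finset.sum_congr rfl fun k _ => ?_)
    ring
  · simp only [neg_mul, Finset.sum_neg_distrib, Finset.sum_mul]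
    refine congrArg Neg.neg ?_
    rw [Finset.sum_comm]
    refine Finset.sum_congr rfl fun i _ => ?_
    rw [Finset.sum_comm]
    refine Finset.sum_congr rfl fun j _ => Finset.sum_congr rfl fun k _ => ?_
    ring

/-- The values of a representative of the Massey class, in terms of cubic Magnus coefficients. -/
def Frame.Represents (w : U) (L : QBar3 U →ₗ[ℤ] CohomologyTwo U)
    (C : Fin n → Fin n → Fin n → ℤ) : Prop :=
  ∀ (t : QBar3 U) (z : HomologyTwo U), ∀ r ∈ relSub (B.gens w) 3, (magnus r).deg₂ = B.delta z →
    kronecker U 1 (L t) z = -pair₃ (B.tensorOf t.1) (magnus r).deg₃ +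
      pair₃ (B.tensorOf t.1) (MagnusGroup.derive C (B.delta z))

/-- The increasing half of an element of `R̄²`, as an element of `R²`. -/
def Frame.halfR : RBar2 U →ₗ[ℤ] R2 U where
  toFun r := ⟨halfTensor B.ξ r.1, by
    change muBar U _ = 0
    rw [← muBarBar_eta₂, eta₂_halfTensor]
    exact r.2⟩
  map_add' r s := Subtype.ext (by
    change halfTensor B.ξ (r.1 + s.1) = halfTensor B.ξ r.1 + halfTensor B.ξ s.1
    simp only [halfTensor, tensor₂, ← Finset.sum_add_distrib, ← add_smul, map_add]
    refine Finset.sum_congr rfl fun i _ => Finset.sum_congr rfl fun j _ => ?_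
    split_ifs <;> simp)
  map_smul' c r := Subtype.ext (by
    change halfTensor B.ξ (c • r.1) = c • halfTensor B.ξ r.1
    simp only [halfTensor, tensor₂, Finset.smul_sum, smul_smul, map_smul]
    refine Finset.sum_congr rfl fun i _ => Finset.sum_congr rfl fun j _ => ?_
    split_ifs <;> simp)

theorem Frame.mul_self_mem (i : Fin n) : B.ξ i ⊗ₜ B.ξ i ∈ R2 U := cup_self (B.ξ i)

theorem Frame.mul_symm_mem (i j : Fin n) : B.ξ i ⊗ₜ B.ξ j + B.ξ j ⊗ₜ B.ξ i ∈ R2 U := by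
  change muBar U _ = 0
  rw [← muBarBar_eta₂, map_add, eta₂_swap (B.ξ i), add_neg_cancel, map_zero]

theorem eq_sum_of_symmetric {M : Type*} [AddCommGroup M] [Module ℤ M]
    (ξ : Module.Basis (Fin n) ℤ M) (t : M ⊗[ℤ] M)
    (hs : ∀ i j, tcoord₂ ξ j i t = tcoord₂ ξ i j t) :
    t = ∑ i, ∑ j, (if i = j then tcoord₂ ξ i i t • (ξ i ⊗ₜ[ℤ] ξ i) else
      if i < j then tcoord₂ ξ i j t • (ξ i ⊗ₜ[ℤ] ξ j + ξ j ⊗ₜ[ℤ] ξ i) else 0) := by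
  have e1 : ∀ i j, tcoord₂ ξ i j t • (ξ i ⊗ₜ[ℤ] ξ j) =
      (if i = j then tcoord₂ ξ i i t • (ξ i ⊗ₜ[ℤ] ξ i) else
        if i < j then tcoord₂ ξ i j t • (ξ i ⊗ₜ[ℤ] ξ j) else 0) +
      (if j < i then tcoord₂ ξ i j t • (ξ i ⊗ₜ[ℤ] ξ j) else 0) := by
    intro i j
    rcases lt_trichotomy i j with h | rfl | h
    · rw [if_neg h.ne, if_pos h, if_neg h.not_gt, add_zero]
    · rw [if_pos rfl, if_neg (lt_irrefl _), add_zero]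
    · rw [if_neg h.ne', if_neg h.not_gt, if_pos h, zero_add]
  refine (sum_tcoord₂ ξ t).trans ?_
  refine (Finset.sum_congr rfl fun i _ => Finset.sum_congr rfl fun j _ => e1 i j).trans ?_
  simp only [Finset.sum_add_distrib]
  rw [Finset.sum_comm (f := fun i j => if j < i then
    tcoord₂ ξ i j t • (ξ i ⊗ₜ[ℤ] ξ j) else 0)]
  simp only [← Finset.sum_add_distrib]
  refine Finset.sum_congr rfl fun i _ => Finset.sum_congr rfl fun j _ => ?_
  rcases lt_trichotomy i j with h | rfl | h
  · rw [if_neg h.ne, if_pos h, if_pos h, if_neg h.ne, if_pos h, hs i j, smul_add]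
  · rw [if_pos rfl, if_neg (lt_irrefl _), if_pos rfl, add_zero]
  · rw [if_neg h.ne', if_neg h.not_gt, if_neg h.not_gt, if_neg h.ne', if_neg h.not_gt, add_zero]

/-- An additive map on `R²` killing the normalized elements factors through `η₂`. -/
theorem Frame.eq_zero_of_eta₂ {N : Type*} [AddCommGroup N] [Module ℤ N] (ρ : R2 U →ₗ[ℤ] N)
    (h₁ : ∀ i, ρ ⟨_, B.mul_self_mem i⟩ = 0) (h₂ : ∀ i j, i ≠ j → ρ ⟨_, B.mul_symm_mem i j⟩ = 0)
    (r : R2 U) (hr : eta₂ _ r.1 = 0) : ρ r = 0 := by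
  have hs : ∀ i j, tcoord₂ B.ξ j i r.1 = tcoord₂ B.ξ i j r.1 := fun i j => by
    have := wedgeCoord_eta₂ B.ξ j i r.1
    rw [hr, map_zero] at this
    linarith
  have e := eq_sum_of_symmetric B.ξ r.1 hs
  have hmem : r.1 ∈ (LinearMap.ker ρ).map (R2 U).subtype := by
    rw [e]
    refine Submodule.sum_mem _ fun i _ => Submodule.sum_mem _ fun j _ => ?_
    split_ifs with h h'
    · exact Submodule.smul_mem _ _ ⟨⟨_, B.mul_self_mem i⟩, h₁ i, rfl⟩
    · exact Submodule.smul_mem _ _ ⟨⟨_, B.mul_symm_mem i j⟩, h₂ i j h, rfl⟩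
    · exact Submodule.zero_mem _
  obtain ⟨r', h0, h1⟩ := hmem
  obtain rfl : r' = r := Subtype.ext h1
  exact h0

end Evaluation

/-! ### Representatives of the Massey class -/

section Representatives

attribute [local instance 10] ZSMul.toSMul instMulActionIntOfSubtractionMonoid
  AddGroup.intSMulWithZero instSMulWithZeroInt AddSubgroupClass.instZSMul

variable {U : Type u} [TopologicalSpace U]

/-- The class of a 1-cocycle in `H^1(U)`. -/
abbrev classOne : Cocycles U 0 →ₗ[ℤ] CohomologyOne U := Submodule.mkQ _

theorem cupCochain_map_cycle {A A' : Type*} [AddCommGroup A] [Module ℤ A] [AddCommGroup A']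
    [Module ℤ A'] (f : A →ₗ[ℤ] Cocycles U 0) (g : A' →ₗ[ℤ] Cocycles U 0) (a : A ⊗[ℤ] A')
    (c : Cycles U 1) :
    cupCochain U (TensorProduct.map ((Cocycles U 0).subtype ∘ₗ f) ((Cocycles U 0).subtype ∘ₗ g) a)
      c.1 =
    kronecker U 1 (muBar U (TensorProduct.map (classOne ∘ₗ f) (classOne ∘ₗ g) a))
      (Submodule.Quotient.mk c) := by
  induction a with
  | zero => simp only [map_zero, LinearMap.zero_apply]
  | add x y hx hy => simp only [map_add, LinearMap.add_apply, hx, hy]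
  | tmul x y => rfl

theorem apply_eq_add_apply_sub {A A' Q : Type*} [AddCommGroup A] [Module ℤ A] [AddCommGroup A']
    [Module ℤ A'] [AddCommGroup Q] [Module ℤ Q] (k : A →ₗ[ℤ] A' →ₗ[ℤ] ℤ) (L L₀ : Q →ₗ[ℤ] A)
    (t : Q) (z : A') : k (L t) z = k (L₀ t) z + k ((L - L₀) t) z := by
  rw [← LinearMap.add_apply, ← map_add, LinearMap.sub_apply, add_sub_cancel]

theorem map_add_add_map_add {A A' N : Type*} [AddCommGroup A] [Module ℤ A] [AddCommGroup A']
    [Module ℤ A'] [AddCommGroup N] [Module ℤ N] {P : Type*} [AddCommGroup P] [Module ℤ P]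
    (m : N ⊗[ℤ] N →ₗ[ℤ] P →ₗ[ℤ] ℤ)
    (ν ρ : A →ₗ[ℤ] N) (k : A' →ₗ[ℤ] N) (a : A ⊗[ℤ] A') (b : A' ⊗[ℤ] A) (c : P) :
    (m (TensorProduct.map (ν + ρ) k a) + m (TensorProduct.map k (ν + ρ) b)) c =
      (m (TensorProduct.map ν k a) c + m (TensorProduct.map k ν b) c) +
      (m (TensorProduct.map k ρ b) c + m (TensorProduct.map ρ k a) c) := by
  rw [TensorProduct.map_add_left, TensorProduct.map_add_right]
  simp only [LinearMap.add_apply, map_add]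
  abel

variable [PathConnectedSpace U] {n : ℕ} (B : Frame U n) {w : U}

theorem Frame.eval_isLambdaBar (hinj : Function.Injective (comultBar w)) {τ : ∀ x, Path w x}
    (hτ : τ w = Path.refl w) {κ : CohomologyOne U →ₗ[ℤ] Cocycles U 0}
    (hs : ∀ x, (Submodule.Quotient.mk (κ x) : CohomologyOne U) = x)
    (hκ : ∀ i a, (κ (B.ξ i)).1 (chainOf a) = B.mark w (edgeClass τ a) i)
    {ν : R2 U →ₗ[ℤ] Cochain U 1} {ρ : R2 U →ₗ[ℤ] Cocycles U 0}
    (hν : ν = B.nuHat τ ∘ₗ (R2 U).subtype + (Cocycles U 0).subtype ∘ₗ ρ)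
    {h : CohomologyOne U ⊗[ℤ] CohomologyOne U →ₗ[ℤ] CohomologyOne U}
    (hh : ∀ r : R2 U, h r.1 = classOne (ρ r)) {lam : Q3 U →ₗ[ℤ] CohomologyTwo U}
    (hlam : IsLambdaBar κ ν lam) {S : Fin n → Fin n → Fin n → ℤ} (hS : (B.isMarked w).Kills S)
    (q : Q3 U) (hq : q.1 = tensor₃ B.ξ S) (z : HomologyTwo U) {r : FreeGroup (Fin n)}
    (hr : r ∈ relSub (B.gens w) 3) (hz : (magnus r).deg₂ = B.delta z) :
    kronecker U 1 (lam q) z = -pair₃ S (magnus r).deg₃ + pair₃ S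
      (MagnusGroup.derive (fun l j k => B.ξ.coord l (h (B.ξ j ⊗ₜ B.ξ k))) (B.delta z)) := by
  subst hν
  obtain ⟨c, rfl⟩ := Submodule.Quotient.mk_surjective _ z
  have hid : classOne ∘ₗ κ = LinearMap.id := LinearMap.ext hs
  have ha := B.inclLeft_leftPart w hS
  have hb := B.inclRight_rightPart w hS
  generalize (∑ k, B.leftPart w hS k ⊗ₜ[ℤ] B.ξ k : R2 U ⊗[ℤ] CohomologyOne U) = a at ha
  generalize (∑ i, B.ξ i ⊗ₜ[ℤ] B.rightPart w hS i : CohomologyOne U ⊗[ℤ] R2 U) = b at hb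
  obtain ⟨z', h1, h2⟩ := hlam q a b (ha.trans hq.symm) (hb.trans hq.symm)
  have e1 := cupCochain_map_cycle (A := R2 U) ρ κ a c
  have e2 := cupCochain_map_cycle (A' := R2 U) κ ρ b c
  rw [hid] at e1 e2
  have e3 := B.kronecker_muBar_incl (g := classOne ∘ₗ ρ) hh ha hb (Submodule.Quotient.mk c)
  have e4 := B.lamCochain_apply τ hκ S c.1
  rw [B.barEval_obstr hinj hτ hS hr c hz.symm] at e4
  have e5 := map_inclLeft ((Cocycles U 0).subtype ∘ₗ κ) (B.nuHat τ) a
  have e6 := map_inclRight ((Cocycles U 0).subtype ∘ₗ κ) (B.nuHat τ) b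
  rw [ha] at e5
  rw [hb] at e6
  have e7 := map_add_add_map_add (A := R2 U) (cupCochain U) (B.nuHat τ ∘ₗ (R2 U).subtype)
    ((Cocycles U 0).subtype ∘ₗ ρ) ((Cocycles U 0).subtype ∘ₗ κ) a b c.1
  have e8 := (congrArg₂ (· + ·) e2 e1).trans ((LinearMap.map_add₂ (kronecker U 1) _ _ _).symm.trans e3)
  have e9 := (congrArg₂ (· + ·) (congrArg (fun y => cupCochain U y c.1) e5)
    (congrArg (fun y => cupCochain U y c.1) e6)).trans e4
  have e10 := (congrArg (fun y : Cochain U 2 => y c.1) h2).trans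
    (e7.trans (congrArg₂ (· + ·) e9 e8))
  exact (congrArg (fun y => kronecker U 1 y (Submodule.Quotient.mk c)) h1).trans e10

end Representatives

section Representatives

attribute [local instance 10] ZSMul.toSMul instMulActionIntOfSubtractionMonoid
  AddGroup.intSMulWithZero instSMulWithZeroInt AddSubgroupClass.instZSMul

variable {U : Type u} [TopologicalSpace U] [PathConnectedSpace U] {n : ℕ} (B : Frame U n) {w : U}

/-- A normalized `ν` differs from the standard one by a map to cocycles. -/
theorem Frame.exists_cocycle_correction {τ : ∀ x, Path w x}
    {κ : CohomologyOne U →ₗ[ℤ] Cocycles U 0} {ν : R2 U →ₗ[ℤ] Cochain U 1}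
    (hadm : IsAdmissible B.ξ κ ν)
    (hκ : ∀ i a, (κ (B.ξ i)).1 (chainOf a) = B.mark w (edgeClass τ a) i) :
    ∃ ρ : R2 U →ₗ[ℤ] Cocycles U 0,
      ν = B.nuHat τ ∘ₗ (R2 U).subtype + (Cocycles U 0).subtype ∘ₗ ρ ∧
      (∀ i, ρ ⟨_, B.mul_self_mem i⟩ = 0) ∧ ∀ i j, i ≠ j → ρ ⟨_, B.mul_symm_mem i j⟩ = 0 := by
  have hmem : ∀ r, (ν - B.nuHat τ ∘ₗ (R2 U).subtype) r ∈ Cocycles U 0 := fun r => by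
    have h := (hadm.cobdry_ν r).symm.trans (B.cobdry_nuHat hκ r)
    exact (LinearMap.map_sub (cobdry U 1) _ _).trans (sub_eq_zero.mpr h)
  refine ⟨LinearMap.codRestrict (Cocycles U 0) _ hmem,
    LinearMap.ext fun r => (add_sub_cancel _ _).symm, fun i => Subtype.ext (sub_eq_zero.mpr
        ((hadm.ν_diag i _ rfl).trans (B.nuHat_diag hκ i).symm)), fun i j hij =>
    Subtype.ext (sub_eq_zero.mpr
        ((hadm.ν_symm i j _ hij rfl).trans (B.nuHat_symm hκ hij).symm))⟩

theorem apply_eq_of_sub {M N : Type*} [AddCommGroup M] [Module ℤ M] [AddCommGroup N] [Module ℤ N]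
    {P : Submodule ℤ M} (ρ : P →ₗ[ℤ] N) {x y : P} (h : ρ (x - y) = 0) : ρ x = ρ y := by
  rw [map_sub] at h
  exact sub_eq_zero.mp h

theorem Frame.apply_halfR {N : Type*} [AddCommGroup N] [Module ℤ N] {ρ : R2 U →ₗ[ℤ] N}
    (h₁ : ∀ i, ρ ⟨_, B.mul_self_mem i⟩ = 0) (h₂ : ∀ i j, i ≠ j → ρ ⟨_, B.mul_symm_mem i j⟩ = 0)
    (r : R2 U) : ρ (B.halfR (etaR U r)) = ρ r := by
  have := B.eq_zero_of_eta₂ ρ h₁ h₂ (B.halfR (etaR U r) - r) ((map_sub (eta₂ _) _ _).trans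
    (sub_eq_zero.mpr (eta₂_halfTensor B.ξ (eta₂ _ r.1))))
  exact apply_eq_of_sub ρ this

theorem pair₃_derive_add (S C C' : Fin n → Fin n → Fin n → ℤ) (b : Fin n → Fin n → ℤ) :
    pair₃ S (MagnusGroup.derive C b) + pair₃ S (MagnusGroup.derive C' b) =
      pair₃ S (MagnusGroup.derive (fun l j k => C l j k + C' l j k) b) := by
  rw [← pair₃_add]
  congr 1
  ext i j k
  simp only [Pi.add_apply, MagnusGroup.derive, ← Finset.sum_add_distrib]
  exact Finset.sum_congr rfl fun _ _ => by ring

/-- Representatives of the Massey class are given by alternating matrices. -/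
theorem Frame.exists_represents (hinj : Function.Injective (comultBar w))
    {L : QBar3 U →ₗ[ℤ] CohomologyTwo U} (hL : L ∈ masseyClass B.ξ) :
    ∃ C, IsAlt C ∧ B.Represents w L C := by
  obtain ⟨L₀, g, ⟨κ, ν, lam, hadm, hlam, hp⟩, hD⟩ := hL
  obtain ⟨τ, hτ, hκ⟩ := B.exists_gauge w (fun i => κ (B.ξ i)) fun i => hadm.section_κ _
  obtain ⟨ρ, hν, hρ₁, hρ₂⟩ := B.exists_cocycle_correction hadm hκ
  have hfac : ∀ r, ρ (B.halfR (etaR U r)) = ρ r := B.apply_halfR hρ₁ hρ₂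
  obtain ⟨h₁, ha₁, hh₁⟩ := B.exists_alt hinj (classOne ∘ₗ ρ ∘ₗ B.halfR)
  obtain ⟨h₂, ha₂, hh₂⟩ := B.exists_alt hinj g
  have hh₁' : ∀ r : R2 U, h₁ r.1 = classOne (ρ r) := fun r =>
    (hh₁ r).trans (congrArg classOne (hfac r))
  refine ⟨fun l j k => B.ξ.coord l (h₁ (B.ξ j ⊗ₜ B.ξ k)) + B.ξ.coord l (h₂ (B.ξ j ⊗ₜ B.ξ k)),
    ⟨fun i j => ?_, fun i j k => ?_⟩, fun t z r hr hz => ?_⟩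
  · exact (congrArg₂ (· + ·) (ha₁.self i j) (ha₂.self i j)).trans (add_zero 0)
  · exact (congrArg₂ (· + ·) (ha₁.anti i j k) (ha₂.anti i j k)).trans (neg_add _ _).symm
  obtain ⟨ht, hLt⟩ := hp t
  have e1 := B.eval_isLambdaBar hinj hτ hadm.section_κ hκ hν hh₁' hlam
    (B.kills_tensorOf w t) ⟨_, ht⟩ (pMap_eq B.ξ t.1) z hr hz
  have e2 := B.eval_isDelta hD hh₂ t z
  have e3 := apply_eq_add_apply_sub (kronecker U 1) L L₀ t z
  have e4 := (congrArg (fun y => kronecker U 1 y z) hLt).trans e1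
  exact (e3.trans (congrArg₂ (· + ·) e4 e2)).trans ((add_assoc _ _ _).trans
    (congrArg (_ + ·) (pair₃_derive_add _ _ _ _)))

end Representatives

section Representatives

attribute [local instance 10] ZSMul.toSMul instMulActionIntOfSubtractionMonoid
  AddGroup.intSMulWithZero instSMulWithZeroInt AddSubgroupClass.instZSMul

/-- The map `Λ² M → M` with given coordinates. -/
theorem exists_wedge_map {M : Type*} [AddCommGroup M] [Module ℤ M] {n : ℕ}
    (ξ : Module.Basis (Fin n) ℤ M) {C : Fin n → Fin n → Fin n → ℤ} (hC : IsAlt C) :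
    ∃ g : ⋀[ℤ]^2 M →ₗ[ℤ] M, ∀ l j k, ξ.coord l (g (eta₂ M (ξ j ⊗ₜ ξ k))) = C l j k := by
  refine ⟨∑ l, ∑ p, ∑ q, LinearMap.toSpanSingleton ℤ M ((if p < q then C l p q else 0) • ξ l) ∘ₗ
    wedgeCoord ξ p q, fun l j k => ?_⟩
  simp only [LinearMap.sum_apply, LinearMap.comp_apply, LinearMap.toSpanSingleton_apply, map_sum,
    map_smul, coord_basis, wedgeCoord_eta₂, tcoord₂_tmul, smul_eq_mul]
  simp only [mul_ite, mul_one, mul_zero, Finset.sum_ite_irrel, Finset.sum_const_zero,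
    Finset.sum_ite_eq, Finset.mem_univ, if_true]
  rw [← sum_mul_antisymm (fun p q => if q = k then if p = j then 1 else 0 else 0) (C l) (hC.anti l)]
  simp

variable {U : Type u} [TopologicalSpace U] [PathConnectedSpace U] {n : ℕ} (B : Frame U n) {w : U}

theorem Frame.exists_section (τ : ∀ x, Path w x) :
    ∃ κ : CohomologyOne U →ₗ[ℤ] Cocycles U 0,
      (∀ x, (Submodule.Quotient.mk (κ x) : CohomologyOne U) = x) ∧
      ∀ i a, (κ (B.ξ i)).1 (chainOf a) = B.mark w (edgeClass τ a) i := by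
  refine ⟨B.ξ.constr ℤ (B.edgeCocycle τ), fun x => ?_, fun i a => ?_⟩
  · have : classOne ∘ₗ B.ξ.constr ℤ (B.edgeCocycle τ) = LinearMap.id := B.ξ.ext fun i => by
      rw [LinearMap.comp_apply, Module.Basis.constr_basis]
      exact B.mk_edgeCocycle τ i
    exact LinearMap.congr_fun this x
  · rw [Module.Basis.constr_basis]
    exact cochainOf_chainOf _ _

theorem Frame.isAdmissible_nuHat {τ : ∀ x, Path w x} {κ : CohomologyOne U →ₗ[ℤ] Cocycles U 0}
    (hs : ∀ x, (Submodule.Quotient.mk (κ x) : CohomologyOne U) = x)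
    (hκ : ∀ i a, (κ (B.ξ i)).1 (chainOf a) = B.mark w (edgeClass τ a) i) :
    IsAdmissible B.ξ κ (B.nuHat τ ∘ₗ (R2 U).subtype) where
  section_κ := hs
  cobdry_ν := B.cobdry_nuHat hκ
  ν_diag i r hr := (congrArg (B.nuHat τ) hr).trans (B.nuHat_diag hκ i)
  ν_symm i j r hij hr := (congrArg (B.nuHat τ) hr).trans (B.nuHat_symm hκ hij)

theorem Frame.lamCochain_mem {τ : ∀ x, Path w x} {κ : CohomologyOne U →ₗ[ℤ] Cocycles U 0}
    (hκ : ∀ i a, (κ (B.ξ i)).1 (chainOf a) = B.mark w (edgeClass τ a) i) (q : Q3 U) :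
    B.lamCochain τ κ q.1 ∈ Cocycles U 1 := by
  refine LinearMap.ext fun c => ?_
  have e := B.lamCochain_apply τ hκ (fun i j k => tcoord₃ B.ξ i j k q.1) (bdry U 2 c)
  rw [tensor₃_tcoord₃, B.obstr_bdry τ (B.kills_of_mem w q.2), neg_zero] at e
  exact e

theorem Frame.exists_isLambdaBar {τ : ∀ x, Path w x} {κ : CohomologyOne U →ₗ[ℤ] Cocycles U 0}
    (hκ : ∀ i a, (κ (B.ξ i)).1 (chainOf a) = B.mark w (edgeClass τ a) i) :
    ∃ lam, IsLambdaBar κ (B.nuHat τ ∘ₗ (R2 U).subtype) lam := by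
  refine ⟨classTwo ∘ₗ (B.lamCochain τ κ ∘ₗ (Q3 U).subtype).codRestrict (Cocycles U 1)
    (B.lamCochain_mem hκ), fun q a b ha hb => ⟨_, rfl, ?_⟩⟩
  have e5 := map_inclLeft ((Cocycles U 0).subtype ∘ₗ κ) (B.nuHat τ) a
  have e6 := map_inclRight ((Cocycles U 0).subtype ∘ₗ κ) (B.nuHat τ) b
  rw [ha] at e5
  rw [hb] at e6
  exact (congrArg₂ (· + ·) (congrArg (cupCochain U) e5) (congrArg (cupCochain U) e6)).symm

theorem exists_muBar_eq {g : R2 U →ₗ[ℤ] CohomologyOne U}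
    {h : CohomologyOne U ⊗[ℤ] CohomologyOne U →ₗ[ℤ] CohomologyOne U}
    (hh : ∀ r : R2 U, h r.1 = g r)
    {q : CohomologyOne U ⊗[ℤ] (CohomologyOne U ⊗[ℤ] CohomologyOne U)} (hq : q ∈ Q3 U) :
    ∃ (a : R2 U ⊗[ℤ] CohomologyOne U) (b : CohomologyOne U ⊗[ℤ] R2 U),
      inclLeft (R2 U) a = q ∧ inclRight (R2 U) b = q ∧
      muBar U (TensorProduct.map LinearMap.id h q) + muBar U (TensorProduct.map h LinearMap.id
        ((TensorProduct.assoc ℤ _ _ _).symm q)) =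
      muBar U (TensorProduct.map LinearMap.id g b) +
        muBar U (TensorProduct.map g LinearMap.id a) := by
  have hg : g = h ∘ₗ (R2 U).subtype := LinearMap.ext fun r => (hh r).symm
  obtain ⟨⟨a, ha⟩, ⟨b, hb⟩⟩ := hq
  have e1 := map_inclRight LinearMap.id h b
  have e2 := map_inclLeft LinearMap.id h a
  rw [hb, ← hg] at e1
  rw [ha, ← hg] at e2
  exact ⟨a, b, ha, hb,
    (congrArg₂ (· + ·) (congrArg (muBar U) e1) (congrArg (muBar U) e2)).symm⟩

theorem Frame.exists_isDelta (w : U) (g : RBar2 U →ₗ[ℤ] CohomologyOne U)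
    {h : CohomologyOne U ⊗[ℤ] CohomologyOne U →ₗ[ℤ] CohomologyOne U}
    (hh : ∀ r : R2 U, h r.1 = g (etaR U r)) : ∃ D, IsDelta B.ξ g D :=
  ⟨(muBar U ∘ₗ TensorProduct.map LinearMap.id h +
    muBar U ∘ₗ TensorProduct.map h LinearMap.id ∘ₗ (TensorProduct.assoc ℤ _ _ _).symm.toLinearMap) ∘ₗ
    pMap B.ξ ∘ₗ (QBar3 U).subtype,
    fun t => exists_muBar_eq (g := g ∘ₗ etaR U) hh (B.pMap_mem w t)⟩

set_option maxHeartbeats 1000000 in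
/-- Every alternating matrix comes from a representative of the Massey class. -/
theorem Frame.exists_mem_masseyClass (w : U) (hinj : Function.Injective (comultBar w))
    {C : Fin n → Fin n → Fin n → ℤ} (hC : IsAlt C) :
    ∃ L ∈ masseyClass B.ξ, B.Represents w L C := by
  obtain ⟨τ, hτ⟩ := exists_based_paths w
  obtain ⟨κ, hs, hκ⟩ := B.exists_section τ
  obtain ⟨lam, hlam⟩ := B.exists_isLambdaBar hκ
  obtain ⟨g, hg⟩ := exists_wedge_map B.ξ hC
  obtain ⟨D, hD⟩ := B.exists_isDelta w (g ∘ₗ (RBar2 U).subtype) (h := g ∘ₗ eta₂ _) fun r => rfl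
  let L₀ : QBar3 U →ₗ[ℤ] CohomologyTwo U :=
    lam ∘ₗ (pMap B.ξ ∘ₗ (QBar3 U).subtype).codRestrict (Q3 U) (B.pMap_mem w)
  have hsub : L₀ + D - L₀ = D := add_sub_cancel_left L₀ D
  refine ⟨L₀ + D, ⟨L₀, g ∘ₗ (RBar2 U).subtype, ⟨κ, _, lam, B.isAdmissible_nuHat hs hκ, hlam,
    fun t => ⟨B.pMap_mem w t, rfl⟩⟩, hsub.symm ▸ hD⟩, fun t z r hr hz => ?_⟩
  have e1 := B.eval_isLambdaBar (ρ := 0) (h := 0) hinj hτ hs hκ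
    (LinearMap.ext fun r => (add_zero _).symm) (fun r => rfl) hlam
    (B.kills_tensorOf w t) ⟨_, B.pMap_mem w t⟩ (pMap_eq B.ξ t.1) z hr hz
  have e2 := B.eval_isDelta hD (h := g ∘ₗ eta₂ _) (fun r => rfl) t z
  have e3 : kronecker U 1 ((L₀ + D) t) z = kronecker U 1 (L₀ t) z + kronecker U 1 (D t) z :=
    LinearMap.map_add₂ (kronecker U 1) _ _ _
  have e4 : (fun l j k => B.ξ.coord l ((0 : CohomologyOne U ⊗[ℤ] CohomologyOne U →ₗ[ℤ]
      CohomologyOne U) (B.ξ j ⊗ₜ B.ξ k)) + B.ξ.coord l ((g ∘ₗ eta₂ _) (B.ξ j ⊗ₜ B.ξ k))) = C := by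
    funext l j k
    exact (congrArg₂ (· + ·) (LinearMap.map_zero (B.ξ.coord l)) (hg l j k)).trans
      (Int.zero_add _)
  exact (e3.trans (congrArg₂ (· + ·) e1 e2)).trans ((add_assoc _ _ _).trans
    (congrArg (_ + ·) ((pair₃_derive_add _ _ _ _).trans
      (congrArg (fun c => pair₃ (B.tensorOf t.1) (MagnusGroup.derive c (B.delta z))) e4))))

end Representatives

/-! ### Duality for brackets -/

section Brackets

open scoped commutatorElement

attribute [local instance 10] ZSMul.toSMul instMulActionIntOfSubtractionMonoid
  AddGroup.intSMulWithZero instSMulWithZeroInt AddSubgroupClass.instZSMul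

variable {n : ℕ} {M : Type*} [AddCommGroup M] [Module ℤ M]

/-- `x ⊗ y ↦ [x, y]`. -/
def bracket₂ (M : Type*) [AddCommGroup M] [Module ℤ M] : M ⊗[ℤ] M →ₗ[ℤ] M ⊗[ℤ] M :=
  LinearMap.id - (TensorProduct.comm ℤ M M).toLinearMap

/-- `x ⊗ t ↦ x ⊗ t - t ⊗ x`. -/
def bracket₁₂ (M : Type*) [AddCommGroup M] [Module ℤ M] :
    M ⊗[ℤ] (M ⊗[ℤ] M) →ₗ[ℤ] M ⊗[ℤ] (M ⊗[ℤ] M) :=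
  LinearMap.id - (TensorProduct.assoc ℤ M M M).toLinearMap ∘ₗ
    (TensorProduct.comm ℤ M (M ⊗[ℤ] M)).toLinearMap

/-- `x ⊗ y ⊗ z ↦ [x, [y, z]]`. -/
def bracket₃ (M : Type*) [AddCommGroup M] [Module ℤ M] :
    M ⊗[ℤ] (M ⊗[ℤ] M) →ₗ[ℤ] M ⊗[ℤ] (M ⊗[ℤ] M) :=
  bracket₁₂ M ∘ₗ TensorProduct.map LinearMap.id (bracket₂ M)

theorem bracket₂_tmul (x y : M) : bracket₂ M (x ⊗ₜ y) = x ⊗ₜ y - y ⊗ₜ x := rfl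

theorem bracket₁₂_tmul (x : M) (t : M ⊗[ℤ] M) :
    bracket₁₂ M (x ⊗ₜ t) = x ⊗ₜ t - TensorProduct.assoc ℤ M M M (t ⊗ₜ x) := rfl

theorem bracket₃_tmul (x : M) (t : M ⊗[ℤ] M) :
    bracket₃ M (x ⊗ₜ t) = bracket₁₂ M (x ⊗ₜ bracket₂ M t) := rfl

theorem bracket₃_tri (x y z : M) :
    bracket₃ M (tri x y z) = (tri x y z - tri x z y) - (tri y z x - tri z y x) := by
  rw [tri, bracket₃_tmul, bracket₁₂_tmul, bracket₂_tmul, TensorProduct.tmul_sub,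
    TensorProduct.sub_tmul, map_sub]
  rfl

theorem bracket₂_mem (t : M ⊗[ℤ] M) : bracket₂ M t ∈ brackets₂ M := by
  induction t with
  | zero => rw [map_zero]; exact zero_mem _
  | add x y hx hy => rw [map_add]; exact add_mem hx hy
  | tmul x y => exact Submodule.subset_span ⟨x, y, rfl⟩

theorem bracket₃_mem (t : M ⊗[ℤ] (M ⊗[ℤ] M)) : bracket₃ M t ∈ brackets₃ M := by
  induction t with
  | zero => rw [map_zero]; exact zero_mem _
  | add x y hx hy => rw [map_add]; exact add_mem hx hy
  | tmul x t =>
    induction t with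
    | zero => rw [TensorProduct.tmul_zero, map_zero]; exact zero_mem _
    | add y z hy hz => rw [TensorProduct.tmul_add, map_add]; exact add_mem hy hz
    | tmul y z => exact Submodule.subset_span ⟨x, y, z, bracket₃_tri x y z⟩

variable (e : Module.Basis (Fin n) ℤ M)

theorem linearMap_ext₃ {N : Type*} [AddCommGroup N] [Module ℤ N]
    {f g : M ⊗[ℤ] (M ⊗[ℤ] M) →ₗ[ℤ] N}
    (h : ∀ i j k, f (tri (e i) (e j) (e k)) = g (tri (e i) (e j) (e k))) : f = g := by
  refine LinearMap.ext fun t => ?_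
  rw [← tensor₃_tcoord₃ e t, tensor₃]
  simp only [map_sum, map_smul, h]

theorem ext_tcoord₂ {s t : M ⊗[ℤ] M} (h : ∀ i j, tcoord₂ e i j s = tcoord₂ e i j t) : s = t := by
  rw [← tensor₂_tcoord₂ e s, ← tensor₂_tcoord₂ e t]
  simp only [h]

theorem ext_tcoord₃ {s t : M ⊗[ℤ] (M ⊗[ℤ] M)}
    (h : ∀ i j k, tcoord₃ e i j k s = tcoord₃ e i j k t) : s = t := by
  rw [← tensor₃_tcoord₃ e s, ← tensor₃_tcoord₃ e t]
  simp only [h]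

theorem tcoord₂_bracket₂ (t : M ⊗[ℤ] M) (i j : Fin n) :
    tcoord₂ e i j (bracket₂ M t) = tcoord₂ e i j t - tcoord₂ e j i t := by
  suffices H : tcoord₂ e i j ∘ₗ bracket₂ M = tcoord₂ e i j - tcoord₂ e j i from
    LinearMap.congr_fun H t
  refine TensorProduct.ext' fun x y => ?_
  rw [LinearMap.comp_apply, bracket₂_tmul, map_sub, LinearMap.sub_apply, tcoord₂_tmul,
    tcoord₂_tmul, tcoord₂_tmul, mul_comm (e.coord i y)]

theorem bracket₂_half {b : Fin n → Fin n → ℤ} (hb : ∀ i j, b j i = -b i j) :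
    bracket₂ M (tensor₂ e fun j k => if j < k then b j k else 0) = tensor₂ e b := by
  refine ext_tcoord₂ e fun i j => ?_
  rw [tcoord₂_bracket₂, tcoord₂_tensor₂, tcoord₂_tensor₂, tcoord₂_tensor₂]
  rcases lt_trichotomy i j with h | rfl | h
  · simp [h, h.not_gt]
  · have := hb i i
    simp only [lt_irrefl, if_false]
    omega
  · simp [h, h.not_gt, hb j i]

/-- Degree-`3` coefficients of an element of `γ₃` form a Lie element. -/
theorem exists_bracket₃_eq {y : FreeGroup (Fin n)}
    (hy : y ∈ (⊤ : Subgroup (FreeGroup (Fin n))).lowerCentralSeries 2) :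
    ∃ t, bracket₃ M t = tensor₃ e (magnus y).deg₃ := by
  have hadd : ∀ c c' : Fin n → Fin n → Fin n → ℤ, tensor₃ e (c + c') = tensor₃ e c + tensor₃ e c' :=
    fun c c' => ext_tcoord₃ e fun i j k => by
      rw [map_add, tcoord₃_tensor₃, tcoord₃_tensor₃, tcoord₃_tensor₃]; rfl
  have hneg : ∀ c : Fin n → Fin n → Fin n → ℤ, tensor₃ e (-c) = -tensor₃ e c :=
    fun c => ext_tcoord₃ e fun i j k => by
      rw [map_neg, tcoord₃_tensor₃, tcoord₃_tensor₃]; rfl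
  induction hy using Subgroup.closure_induction with
  | mem y hy =>
    obtain ⟨a, ha, b, -, rfl⟩ := hy
    have h1 := deg₁_of_mem_lowerCentralSeries le_rfl ha
    have : (magnus ⁅a, b⁆).deg₃ = -(fun i j k => (magnus b).deg₁ i * (magnus a).deg₂ j k -
        (magnus a).deg₂ i j * (magnus b).deg₁ k) := by
      ext i j k
      rw [← commutatorElement_inv, map_inv, map_commutatorElement, MagnusGroup.inv_deg₃,
        MagnusGroup.commutator_deg₃ _ _ h1]
      simp [MagnusGroup.commutator_deg₁]
    rw [this, hneg]
    refine ⟨-((∑ i, (magnus b).deg₁ i • e i) ⊗ₜ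
      tensor₂ e fun j k => if j < k then (magnus a).deg₂ j k else 0), ?_⟩
    rw [map_neg, bracket₃_tmul, bracket₂_half e (deg₂_antisymm h1), bracket₁₂_tmul]
    refine congrArg Neg.neg (ext_tcoord₃ e fun i j k => ?_)
    rw [map_sub, tcoord₃_tmul, tcoord₃_assoc, tcoord₃_tensor₃, tcoord₂_tensor₂, tcoord₂_tensor₂]
    simp only [map_sum, map_smul, coord_basis, smul_eq_mul, mul_ite, mul_one, mul_zero,
      Finset.sum_ite_eq, Finset.mem_univ, if_true]
  | one => exact ⟨0, by
      rw [map_zero]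
      exact (ext_tcoord₃ e fun i j k => by rw [tcoord₃_tensor₃]; simp)⟩
  | mul y z hy _ ihy ihz =>
    have h1 := deg₁_of_mem_lowerCentralSeries (k := 2) (by norm_num) hy
    have h2 := deg₂_of_mem_gamma_three hy
    have : (magnus (y * z)).deg₃ = (magnus y).deg₃ + (magnus z).deg₃ := by
      ext i j k; simp [h1, h2]
    obtain ⟨s, hs⟩ := ihy
    obtain ⟨t, ht⟩ := ihz
    exact ⟨s + t, by rw [this, map_add, hs, ht, hadd]⟩
  | inv y hy ihy =>
    have h1 := deg₁_of_mem_lowerCentralSeries (k := 2) (by norm_num) hy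
    have h2 := deg₂_of_mem_gamma_three hy
    have : (magnus y⁻¹).deg₃ = -(magnus y).deg₃ := by
      ext i j k; simp [h1]
    obtain ⟨s, hs⟩ := ihy
    exact ⟨-s, by rw [this, map_neg, hs, hneg]⟩

/-- The pairing of a bracket-like form with a Lie element. -/
theorem pair₃_symLift_bracket₃ {T : Fin n → Fin n → Fin n → ℤ} (hT : IsBracketLike T)
    {F : M ⊗[ℤ] (M ⊗[ℤ] M) →ₗ[ℤ] ℤ} (hF : ∀ i j k, F (tri (e i) (e j) (e k)) = T i j k)
    (t : M ⊗[ℤ] (M ⊗[ℤ] M)) :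
    pair₃ (symLift T) (fun i j k => tcoord₃ e i j k (bracket₃ M t)) = F t := by
  let Φ : M ⊗[ℤ] (M ⊗[ℤ] M) →ₗ[ℤ] ℤ := ∑ i, ∑ j, ∑ k, symLift T i j k • tcoord₃ e i j k
  have hΦ : ∀ c, Φ (tensor₃ e c) = pair₃ (symLift T) c := fun c => by
    simp only [Φ, LinearMap.sum_apply, LinearMap.smul_apply, tcoord₃_tensor₃, smul_eq_mul, pair₃]
  have hΦ' : ∀ i j k, Φ (tri (e i) (e j) (e k)) = symLift T i j k := fun i j k => by
    simp only [Φ, LinearMap.sum_apply, LinearMap.smul_apply, tri, tcoord₃_tmul, tcoord₂_tmul,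
      coord_basis, smul_eq_mul]
    rw [Finset.sum_eq_single i (fun b _ hb => by simp [hb]) (by simp),
      Finset.sum_eq_single j (fun b _ hb => by simp [hb]) (by simp),
      Finset.sum_eq_single k (fun b _ hb => by simp [hb]) (by simp)]
    simp
  rw [← hΦ, tensor₃_tcoord₃]
  refine LinearMap.congr_fun (f := Φ ∘ₗ bracket₃ M) (linearMap_ext₃ e fun i j k => ?_) t
  rw [LinearMap.comp_apply, bracket₃_tri, map_sub, map_sub, map_sub, hΦ', hΦ', hΦ', hΦ', hF,
    hT.symLift_sub, symLift_symm T k j i, sub_self, sub_zero]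

theorem map_tensor₂_half {N : Type*} [AddCommGroup N] [Module ℤ N] (F : M ⊗[ℤ] M →ₗ[ℤ] N)
    (b : Fin n → Fin n → ℤ) :
    F (tensor₂ e fun j k => if j < k then b j k else 0) =
      ∑ j, ∑ k, if j < k then b j k • F (e j ⊗ₜ e k) else 0 := by
  simp only [tensor₂, map_sum, map_smul, ite_smul, zero_smul, apply_ite F, map_zero]

/-- If the Lie elements modulo `K ⊗ M + M ⊗ K` form a free group, they are detected by
bracket-like forms. -/
theorem mem_of_symLift {K : Submodule ℤ (M ⊗[ℤ] M)}
    (hK : ∀ A ∈ K, ∀ i j, tcoord₂ e j i A = -tcoord₂ e i j A)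
    [hfree : Module.Free ℤ ((brackets₃ M).map (Submodule.mkQ
      (LinearMap.range (inclLeft K) ⊔ LinearMap.range (inclRight K))))]
    {t : M ⊗[ℤ] (M ⊗[ℤ] M)}
    (ht : ∀ T : Fin n → Fin n → Fin n → ℤ, IsBracketLike T →
      (∀ A ∈ K, ∀ i, ∑ j, ∑ k, (if j < k then T i j k * tcoord₂ e j k A else 0) = 0) →
      pair₃ (symLift T) (fun i j k => tcoord₃ e i j k (bracket₃ M t)) = 0) :
    bracket₃ M t ∈ LinearMap.range (inclLeft K) ⊔ LinearMap.range (inclRight K) := by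
  set R := LinearMap.range (inclLeft K) ⊔ LinearMap.range (inclRight K) with hR
  let D : M ⊗[ℤ] (M ⊗[ℤ] M) →ₗ[ℤ] (brackets₃ M).map (Submodule.mkQ R) :=
    (Submodule.mkQ R ∘ₗ bracket₃ M).codRestrict _ fun s => ⟨_, bracket₃_mem s, rfl⟩
  have hD : ∀ s, bracket₃ M s ∈ R → D s = 0 := fun s hs =>
    Subtype.ext ((Submodule.Quotient.mk_eq_zero R).mpr hs)
  have hD0 : D t = 0 := by
    rw [← Module.forall_dual_apply_eq_zero_iff ℤ]
    intro f
    have hz : ∀ s, bracket₃ M s = 0 → (f ∘ₗ D) s = 0 := fun s hs => by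
      rw [LinearMap.comp_apply, hD s (hs ▸ zero_mem R), map_zero]
    have hT : IsBracketLike fun i j k => (f ∘ₗ D) (tri (e i) (e j) (e k)) := by
      refine ⟨fun i j => hz _ ?_, fun i j k => ?_, fun i j k => ?_⟩
      · rw [bracket₃_tri]; abel
      · rw [eq_neg_iff_add_eq_zero, ← map_add]
        refine hz _ ?_
        rw [map_add, bracket₃_tri, bracket₃_tri]; abel
      · rw [← map_add, ← map_add]
        refine hz _ ?_
        rw [map_add, map_add, bracket₃_tri, bracket₃_tri, bracket₃_tri]; abel
    refine (pair₃_symLift_bracket₃ e hT (F := f ∘ₗ D) (fun i j k => rfl) t).symm.trans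
      (ht _ hT fun A hA i => ?_)
    have e1 := map_tensor₂_half e ((f ∘ₗ D) ∘ₗ TensorProduct.mk ℤ M (M ⊗[ℤ] M) (e i))
      fun j k => tcoord₂ e j k A
    have e2 : D (e i ⊗ₜ tensor₂ e fun j k => if j < k then tcoord₂ e j k A else 0) = 0 := by
      refine hD _ ?_
      rw [bracket₃_tmul, bracket₂_half e (hK A hA), tensor₂_tcoord₂, bracket₁₂_tmul]
      refine sub_mem (le_sup_right (a := LinearMap.range (inclLeft K)) ⟨e i ⊗ₜ ⟨A, hA⟩, rfl⟩)
        (le_sup_left (b := LinearMap.range (inclRight K)) ⟨⟨A, hA⟩ ⊗ₜ e i, rfl⟩)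
    rw [LinearMap.comp_apply, LinearMap.comp_apply, TensorProduct.mk_apply, e2, map_zero] at e1
    refine Eq.trans ?_ e1.symm
    refine Finset.sum_congr rfl fun j _ => Finset.sum_congr rfl fun k _ => ?_
    split_ifs
    · rw [smul_eq_mul, mul_comm]; rfl
    · rfl
  exact (Submodule.Quotient.mk_eq_zero R).mp (congrArg Subtype.val hD0)

theorem coords_mem_tensorSpan {K : Submodule ℤ (M ⊗[ℤ] M)} {K' : AddSubgroup (Fin n → Fin n → ℤ)}
    (hK : ∀ A ∈ K, (fun i j => tcoord₂ e i j A) ∈ K') {c : Fin n → Fin n → Fin n → ℤ}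
    (hc : tensor₃ e c ∈ LinearMap.range (inclLeft K) ⊔ LinearMap.range (inclRight K)) :
    c ∈ tensorSpan K' := by
  have hc' : c = fun i j k => tcoord₃ e i j k (tensor₃ e c) := by
    ext i j k; rw [tcoord₃_tensor₃]
  obtain ⟨_, ⟨a, rfl⟩, _, ⟨b, rfl⟩, h⟩ := Submodule.mem_sup.mp hc
  rw [hc', ← h]
  clear h hc hc'
  have e0 : (fun i j k => tcoord₃ e i j k (inclLeft K a + inclRight K b)) =
      (fun i j k => tcoord₃ e i j k (inclLeft K a)) + fun i j k => tcoord₃ e i j k (inclRight K b) := by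
    ext i j k; rw [map_add]; rfl
  rw [e0]
  clear e0
  refine add_mem ?_ ?_
  · induction a with
    | zero =>
      simp only [map_zero]
      exact zero_mem (tensorSpan K')
    | add x y hx hy =>
      have : (fun i j k => tcoord₃ e i j k (inclLeft K (x + y))) =
        (fun i j k => tcoord₃ e i j k (inclLeft K x)) +
          fun i j k => tcoord₃ e i j k (inclLeft K y) := by
        ext i j k; rw [map_add, map_add]; rfl
      rw [this]
      exact add_mem hx hy
    | tmul A x =>
      refine AddSubgroup.subset_closure ⟨_, hK A.1 A.2, fun k => e.coord k x, Or.inr ?_⟩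
      ext i j k
      exact tcoord₃_assoc e i j k A.1 x
  · induction b with
    | zero =>
      simp only [map_zero]
      exact zero_mem (tensorSpan K')
    | add x y hx hy =>
      have : (fun i j k => tcoord₃ e i j k (inclRight K (x + y))) =
        (fun i j k => tcoord₃ e i j k (inclRight K x)) +
          fun i j k => tcoord₃ e i j k (inclRight K y) := by
        ext i j k; rw [map_add, map_add]; rfl
      rw [this]
      exact add_mem hx hy
    | tmul x A =>
      refine AddSubgroup.subset_closure ⟨_, hK A.1 A.2, fun k => e.coord k x, Or.inl ?_⟩
      ext i j k
      exact tcoord₃_tmul e i j k x A.1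

/-- If the brackets modulo `K` form a free group, they are detected by alternating forms. -/
theorem mem_of_alternating {K : Submodule ℤ (M ⊗[ℤ] M)}
    (hK : ∀ A ∈ K, ∀ i j, tcoord₂ e j i A = -tcoord₂ e i j A)
    [hfree : Module.Free ℤ ((brackets₂ M).map (Submodule.mkQ K))] {b : Fin n → Fin n → ℤ}
    (hb : ∀ i j, b j i = -b i j)
    (ht : ∀ a : Fin n → Fin n → ℤ, (∀ j, a j j = 0) → (∀ j k, a k j = -a j k) →
      (∀ A ∈ K, ∑ j, ∑ k, (if j < k then a j k * tcoord₂ e j k A else 0) = 0) →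
      ∑ j, ∑ k, (if j < k then a j k * b j k else 0) = 0) : tensor₂ e b ∈ K := by
  let D : M ⊗[ℤ] M →ₗ[ℤ] (brackets₂ M).map (Submodule.mkQ K) :=
    (Submodule.mkQ K ∘ₗ bracket₂ M).codRestrict _ fun s => ⟨_, bracket₂_mem s, rfl⟩
  have hD : ∀ s, bracket₂ M s ∈ K → D s = 0 := fun s hs =>
    Subtype.ext ((Submodule.Quotient.mk_eq_zero K).mpr hs)
  have hsum : ∀ (f : (brackets₂ M).map (Submodule.mkQ K) →ₗ[ℤ] ℤ) (b : Fin n → Fin n → ℤ),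
      (∑ j, ∑ k, if j < k then (f ∘ₗ D) (e j ⊗ₜ e k) * b j k else 0) =
        (f ∘ₗ D) (tensor₂ e fun j k => if j < k then b j k else 0) := fun f b => by
    rw [map_tensor₂_half]
    refine Finset.sum_congr rfl fun j _ => Finset.sum_congr rfl fun k _ => ?_
    split_ifs
    · rw [smul_eq_mul, mul_comm]
    · rfl
  have hD0 : D (tensor₂ e fun j k => if j < k then b j k else 0) = 0 := by
    rw [← Module.forall_dual_apply_eq_zero_iff ℤ]
    intro f
    have hz : ∀ s, bracket₂ M s ∈ K → (f ∘ₗ D) s = 0 := fun s hs => by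
      rw [LinearMap.comp_apply, hD s hs, map_zero]
    refine (hsum f b).symm.trans (ht (fun j k => (f ∘ₗ D) (e j ⊗ₜ e k)) (fun j => hz _ ?_)
      (fun j k => ?_) fun A hA => (hsum f _).trans (hz _ ?_))
    · rw [bracket₂_tmul, sub_self]; exact zero_mem K
    · rw [eq_neg_iff_add_eq_zero, ← map_add]
      refine hz _ ?_
      rw [map_add, bracket₂_tmul, bracket₂_tmul, sub_add_sub_cancel, sub_self]
      exact zero_mem K
    · rw [bracket₂_half e (hK A hA), tensor₂_tcoord₂]
      exact hA
  have := (Submodule.Quotient.mk_eq_zero K).mp (congrArg Subtype.val hD0)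
  rwa [bracket₂_half e hb] at this

end Brackets

/-! ### Consequences of freeness of `P₂` and `P₃` -/

section Detection

attribute [local instance 10] ZSMul.toSMul instMulActionIntOfSubtractionMonoid
  AddGroup.intSMulWithZero instSMulWithZeroInt AddSubgroupClass.instZSMul

variable {U : Type u} [TopologicalSpace U] [PathConnectedSpace U] {n : ℕ} (B : Frame U n) {w : U}

theorem Frame.tcoord₂_comultBar (w : U) (z : HomologyTwo U) (i j : Fin n) :
    tcoord₂ B.e i j (comultBar w z) = B.delta z i j := by
  have h : ∀ i, B.e.coord i = kronecker U 0 (B.ξ i) := fun i =>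
    LinearMap.ext fun c => (B.kronecker_ξ i c).symm
  rw [B.delta_eq w, tcoord₂, h, h]
  rfl

theorem Frame.tcoord₂_antisymm (w : U) {A : HomologyOne U ⊗[ℤ] HomologyOne U}
    (hA : A ∈ LinearMap.range (comultBar w)) (i j : Fin n) :
    tcoord₂ B.e j i A = -tcoord₂ B.e i j A := by
  obtain ⟨z, rfl⟩ := hA
  rw [B.tcoord₂_comultBar, B.tcoord₂_comultBar]
  exact (B.isMarked w).rel₂_antisymm ((B.mem_rel₂_iff _).mpr ⟨z, rfl⟩) i j

theorem Frame.tcoord₂_mem (w : U) {A : HomologyOne U ⊗[ℤ] HomologyOne U}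
    (hA : A ∈ LinearMap.range (comultBar w)) :
    (fun i j => tcoord₂ B.e i j A) ∈ (B.isMarked w).rel₂ := by
  obtain ⟨z, rfl⟩ := hA
  exact (B.mem_rel₂_iff _).mpr ⟨z, funext fun i => funext fun j => (B.tcoord₂_comultBar w z i j).symm⟩

theorem Frame.separated (h : Module.Free ℤ (P3 w)) : (B.isMarked w).Separated := by
  intro y hy hT
  obtain ⟨t, ht⟩ := exists_bracket₃_eq B.e hy
  refine coords_mem_tensorSpan B.e (K := LinearMap.range (comultBar w))
    (fun A hA => B.tcoord₂_mem w hA) ?_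
  rw [← ht]
  refine mem_of_symLift B.e (hfree := h) (fun A hA => B.tcoord₂_antisymm w hA)
    fun T hT₁ hT₂ => ?_
  have e1 : (fun i j k => tcoord₃ B.e i j k (bracket₃ _ t)) = (magnus y).deg₃ := by
    funext i j k
    rw [ht, tcoord₃_tensor₃]
  rw [e1]
  refine hT T ⟨hT₁, fun b hb i => ?_⟩
  obtain ⟨z, rfl⟩ := (B.mem_rel₂_iff b).mp hb
  have := hT₂ _ ⟨z, rfl⟩ i
  simp only [B.tcoord₂_comultBar] at this
  exact this

theorem Frame.mem_rel₂_of_RBar2 (h : Module.Free ℤ (P2 w)) {b : Fin n → Fin n → ℤ}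
    (hb : ∀ i j, b j i = -b i j) (hr : ∀ r ∈ RBar2 U,
      ∑ j, ∑ k, (if j < k then wedgeCoord B.ξ j k r * b j k else 0) = 0) :
    b ∈ (B.isMarked w).rel₂ := by
  have h1 : tensor₂ B.e b ∈ LinearMap.range (comultBar w) := by
    refine mem_of_alternating B.e (hfree := h) (fun A hA => B.tcoord₂_antisymm w hA) hb
      fun a ha₀ ha₁ ha₂ => ?_
    have hw := wedgeCoord_sum B.ξ ha₀ ha₁
    have := hr (∑ p, ∑ q, if p < q then a p q • eta₂ _ (B.ξ p ⊗ₜ B.ξ q) else 0)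
      ((B.mem_RBar2_iff w _).mpr fun z => by
        simp only [hw]
        have := ha₂ _ ⟨z, rfl⟩
        simp only [B.tcoord₂_comultBar] at this
        exact this)
    simp only [hw] at this
    exact this
  have h2 := B.tcoord₂_mem w h1
  simp only [tcoord₂_tensor₂] at h2
  exact h2

end Detection

section Transport

attribute [local instance 10] ZSMul.toSMul instMulActionIntOfSubtractionMonoid
  AddGroup.intSMulWithZero instSMulWithZeroInt AddSubgroupClass.instZSMul

variable {M N : Type*} [AddCommGroup M] [Module ℤ M] [AddCommGroup N] [Module ℤ N] {n : ℕ}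
  {ξ : Module.Basis (Fin n) ℤ M} {ξ' : Module.Basis (Fin n) ℤ N} {φ : M →ₗ[ℤ] N}

theorem coord_map (h : ∀ i, φ (ξ i) = ξ' i) (i : Fin n) (x : M) :
    ξ'.coord i (φ x) = ξ.coord i x := by
  suffices H : ξ'.coord i ∘ₗ φ = ξ.coord i from LinearMap.congr_fun H x
  refine ξ.ext fun j => ?_
  rw [LinearMap.comp_apply, h, coord_basis, coord_basis]

theorem map_eta₂ (φ : M →ₗ[ℤ] N) (t : M ⊗[ℤ] M) :
    exteriorPower.map 2 φ (eta₂ M t) = eta₂ N (TensorProduct.map φ φ t) := by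
  suffices H : exteriorPower.map 2 φ ∘ₗ eta₂ M = eta₂ N ∘ₗ TensorProduct.map φ φ from
    LinearMap.congr_fun H t
  refine TensorProduct.ext' fun x y => ?_
  rw [LinearMap.comp_apply, LinearMap.comp_apply, TensorProduct.map_tmul, eta₂_tmul, eta₂_tmul,
    exteriorPower.map_apply_ιMulti]
  congr 1
  ext i
  fin_cases i <;> rfl

theorem wedgeCoord_map (h : ∀ i, φ (ξ i) = ξ' i) (j k : Fin n) (r : ⋀[ℤ]^2 M) :
    wedgeCoord ξ' j k (exteriorPower.map 2 φ r) = wedgeCoord ξ j k r := by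
  obtain ⟨t, rfl⟩ := eta₂_surjective r
  rw [map_eta₂, wedgeCoord_eta₂, wedgeCoord_eta₂]
  have : ∀ j k, tcoord₂ ξ' j k ∘ₗ TensorProduct.map φ φ = tcoord₂ ξ j k := fun j k =>
    TensorProduct.ext' fun x y => by
      rw [LinearMap.comp_apply, TensorProduct.map_tmul, tcoord₂_tmul, tcoord₂_tmul,
        coord_map h, coord_map h]
  rw [← LinearMap.comp_apply, ← LinearMap.comp_apply, this, this]

theorem wedgeCoord_ext {r s : ⋀[ℤ]^2 M} (h : ∀ j k, wedgeCoord ξ j k r = wedgeCoord ξ j k s) :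
    r = s := by
  rw [sum_wedgeCoord ξ r, sum_wedgeCoord ξ s]
  simp only [h]

theorem exists_map_eq (h : ∀ i, φ (ξ i) = ξ' i) (r : ⋀[ℤ]^2 N) :
    ∃ s : ⋀[ℤ]^2 M, exteriorPower.map 2 φ s = r :=
  ⟨∑ p, ∑ q, if p < q then wedgeCoord ξ' p q r • eta₂ M (ξ p ⊗ₜ ξ q) else 0,
    wedgeCoord_ext (ξ := ξ') fun j k => by
      rw [wedgeCoord_map h, wedgeCoord_sum ξ (fun j => wedgeCoord_self ξ' j r)
        (fun j k => wedgeCoord_anti ξ' j k r)]⟩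

theorem alphaCoord_map (h : ∀ i, φ (ξ i) = ξ' i) (i j k : Fin n) (t : M ⊗[ℤ] (⋀[ℤ]^2 M)) :
    alphaCoord ξ' i j k (TensorProduct.map φ (exteriorPower.map 2 φ) t) = alphaCoord ξ i j k t := by
  suffices H : alphaCoord ξ' i j k ∘ₗ TensorProduct.map φ (exteriorPower.map 2 φ) =
      alphaCoord ξ i j k from LinearMap.congr_fun H t
  refine TensorProduct.ext' fun x r => ?_
  rw [LinearMap.comp_apply, TensorProduct.map_tmul]
  simp only [alphaCoord, LinearMap.comp_apply, TensorProduct.map_tmul, LinearEquiv.coe_coe,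
    TensorProduct.lid_tmul, smul_eq_mul, coord_map h, wedgeCoord_map h]

end Transport

/-! ### Comparison of two spaces -/

section Comparison

attribute [local instance 10] ZSMul.toSMul instMulActionIntOfSubtractionMonoid
  AddGroup.intSMulWithZero instSMulWithZeroInt AddSubgroupClass.instZSMul

variable {U : Type u} {V : Type v} [TopologicalSpace U] [TopologicalSpace V]
  [PathConnectedSpace U] [PathConnectedSpace V] {x : U} {y : V} {n : ℕ}
  {B : Frame U n} {B' : Frame V n} {φ : CohomologyOne V →ₗ[ℤ] CohomologyOne U}

theorem map_RBar2_of_rel₂_eq (hφ : ∀ i, φ (B'.ξ i) = B.ξ i)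
    (h : (B.isMarked x).rel₂ = (B'.isMarked y).rel₂) :
    (RBar2 V).map (exteriorPower.map 2 φ) = RBar2 U := by
  have key : ∀ r, exteriorPower.map 2 φ r ∈ RBar2 U ↔ r ∈ RBar2 V := fun r => by
    rw [B.mem_RBar2_iff x, B'.mem_RBar2_iff y]
    simp only [wedgeCoord_map hφ]
    constructor
    · intro H z
      obtain ⟨z', hz'⟩ := (B.mem_rel₂_iff (w := x) (B'.delta z)).mp
        (h ▸ (B'.mem_rel₂_iff _).mpr ⟨z, rfl⟩)
      rw [← hz']
      exact H z'
    · intro H z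
      obtain ⟨z', hz'⟩ := (B'.mem_rel₂_iff (w := y) (B.delta z)).mp
        (h ▸ (B.mem_rel₂_iff _).mpr ⟨z, rfl⟩)
      rw [← hz']
      exact H z'
  ext r
  constructor
  · rintro ⟨s, hs, rfl⟩
    exact (key s).mpr hs
  · intro hr
    obtain ⟨s, rfl⟩ := exists_map_eq hφ r
    exact ⟨s, (key s).mp hr, rfl⟩

theorem rel₂_eq_of_map_RBar2 (hφ : ∀ i, φ (B'.ξ i) = B.ξ i) (hU : Module.Free ℤ (P2 x))
    (hV : Module.Free ℤ (P2 y)) (h : (RBar2 V).map (exteriorPower.map 2 φ) = RBar2 U) :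
    (B.isMarked x).rel₂ = (B'.isMarked y).rel₂ := by
  ext b
  constructor
  · intro hb
    refine B'.mem_rel₂_of_RBar2 hV ((B.isMarked x).rel₂_antisymm hb) fun r hr => ?_
    obtain ⟨z, rfl⟩ := (B.mem_rel₂_iff _).mp hb
    have := (B.mem_RBar2_iff x _).mp (h ▸ Submodule.mem_map_of_mem hr) z
    simp only [wedgeCoord_map hφ] at this
    exact this
  · intro hb
    refine B.mem_rel₂_of_RBar2 hU ((B'.isMarked y).rel₂_antisymm hb) fun r hr => ?_
    obtain ⟨z, rfl⟩ := (B'.mem_rel₂_iff _).mp hb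
    rw [← h] at hr
    obtain ⟨s, hs, rfl⟩ := hr
    have := (B'.mem_RBar2_iff y _).mp hs z
    simp only [wedgeCoord_map hφ]
    exact this

/-- Every functional on `H^2` is the pairing with a class in `H_2`. -/
theorem Frame.exists_homologyTwo {w : U} (B : Frame U n) (hinj : Function.Injective (comultBar w))
    (f : CohomologyTwo U →ₗ[ℤ] ℤ) : ∃ z, ∀ c, kronecker U 1 c z = f c := by
  have := B.finite_homologyTwo hinj
  have := B.free_homologyTwo hinj
  let K : CohomologyTwo U ≃ₗ[ℤ] Module.Dual ℤ (HomologyTwo U) := LinearEquiv.ofBijective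
    (kronecker U 1) ⟨B.kronecker_one_injective w, B.kronecker_one_surjective w⟩
  obtain ⟨z, hz⟩ := (Module.bijective_dual_eval ℤ (HomologyTwo U)).2 (f ∘ₗ K.symm.toLinearMap)
  refine ⟨z, fun c => ?_⟩
  have := LinearMap.congr_fun hz (K c)
  exact this.trans (congrArg f (K.symm_apply_apply c))

theorem rel₂_le_of_cup {φ : CohomologyOne V →ₗ[ℤ] CohomologyOne U}
    (hφ : ∀ i, φ (B'.ξ i) = B.ξ i) (hinj : Function.Injective (comultBar y))
    {ψ : CohomologyTwo V →ₗ[ℤ] CohomologyTwo U} (hψ : ∀ a b, ψ (cup a b) = cup (φ a) (φ b))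
    (z : HomologyTwo U) : ∃ z', B'.delta z' = B.delta z ∧
      ∀ c, kronecker V 1 c z' = kronecker U 1 (ψ c) z := by
  obtain ⟨z', hz'⟩ := B'.exists_homologyTwo hinj ((kronecker U 1).flip z ∘ₗ ψ)
  refine ⟨z', ?_, hz'⟩
  ext i j
  rw [B'.delta_apply, hz', B.delta_apply, ← hφ, ← hφ, ← hψ]
  rfl

theorem rel₂_le (h : ∀ z : HomologyTwo U, ∃ z', B'.delta z' = B.delta z) :
    (B.isMarked x).rel₂ ≤ (B'.isMarked y).rel₂ := fun b hb => by
  obtain ⟨z, rfl⟩ := (B.mem_rel₂_iff _).mp hb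
  exact (B'.mem_rel₂_iff _).mpr (h z)

theorem rel₂_eq_of_cup (hφ : ∀ i, φ (B'.ξ i) = B.ξ i) (hinj : Function.Injective (comultBar x))
    (hinj' : Function.Injective (comultBar y)) (ψ : CohomologyTwo V ≃ₗ[ℤ] CohomologyTwo U)
    (hψ : ∀ a b, ψ (cup a b) = cup (φ a) (φ b)) :
    (B.isMarked x).rel₂ = (B'.isMarked y).rel₂ := by
  let θ : CohomologyOne U →ₗ[ℤ] CohomologyOne V := B.ξ.constr ℤ B'.ξ
  have hθ : ∀ i, θ (B.ξ i) = B'.ξ i := fun i => B.ξ.constr_basis ℤ _ i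
  have hφθ : ∀ a, φ (θ a) = a := fun a => by
    have : φ ∘ₗ θ = LinearMap.id := B.ξ.ext fun i => by
      rw [LinearMap.comp_apply, hθ, hφ, LinearMap.id_apply]
    exact LinearMap.congr_fun this a
  refine le_antisymm (rel₂_le fun z => ?_) (rel₂_le fun z => ?_)
  · obtain ⟨z', hz', -⟩ := rel₂_le_of_cup (ψ := ψ.toLinearMap) hφ hinj' hψ z
    exact ⟨z', hz'⟩
  · obtain ⟨z', hz', -⟩ := rel₂_le_of_cup (ψ := ψ.symm.toLinearMap) hθ hinj (fun a b => by
      rw [LinearEquiv.coe_coe, LinearEquiv.symm_apply_eq, hψ, hφθ, hφθ]) z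
    exact ⟨z', hz'⟩

theorem exists_cohomologyTwo_equiv (hφ : ∀ i, φ (B'.ξ i) = B.ξ i)
    (hinj : Function.Injective (comultBar x)) (hinj' : Function.Injective (comultBar y))
    (h : (B.isMarked x).rel₂ = (B'.isMarked y).rel₂) :
    ∃ ψ : CohomologyTwo V ≃ₗ[ℤ] CohomologyTwo U, (∀ a b, ψ (cup a b) = cup (φ a) (φ b)) ∧
      ∀ c z z', B.delta z = B'.delta z' → kronecker U 1 (ψ c) z = kronecker V 1 c z' := by
  have hr : LinearMap.range B.delta = LinearMap.range B'.delta := by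
    ext b
    exact ((B.mem_rel₂_iff (w := x) b).symm.trans (h ▸ Iff.rfl)).trans
      (B'.mem_rel₂_iff (w := y) b)
  let θ : HomologyTwo U ≃ₗ[ℤ] HomologyTwo V :=
    (LinearEquiv.ofInjective B.delta (B.delta_injective hinj)).trans
      ((LinearEquiv.ofEq _ _ hr).trans
        (LinearEquiv.ofInjective B'.delta (B'.delta_injective hinj')).symm)
  have hθ : ∀ z, B'.delta (θ z) = B.delta z := fun z => by
    have := (LinearEquiv.ofInjective B'.delta (B'.delta_injective hinj')).apply_symm_apply
      (LinearEquiv.ofEq _ _ hr (LinearEquiv.ofInjective B.delta (B.delta_injective hinj) z))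
    exact congrArg Subtype.val this
  let K : CohomologyTwo U ≃ₗ[ℤ] Module.Dual ℤ (HomologyTwo U) := LinearEquiv.ofBijective
    (kronecker U 1) ⟨B.kronecker_one_injective x, B.kronecker_one_surjective x⟩
  let K' : CohomologyTwo V ≃ₗ[ℤ] Module.Dual ℤ (HomologyTwo V) := LinearEquiv.ofBijective
    (kronecker V 1) ⟨B'.kronecker_one_injective y, B'.kronecker_one_surjective y⟩
  let ψ : CohomologyTwo V ≃ₗ[ℤ] CohomologyTwo U := K'.trans (θ.dualMap.trans K.symm)
  have hψ : ∀ c z, kronecker U 1 (ψ c) z = kronecker V 1 c (θ z) := fun c z =>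
    LinearMap.congr_fun (K.apply_symm_apply (θ.dualMap (K' c))) z
  refine ⟨ψ, fun a b => ?_, fun c z z' hz => ?_⟩
  · have : cup.compr₂ ψ.toLinearMap = cup.compl₁₂ φ φ := by
      refine B'.ξ.ext fun i => B'.ξ.ext fun j => ?_
      refine B.kronecker_one_injective x (LinearMap.ext fun z => ?_)
      change kronecker U 1 (ψ (cup _ _)) z = kronecker U 1 (cup (φ _) (φ _)) z
      rw [hψ, hφ, hφ]
      exact congrFun (congrFun (hθ z) i) j
    exact LinearMap.congr_fun (LinearMap.congr_fun this a) b
  · rw [hψ]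
    exact congrArg _ (B'.delta_injective hinj' ((hθ z).trans hz))

end Comparison

section Comparison

variable {U : Type u} {V : Type v} [TopologicalSpace U] [TopologicalSpace V]
  [PathConnectedSpace U] [PathConnectedSpace V] {x : U} {y : V} {n : ℕ}
  {B : Frame U n} {B' : Frame V n} {φ : CohomologyOne V →ₗ[ℤ] CohomologyOne U}

theorem Frame.tensorOf_map (hφ : ∀ i, φ (B'.ξ i) = B.ξ i)
    (t : CohomologyOne V ⊗[ℤ] (⋀[ℤ]^2 (CohomologyOne V))) :
    B.tensorOf (TensorProduct.map φ (exteriorPower.map 2 φ) t) = B'.tensorOf t := by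
  unfold Frame.tensorOf
  simp only [alphaCoord_map hφ]

theorem Frame.tensorOf_bracketTensor {T : Fin n → Fin n → Fin n → ℤ} (hT : IsBracketLike T) :
    B.tensorOf (bracketTensor B.ξ T) = symLift T := by
  unfold Frame.tensorOf
  simp only [alphaCoord_bracketTensor B.ξ hT]

theorem map_mem_QBar3 (hφ : ∀ i, φ (B'.ξ i) = B.ξ i)
    (h : (B.isMarked x).rel₂ = (B'.isMarked y).rel₂) (t : QBar3 V) :
    TensorProduct.map φ (exteriorPower.map 2 φ) t.1 ∈ QBar3 U := by
  have h1 := B'.killsBrackets_of_mem y t.2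
  have h2 : (B.isMarked x).KillsBrackets fun i j k => alphaCoord B'.ξ i j k t.1 :=
    ⟨h1.toIsBracketLike, h ▸ h1.rel⟩
  have h3 := B.bracketTensor_mem x h2
  have h4 := bracketTensor_alphaCoord B.ξ (TensorProduct.map φ (exteriorPower.map 2 φ) t.1)
  simp only [alphaCoord_map hφ] at h4
  rwa [h4] at h3

theorem isAlt_sub {C C' : Fin n → Fin n → Fin n → ℤ} (h : IsAlt C) (h' : IsAlt C') :
    IsAlt fun l j k => C l j k - C' l j k where
  self i j := by rw [h.self, h'.self, sub_zero]
  anti i j k := by rw [h.anti, h'.anti]; ring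

theorem pair₃_derive_sub (S C C' : Fin n → Fin n → Fin n → ℤ) (b : Fin n → Fin n → ℤ) :
    pair₃ S (MagnusGroup.derive (fun l j k => C l j k - C' l j k) b) =
      pair₃ S (MagnusGroup.derive C b) - pair₃ S (MagnusGroup.derive C' b) := by
  have := pair₃_derive_add S (fun l j k => C l j k - C' l j k) C' b
  simp only [sub_add_cancel] at this
  linarith

theorem neg_pair₃_add_eq {S C d d' : Fin n → Fin n → Fin n → ℤ} {b b' : Fin n → Fin n → ℤ}
    (hb : b = b') (h : pair₃ S d' = pair₃ S d + pair₃ S (MagnusGroup.derive C b)) :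
    -pair₃ S d + pair₃ S (MagnusGroup.derive (fun _ _ _ => 0) b) =
      -pair₃ S d' + pair₃ S (MagnusGroup.derive C b') := by
  have h0 : pair₃ S (MagnusGroup.derive (fun _ _ _ => 0) b) = 0 := by
    simp [pair₃, MagnusGroup.derive]
  rw [h0, h, hb]
  ring

theorem Frame.Represents.eval {L : QBar3 U →ₗ[ℤ] CohomologyTwo U} {C : Fin n → Fin n → Fin n → ℤ}
    (hL : B.Represents x L C) {t : QBar3 U} {S : Fin n → Fin n → Fin n → ℤ}
    (ht : B.tensorOf t.1 = S) {z : HomologyTwo U} {r : FreeGroup (Fin n)}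
    (hr : r ∈ relSub (B.gens x) 3) (hz : (magnus r).deg₂ = B.delta z) :
    kronecker U 1 (L t) z = -pair₃ S (magnus r).deg₃ +
      pair₃ S (MagnusGroup.derive C (magnus r).deg₂) := by
  subst ht
  rw [hz]
  exact hL t z r hr hz

/-- The relation between cubic coefficients given by corresponding Massey classes. -/
def Frame.CubicMatch (B : Frame U n) (x : U) (B' : Frame V n) (y : V)
    (C : Fin n → Fin n → Fin n → ℤ) : Prop :=
  ∀ T, (B'.isMarked y).KillsBrackets T → ∀ r ∈ relSub (B.gens x) 3,
    ∀ r' ∈ relSub (B'.gens y) 3, (magnus r).deg₂ = (magnus r').deg₂ →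
    pair₃ (symLift T) (magnus r').deg₃ = pair₃ (symLift T) (magnus r).deg₃ +
      pair₃ (symLift T) (MagnusGroup.derive C (magnus r).deg₂)

theorem Frame.cubicMatch_of_represents (hφ : ∀ i, φ (B'.ξ i) = B.ξ i)
    (hinj' : Function.Injective (comultBar y)) {ψ : CohomologyTwo V →ₗ[ℤ] CohomologyTwo U}
    (hψ : ∀ a b, ψ (cup a b) = cup (φ a) (φ b)) {L : QBar3 U →ₗ[ℤ] CohomologyTwo U}
    {L' : QBar3 V →ₗ[ℤ] CohomologyTwo V} {C C' : Fin n → Fin n → Fin n → ℤ}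
    (hL : B.Represents x L C) (hL' : B'.Represents y L' C')
    (H : ∀ t : QBar3 V, ∃ s : QBar3 U,
      s.1 = TensorProduct.map φ (exteriorPower.map 2 φ) t.1 ∧ L s = ψ (L' t)) :
    B.CubicMatch x B' y fun l j k => C' l j k - C l j k := by
  intro T hT r hr r' hr' e
  have ht : ∃ t : QBar3 V, B'.tensorOf t.1 = symLift T :=
    ⟨⟨_, B'.bracketTensor_mem y hT⟩, Frame.tensorOf_bracketTensor hT.toIsBracketLike⟩
  obtain ⟨t, ht⟩ := ht
  obtain ⟨s, hs, hst⟩ := H t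
  have hs' : B.tensorOf s.1 = symLift T := ((congrArg _ hs).trans (Frame.tensorOf_map hφ t.1)).trans ht
  obtain ⟨z, hz⟩ := (B.mem_rel₂_iff (w := x) (magnus r).deg₂).mp ⟨r, hr, rfl⟩
  obtain ⟨z', hz', hzz⟩ := rel₂_le_of_cup hφ hinj' hψ z
  have e1 := hL.eval hs' hr hz.symm
  have e2 := hL'.eval ht hr' (e.symm.trans (hz'.trans hz).symm)
  have e4 := (congrArg (fun c => kronecker U 1 c z) hst).trans (hzz _).symm
  have e5 := e1.symm.trans (e4.trans e2)
  rw [pair₃_derive_sub]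
  rw [← e] at e5
  linarith

set_option maxHeartbeats 1000000 in
theorem Frame.eq_of_cubicMatch (hφ : ∀ i, φ (B'.ξ i) = B.ξ i)
    (h : (B.isMarked x).rel₂ = (B'.isMarked y).rel₂) {ψ : CohomologyTwo V →ₗ[ℤ] CohomologyTwo U}
    (hψ : ∀ c z z', B.delta z = B'.delta z' → kronecker U 1 (ψ c) z = kronecker V 1 c z')
    {L : QBar3 U →ₗ[ℤ] CohomologyTwo U}
    {L' : QBar3 V →ₗ[ℤ] CohomologyTwo V} {C : Fin n → Fin n → Fin n → ℤ}
    (hL : B.Represents x L fun _ _ _ => 0) (hL' : B'.Represents y L' C)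
    (H : B.CubicMatch x B' y C) {s : QBar3 U} {t : QBar3 V}
    (hs : s.1 = TensorProduct.map φ (exteriorPower.map 2 φ) t.1) : L s = ψ (L' t) := by
  have hst : B.tensorOf s.1 = B'.tensorOf t.1 := (congrArg _ hs).trans (Frame.tensorOf_map hφ t.1)
  refine B.kronecker_one_injective x (LinearMap.ext fun z => ?_)
  obtain ⟨r, hr, er⟩ : B.delta z ∈ (B.isMarked x).rel₂ := (B.mem_rel₂_iff _).mpr ⟨z, rfl⟩
  obtain ⟨r', hr', er'⟩ : B.delta z ∈ (B'.isMarked y).rel₂ := h ▸ (B.mem_rel₂_iff _).mpr ⟨z, rfl⟩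
  obtain ⟨z', hz'⟩ := (B'.mem_rel₂_iff (w := y) (B.delta z)).mp ⟨r', hr', er'⟩
  have e1 := hL.eval hst hr er
  have e2 := hL'.eval (t := t) rfl hr' (er'.trans hz'.symm)
  have e3 := H _ (B'.killsBrackets_of_mem y t.2) r hr r' hr' (er.trans er'.symm)
  have e4 := hψ (L' t) z z' hz'.symm
  exact (e1.trans (neg_pair₃_add_eq (er.trans er'.symm) e3)).trans (e2.symm.trans e4.symm)

/-- The correspondence of the Massey classes in terms of cubic Magnus coefficients. -/
theorem classesCorrespond_iff (hφ : ∀ i, φ (B'.ξ i) = B.ξ i)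
    (hinj : Function.Injective (comultBar x)) (hinj' : Function.Injective (comultBar y)) :
    ClassesCorrespond φ B.ξ B'.ξ ↔ (B.isMarked x).rel₂ = (B'.isMarked y).rel₂ ∧
      ∃ C, IsAlt C ∧ B.CubicMatch x B' y C := by
  constructor
  · rintro ⟨ψ, hψ, L, hL, L', hL', H⟩
    obtain ⟨C, hC, hLC⟩ := B.exists_represents hinj hL
    obtain ⟨C', hC', hLC'⟩ := B'.exists_represents hinj' hL'
    exact ⟨rel₂_eq_of_cup hφ hinj hinj' ψ hψ, _, isAlt_sub hC' hC,
      Frame.cubicMatch_of_represents (ψ := ψ.toLinearMap) hφ hinj' hψ hLC hLC' H⟩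
  · rintro ⟨h, C, hC, H⟩
    obtain ⟨ψ, hψ, hψz⟩ := exists_cohomologyTwo_equiv hφ hinj hinj' h
    obtain ⟨L, hL, hLC⟩ := B.exists_mem_masseyClass x hinj
      (C := fun _ _ _ => 0) ⟨fun _ _ => rfl, fun _ _ _ => rfl⟩
    obtain ⟨L', hL', hLC'⟩ := B'.exists_mem_masseyClass y hinj' hC
    exact ⟨ψ, hψ, L, hL, L', hL', fun t => ⟨⟨_, map_mem_QBar3 hφ h t⟩, rfl,
      Frame.eq_of_cubicMatch (ψ := ψ.toLinearMap) hφ h hψz hLC hLC' H rfl⟩⟩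

end Comparison

section Comparison

variable {U : Type u} {V : Type v} [TopologicalSpace U] [TopologicalSpace V]
  [PathConnectedSpace U] [PathConnectedSpace V] {x : U} {y : V} {n : ℕ}
  {B : Frame U n} {B' : Frame V n} {φ : CohomologyOne V →ₗ[ℤ] CohomologyOne U}

theorem exists_fromPath_eq (g : FundamentalGroup U x) :
    ∃ α : Path x x, FundamentalGroup.fromPath (Path.Homotopic.Quotient.mk α) = g :=
  ⟨repLoop g⁻¹, (mk_repLoop _).trans (inv_inv g)⟩

theorem Frame.mark_eq_iff {f : HomologyOne U ≃ₗ[ℤ] HomologyOne V}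
    (hf : ∀ (c : CohomologyOne V) (h : HomologyOne U),
      kronecker U 0 (φ c) h = kronecker V 0 c (f h))
    (hφ : ∀ i, φ (B'.ξ i) = B.ξ i) (α : Path x x) (β : Path y y) :
    B.mark x (FundamentalGroup.fromPath (Path.Homotopic.Quotient.mk α)) =
      B'.mark y (FundamentalGroup.fromPath (Path.Homotopic.Quotient.mk β)) ↔
    f (loopClass α) = loopClass β := by
  have e1 : ∀ i, B.mark x (FundamentalGroup.fromPath (Path.Homotopic.Quotient.mk α)) i =
      -kronecker V 0 (B'.ξ i) (f (loopClass α)) := fun i => by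
    rw [Frame.mark, hurewicz_fromPath, map_neg, ← hφ, hf]
  have e2 : ∀ i, B'.mark y (FundamentalGroup.fromPath (Path.Homotopic.Quotient.mk β)) i =
      -kronecker V 0 (B'.ξ i) (loopClass β) := fun i => by
    rw [Frame.mark, hurewicz_fromPath, map_neg]
  rw [funext_iff]
  constructor
  · intro h
    rw [B'.sum_e (f (loopClass α)), B'.sum_e (loopClass β)]
    refine Finset.sum_congr rfl fun i _ => ?_
    have := h i
    rw [e1, e2, neg_inj] at this
    rw [this]
  · intro h i
    rw [e1, e2, h]

theorem Frame.extendsTo_iff {f : HomologyOne U ≃ₗ[ℤ] HomologyOne V}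
    (hf : ∀ (c : CohomologyOne V) (h : HomologyOne U),
      kronecker U 0 (φ c) h = kronecker V 0 c (f h))
    (hφ : ∀ i, φ (B'.ξ i) = B.ξ i) (k : ℕ) :
    ExtendsTo x y f (k + 1) ↔ IsoMod (B.mark x) (B'.mark y) k := by
  constructor
  · rintro ⟨F, hF⟩
    refine ⟨F, fun g g' h => ?_⟩
    obtain ⟨α, rfl⟩ := exists_fromPath_eq g
    obtain ⟨β, rfl⟩ := exists_fromPath_eq g'
    exact (mark_eq_iff hf hφ α β).mpr (hF α β h)
  · rintro ⟨F, hF⟩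
    exact ⟨F, fun α β h => (mark_eq_iff hf hφ α β).mp (hF _ _ h)⟩

/-- Dual bases of two spaces, matched by an isomorphism of `H_1`. -/
theorem exists_matched_frames {f : HomologyOne U ≃ₗ[ℤ] HomologyOne V}
    (hf : ∀ (c : CohomologyOne V) (h : HomologyOne U),
      kronecker U 0 (φ c) h = kronecker V 0 c (f h)) (hx : StandingConditions x) (y : V) :
    ∃ (n : ℕ) (B : Frame U n) (B' : Frame V n), ∀ i, φ (B'.ξ i) = B.ξ i := by
  obtain ⟨n, h1, -, -⟩ := hx
  obtain ⟨e⟩ := exists_basis_of_abelianization x h1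
  obtain ⟨B, hB⟩ := exists_frame_of_basis x e
  obtain ⟨B', hB'⟩ := exists_frame_of_basis y (e.map f)
  refine ⟨n, B, B', fun i => kronecker_zero_injective x (LinearMap.ext fun c => ?_)⟩
  rw [hf, B'.kronecker_ξ, B.kronecker_ξ, hB, hB', Module.Basis.map_repr, LinearEquiv.trans_apply,
    LinearEquiv.symm_apply_apply]

end Comparison

end TripleMassey

end

theorem mainTheorem3 {Ua : Type u} {Ub : Type v} [TopologicalSpace Ua] [TopologicalSpace Ub]
    [PathConnectedSpace Ua] [PathConnectedSpace Ub] (ua : Ua) (ub : Ub)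
    (ha : StandingConditions ua) (hb : StandingConditions ub)
    (f : HomologyOne Ua ≃ₗ[ℤ] HomologyOne Ub)
    (φ : CohomologyOne Ub →ₗ[ℤ] CohomologyOne Ua)
    (hφ : ∀ (x : CohomologyOne Ub) (w : HomologyOne Ua),
      kronecker Ua 0 (φ x) w = kronecker Ub 0 x (f w)) :
    (ExtendsTo ua ub f 3 → (RBar2 Ub).map (exteriorPower.map 2 φ) = RBar2 Ua) ∧
    (Module.Free ℤ (P2 ua) → Module.Free ℤ (P2 ub) →
      (ExtendsTo ua ub f 3 ↔ (RBar2 Ub).map (exteriorPower.map 2 φ) = RBar2 Ua)) ∧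
    ((RBar2 Ub).map (exteriorPower.map 2 φ) = RBar2 Ua →
      Module.Free ℤ (P3 ua) → Module.Free ℤ (P3 ub) →
      ∀ (n : ℕ) (ξa : Module.Basis (Fin n) ℤ (CohomologyOne Ua))
        (ξb : Module.Basis (Fin n) ℤ (CohomologyOne Ub)), (∀ i, φ (ξb i) = ξa i) →
        (ExtendsTo ua ub f 4 ↔ ClassesCorrespond φ ξa ξb)) := by
  refine ⟨fun h => ?_, fun hfa hfb => ?_, fun hR hfa hfb n ξa ξb hξ => ?_⟩
  · obtain ⟨n, B, B', hB⟩ := exists_matched_frames hφ ha ub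
    exact map_RBar2_of_rel₂_eq hB
      ((isoMod_two_iff (B.isMarked ua) (B'.isMarked ub)).mp ((Frame.extendsTo_iff hφ hB 2).mp h))
  · obtain ⟨n, B, B', hB⟩ := exists_matched_frames hφ ha ub
    rw [Frame.extendsTo_iff hφ hB 2, isoMod_two_iff (B.isMarked ua) (B'.isMarked ub)]
    exact ⟨map_RBar2_of_rel₂_eq hB, rel₂_eq_of_map_RBar2 hB hfa hfb⟩
  · obtain ⟨m, hm, -, hinj⟩ := ha
    obtain ⟨m', hm', -, hinj'⟩ := hb
    obtain ⟨e⟩ := exists_basis_of_abelianization ua hm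
    obtain ⟨e'⟩ := exists_basis_of_abelianization ub hm'
    obtain ⟨B, rfl⟩ := exists_frame_of_cobasis ua e ξa
    obtain ⟨B', rfl⟩ := exists_frame_of_cobasis ub e' ξb
    rw [Frame.extendsTo_iff hφ hξ 3, classesCorrespond_iff hξ hinj hinj']
    exact isoMod_three_iff (B.isMarked ua) (B'.isMarked ub) (B'.determined hinj')
      (B.separated hfa) (B'.separated hfb)
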